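/- Work on a unit-cost word RAM with logarithmic word size: a program is a fixed finite list of instructions (constants, arithmetic and bitwise operations, indirect loads and stores, jumps and conditional jumps), each of cost $1$, operating on memory words of $\ell$ bits; on an input of length $n$ it must work for every $\ell$ with $2^\ell\ge c\,n$, where $c$ is a constant that depends only on the program. Let $w$ be a nonempty word of length $n$ over an integer alphabet $\{1,\dots,\sigma\}$ with $\sigma\le\max(2,n)$. Two words are conjugates if they can be written as $xy$ and $yx$, and the circular word $w_\circ$ is the set of all conjugates of $w$. For a nonempty word $u$, let $u^{n/|u|}$ be the prefix of length $n$ of the infinite word $uuu\cdots$. A pair $(u,n)$ with $u$ nonempty is a representation of $w_\circ$ if $|u|\le n=|w|$ and $u^{n/|u|}\in w_\circ$. A representation $(v,n)$ of $w_\circ$ is minimal if for every other representation $(u,n)$ of $w_\circ$ either $|v|<|u|$, or $|v|=|u|$ and $v$ is lexicographically smaller than $u$. Theorem. There is an algorithm (one fixed program) that, given $w$ and its length $n$, computes in $\mathcal{O}(n)$ time the minimal representation $(v,n)$ of $w_\circ$, together with a position $i\in\{1,\dots,n\}$ and the conjugate $w[i:n]\,w[1:i-1]$ of $w$, which satisfies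 $w[i:n]\,w[1:i-1]=v^{n/|v|}$. The words $v$ and $w[i:n]\,w[1:i-1]$ are written out explicitly in memory. -/

import Mathlib

/-! ## Circular words and their representations -/

/-- The circular word of `w`: the set of all conjugates of `w`. -/
def circularWord {α : Type*} (w : List α) : Set (List α) := {u | u ~r w}

/-- Conjugacy in the usual form: `u = xy` and `w = yx`. -/
theorem mem_circularWord_iff {α : Type*} (u w : List α) :
    u ∈ circularWord w ↔ ∃ x y : List α, u = x ++ y ∧ w = y ++ x := by
  constructor
  · rintro ⟨k, hk⟩
    refine ⟨u.take (k % u.length), u.drop (k % u.length), by simp, ?_⟩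
    rw [← hk, List.rotate_eq_drop_append_take_mod]
  · rintro ⟨x, y, rfl, rfl⟩
    exact List.isRotated_append

/-- For a nonempty word `u`, the power `u ^ (n / |u|)`: the prefix of length `n` of the infinite
word `uuu⋯` (the word `u ^ n` is already long enough to contain it). -/
def fracPow {α : Type*} (u : List α) (n : ℕ) : List α :=
  (List.replicate n u).flatten.take n

/-- The pair `r = (u, n)` is a representation of the circular word of `w`. -/
def IsRepresentation {α : Type*} (w : List α) (r : List α × ℕ) : Prop :=
  r.1 ≠ [] ∧ r.1.length ≤ r.2 ∧ r.2 = w.length ∧ fracPow r.1 r.2 ∈ circularWord w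

/-- The pair `r = (u, n)` is a minimal representation of the circular word of `w`. The order
`<` on lists is the lexicographic order. -/
def IsMinimalRepresentation {α : Type*} [LinearOrder α] (w : List α) (r : List α × ℕ) : Prop :=
  IsRepresentation w r ∧
    ∀ r' : List α × ℕ, IsRepresentation w r' → r' ≠ r →
      r.1.length < r'.1.length ∨ (r.1.length = r'.1.length ∧ r.1 < r'.1)

/-! ## The unit-cost word RAM

Every memory word consists of `ℓ` bits, that is, holds a number below `2 ^ ℓ`. A program is a
finite list of instructions and every instruction costs one step. -/

namespace WordRAM

/-- Arithmetic and bitwise operations. -/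
inductive BinOp where
  | add | sub | mul | div | mod | and | or | xor | shl | shr

/-- The value of an operation on words of `ℓ` bits; results are reduced modulo `2 ^ ℓ`.
Subtraction is truncated at `0`, and `x / 0 = 0`, `x % 0 = x`. -/
def BinOp.eval (ℓ : ℕ) (o : BinOp) (x y : ℕ) : ℕ :=
  (match o with
    | .add => x + y
    | .sub => x - y
    | .mul => x * y
    | .div => x / y
    | .mod => x % y
    | .and => x &&& y
    | .or => x ||| y
    | .xor => x ^^^ y
    | .shl => x <<< y
    | .shr => x >>> y) % 2 ^ ℓ

/-- Instructions; `d`, `a`, `b` are names of registers and `t` is a position in the program. -/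
inductive Instr where
  /-- `R[d] := c` -/
  | const (d c : ℕ)
  /-- `R[d] := R[a] ∘ R[b]` -/
  | op (o : BinOp) (d a b : ℕ)
  /-- `R[d] := M[R[a]]` -/
  | load (d a : ℕ)
  /-- `M[R[a]] := R[b]` -/
  | store (a b : ℕ)
  /-- `goto t` -/
  | jump (t : ℕ)
  /-- `if R[a] = R[b] then goto t` -/
  | jumpEq (a b t : ℕ)
  /-- `if R[a] < R[b] then goto t` -/
  | jumpLt (a b t : ℕ)

/-- A configuration: program counter, registers and memory. -/
structure Config where
  pc : ℕ
  reg : ℕ → ℕ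
  mem : ℕ → ℕ

/-- The effect of one instruction. -/
def Instr.exec (ℓ : ℕ) (I : Instr) (s : Config) : Config :=
  match I with
  | .const d c => ⟨s.pc + 1, Function.update s.reg d (c % 2 ^ ℓ), s.mem⟩
  | .op o d a b => ⟨s.pc + 1, Function.update s.reg d (o.eval ℓ (s.reg a) (s.reg b)), s.mem⟩
  | .load d a => ⟨s.pc + 1, Function.update s.reg d (s.mem (s.reg a)), s.mem⟩
  | .store a b => ⟨s.pc + 1, s.reg, Function.update s.mem (s.reg a) (s.reg b)⟩
  | .jump t => ⟨t, s.reg, s.mem⟩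
  | .jumpEq a b t => ⟨if s.reg a = s.reg b then t else s.pc + 1, s.reg, s.mem⟩
  | .jumpLt a b t => ⟨if s.reg a < s.reg b then t else s.pc + 1, s.reg, s.mem⟩

/-- One step of the program `P`. The machine has halted once the program counter has left the
program; from then on the configuration does not change. -/
def step (ℓ : ℕ) (P : List Instr) (s : Config) : Config :=
  match P[s.pc]? with
  | some I => I.exec ℓ s
  | none => s

/-- Started in `s`, the program `P` halts after at most `T` steps, in the configuration `s'`. -/
def HaltsWithin (ℓ : ℕ) (P : List Instr) (s : Config) (T : ℕ) (s' : Config) : Prop :=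
  (step ℓ P)^[T] s = s' ∧ P.length ≤ s'.pc

/-- The initial configuration on input `w`: the length of `w` is in register `0`, the letters of
`w` are in the memory cells `0, …, |w| - 1`, and everything else is `0`. -/
def init (w : List ℕ) : Config where
  pc := 0
  reg := fun r => if r = 0 then w.length else 0
  mem := fun k => w.getD k 0

/-- The word `u` is written in the memory of `s`, starting at address `a`. -/
def Config.HoldsWord (s : Config) (a : ℕ) (u : List ℕ) : Prop :=
  ∀ k (hk : k < u.length), s.mem (a + k) = u[k]

end WordRAM

/-! Let n be the length of w. A word of length p = n - b represents the circular word exactly when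
it is the prefix of a conjugate with period p, that is, with a border of length b. Call the starting
position of such a conjugate a center. The minimal representation belongs to the greatest b < n that
has a center, and v is the prefix of length p of the least conjugate that starts at a center for
this b.

A border of length b of a conjugate puts two equal words of length b side by side on the circle. So
b is the half-length of the longest square in www with halves shorter than n
(`IsTripled.exists_center`, `IsTripled.hasSquare`). The text T is www followed by a letter greater
than all others.

To find the square, extend it to the right as far as its primitive period q allows. Suppose that the
letter that breaks the period is smaller than the letter q places before it. If j is the position in
the first period where the least rotation starts, then the next smaller suffix of j is that at j + q
(`Run.exists_nss`). Otherwise this holds for the reversed order of the letters. Hence it suffices to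
inspect the edges from positions to their next smaller suffixes, for both orders. If the period d of
an edge extends over a stretch of length L, then it yields the half-lengths dm with 2dm ≤ L
(`Run.le_of_covers`, `hasSquare_of_edge`, `le_of_covers`).

The edges are computed in linear time by a stack algorithm. Comparisons inside a stretch that is
known to repeat at distance y - x are copied from the earlier occurrence, so that letters are only
matched beyond the right end r of that stretch (`Copies`, `CopyStep`). The extensions of the edges
to the left are found in the same manner, because edges repeat along with the text (`Nss.shift`,
`LeftCopies`).

The centers form blocks of consecutive positions, and different blocks are more than b apart
(`Center.between`). Next smaller suffixes give the least center of each block. The block minima are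
then compared in duels: a match of length k between two centers also settles the pairs shifted by t
with b + t ≤ k (`Center.of_match`), which pays for the letters read.

The program is written in a small structured language. Its translation to the machine is proved
correct and efficient once (`Run.reach`), and programs are verified with the predicate `wp`, in
which each iteration of a loop consumes one credit. -/

set_option linter.constructorNameAsVariable false
set_option linter.unusedSimpArgs false

/-! ## A structured language and its translation to the word RAM -/

namespace WordRAM

/-- Variables of structured programs. -/
inductive Var where
  | n | N | i | j | l | x | y | r | d | st | b | p | c | u
  deriving DecidableEq

/-- Arrays of structured programs; `raw` is the initial part of the memory. -/
inductive Arr where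
  | raw | text | ps | pl | ns | nl | ln | fl
  deriving DecidableEq

/-- Expressions of structured programs. -/
inductive Expr where
  | lit (c : ℕ)
  | var (x : Var)
  | op (o : BinOp) (e f : Expr)
  | get (A : Arr) (e : Expr)

namespace Expr

instance : Coe Var Expr := ⟨.var⟩
instance : Add Expr := ⟨.op .add⟩
instance : Sub Expr := ⟨.op .sub⟩
instance : Mul Expr := ⟨.op .mul⟩
instance : Div Expr := ⟨.op .div⟩
instance : Mod Expr := ⟨.op .mod⟩

end Expr

/-- Conditions of structured programs. -/
inductive Cond where
  | lt (e f : Expr)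
  | eq (e f : Expr)

/-- Structured programs. -/
inductive Stmt where
  | skip
  | assign (x : Var) (e : Expr)
  | store (A : Arr) (e f : Expr)
  | seq (s t : Stmt)
  | ite (c : Cond) (s t : Stmt)
  | while (c : Cond) (s : Stmt)

/-- States of structured programs. -/
structure St where
  v : Var → ℕ
  a : Arr → ℕ → ℕ

/-- The value of an operation on unbounded numbers. -/
def BinOp.ideal (o : BinOp) (x y : ℕ) : ℕ :=
  match o with
  | .add => x + y
  | .sub => x - y
  | .mul => x * y
  | .div => x / y
  | .mod => x % y
  | .and => x &&& y
  | .or => x ||| y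
  | .xor => x ^^^ y
  | .shl => x <<< y
  | .shr => x >>> y

theorem BinOp.eval_eq (ℓ : ℕ) (o : BinOp) (x y : ℕ) : o.eval ℓ x y = o.ideal x y % 2 ^ ℓ := by
  cases o <;> rfl

/-- The value of an expression. -/
def Expr.eval (σ : St) : Expr → ℕ
  | .lit c => c
  | .var x => σ.v x
  | .op o e f => o.ideal (e.eval σ) (f.eval σ)
  | .get A e => σ.a A (e.eval σ)

/-- All values that occur in the evaluation of an expression are at most `V`, and the initial part
of the memory is accessed below `B` only. -/
def Expr.ok (V B : ℕ) (σ : St) : Expr → Prop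
  | .lit c => c ≤ V
  | .var _ => True
  | .op o e f => e.ok V B σ ∧ f.ok V B σ ∧
      match o with
      -- The result of these three operations is at most the first operand, which is bounded
      -- already.
      | .sub => True
      | .div => True
      | .mod => True
      | o => o.ideal (e.eval σ) (f.eval σ) ≤ V
  | .get A e => e.ok V B σ ∧ (A = .raw → e.eval σ < B)

def Cond.eval (σ : St) : Cond → Prop
  | .lt e f => e.eval σ < f.eval σ
  | .eq e f => e.eval σ = f.eval σ

def Cond.ok (V B : ℕ) (σ : St) : Cond → Prop
  | .lt e f => e.ok V B σ ∧ f.ok V B σ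
  | .eq e f => e.ok V B σ ∧ f.ok V B σ

/-- Assignment to a variable. -/
def St.set (σ : St) (x : Var) (k : ℕ) : St := ⟨Function.update σ.v x k, σ.a⟩

/-- Assignment to an array cell. -/
def St.put (σ : St) (A : Arr) (i k : ℕ) : St :=
  ⟨σ.v, Function.update σ.a A (Function.update (σ.a A) i k)⟩

/-- All values of a state are at most `V`. -/
def St.Bdd (V : ℕ) (σ : St) : Prop := (∀ x, σ.v x ≤ V) ∧ ∀ A i, σ.a A i ≤ V

/-- `Run V B s σ k τ`: the program `s`, started in `σ`, halts in `τ` after `k` iterations of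
loops. -/
inductive Run (V B : ℕ) : Stmt → St → ℕ → St → Prop
  | skip (σ) : Run V B .skip σ 0 σ
  | assign (σ x) (e : Expr) (h : e.ok V B σ) :
      Run V B (.assign x e) σ 0 (σ.set x (e.eval σ))
  | store (σ A) (e f : Expr) (he : e.ok V B σ) (hf : f.ok V B σ)
      (h : A = .raw → e.eval σ < B) : Run V B (.store A e f) σ 0 (σ.put A (e.eval σ) (f.eval σ))
  | seq {s t σ₀ σ₁ σ₂ k m} (h₁ : Run V B s σ₀ k σ₁) (h₂ : Run V B t σ₁ m σ₂) :
      Run V B (.seq s t) σ₀ (k + m) σ₂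
  | ite_true {c s t σ₀ σ₁ k} (hok : c.ok V B σ₀) (hc : c.eval σ₀) (h : Run V B s σ₀ k σ₁) :
      Run V B (.ite c s t) σ₀ k σ₁
  | ite_false {c s t σ₀ σ₁ k} (hok : c.ok V B σ₀) (hc : ¬ c.eval σ₀) (h : Run V B t σ₀ k σ₁) :
      Run V B (.ite c s t) σ₀ k σ₁
  | while_true {c s σ₀ σ₁ σ₂ k m} (hok : c.ok V B σ₀) (hc : c.eval σ₀)
      (h₁ : Run V B s σ₀ k σ₁) (h₂ : Run V B (.while c s) σ₁ m σ₂) :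
      Run V B (.while c s) σ₀ (k + m + 1) σ₂
  | while_false {c s σ} (hok : c.ok V B σ) (hc : ¬ c.eval σ) :
      Run V B (.while c s) σ 0 σ

theorem Expr.eval_le {V B : ℕ} {σ : St} (hσ : σ.Bdd V) :
    ∀ e : Expr, e.ok V B σ → e.eval σ ≤ V
  | .lit _, h => h
  | .var x, _ => hσ.1 x
  | .get A e, _ => hσ.2 A _
  | .op o e f, h => by
      obtain ⟨he, hf, h⟩ := h
      have h1 := Expr.eval_le hσ e he
      cases o <;> first
        | exact h
        | exact (Nat.sub_le _ _).trans h1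
        | exact (Nat.div_le_self _ _).trans h1
        | exact (Nat.mod_le _ _).trans h1

theorem St.Bdd.set {V : ℕ} {σ : St} (h : σ.Bdd V) {x : Var} {k : ℕ} (hk : k ≤ V) :
    (σ.set x k).Bdd V := by
  refine ⟨fun y => ?_, h.2⟩
  simp only [St.set, Function.update_apply]
  split_ifs
  · exact hk
  · exact h.1 y

theorem St.Bdd.put {V : ℕ} {σ : St} (h : σ.Bdd V) {A : Arr} {i k : ℕ} (hk : k ≤ V) :
    (σ.put A i k).Bdd V := by
  refine ⟨h.1, fun C q => ?_⟩
  simp only [St.put, Function.update_apply]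
  split_ifs with h1
  · simp only [Function.update_apply]
    split_ifs
    · exact hk
    · exact h.2 _ _
  · exact h.2 _ _

theorem Run.bdd {V B : ℕ} {s : Stmt} {σ τ : St} {k : ℕ} (h : Run V B s σ k τ) (hσ : σ.Bdd V) :
    τ.Bdd V := by
  induction h with
  | skip => exact hσ
  | assign σ x e h => exact hσ.set (e.eval_le hσ h)
  | store σ A e f he hf h => exact hσ.put (f.eval_le hσ hf)
  | seq _ _ ih1 ih2 => exact ih2 (ih1 hσ)
  | ite_true _ _ _ ih => exact ih hσ
  | ite_false _ _ _ ih => exact ih hσ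
  | while_true _ _ _ _ ih1 ih2 => exact ih2 (ih1 hσ)
  | while_false => exact hσ

/-! ### Translation -/

/-- The register of a variable. -/
def Var.reg (x : Var) : ℕ := 2 * x.ctorIdx + 6

/-- The registers for intermediate results. -/
def scratch (k : ℕ) : ℕ := 2 * k + 7

/-- The address of an array cell, when the arrays begin at `B`. -/
def addr (B : ℕ) (A : Arr) (i : ℕ) : ℕ :=
  match A with
  | .raw => i
  | A => B + (8 * i + A.ctorIdx)

theorem Var.reg_injective : Function.Injective Var.reg := fun x y h => by
  have h1 : x.ctorIdx = y.ctorIdx := by unfold Var.reg at h; omega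
  rw [← Var.ofNat_ctorIdx x, h1, Var.ofNat_ctorIdx y]

/-- Variables have the even registers from 6 on, intermediate results the odd ones from 7 on.
Registers 0 to 4 remain for input and output, and register 5 holds the base of the arrays. -/
theorem Var.reg_ne_scratch (x : Var) (k : ℕ) : x.reg ≠ scratch k := by
  unfold Var.reg scratch; omega

theorem Arr.ctorIdx_lt (A : Arr) : A.ctorIdx < 8 := by cases A <;> decide

theorem addr_of_ne {B : ℕ} {A : Arr} (i : ℕ) (h : A ≠ .raw) :
    addr B A i = B + (8 * i + A.ctorIdx) := by
  cases A <;> first | rfl | exact absurd rfl h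

/-- Above `B` the arrays are interleaved with stride 8, and the residue modulo 8 tells them apart.
Cells of `raw` lie below `B`. -/
theorem addr_inj {B : ℕ} {A C : Arr} {i k : ℕ} (hA : A = .raw → i < B) (hC : C = .raw → k < B)
    (h : addr B A i = addr B C k) : A = C ∧ i = k := by
  by_cases h1 : A = .raw <;> by_cases h2 : C = .raw
  · subst h1 h2; exact ⟨rfl, h⟩
  · subst h1; rw [addr_of_ne k h2] at h
    have := hA rfl
    simp only [addr] at h; omega
  · subst h2; rw [addr_of_ne i h1] at h
    have := hC rfl
    simp only [addr] at h; omega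
  · rw [addr_of_ne i h1, addr_of_ne k h2] at h
    have hA := A.ctorIdx_lt
    have hC := C.ctorIdx_lt
    have h3 : A.ctorIdx = C.ctorIdx := by omega
    refine ⟨?_, by omega⟩
    rw [← Arr.ofNat_ctorIdx A, h3, Arr.ofNat_ctorIdx C]

/-- Turn the number in register `scratch k` into the address of a cell of `A`. The arrays begin at
the address in register `5`. -/
def addrCode (A : Arr) (k : ℕ) : List Instr :=
  match A with
  | .raw => []
  | A => [.const (scratch (k + 1)) 8, .op .mul (scratch k) (scratch k) (scratch (k + 1)),
      .const (scratch (k + 1)) A.ctorIdx, .op .add (scratch k) (scratch k) (scratch (k + 1)),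
      .op .add (scratch k) 5 (scratch k)]

/-- Code that puts the value of an expression into register `scratch k`. -/
def Expr.code : Expr → ℕ → List Instr
  | .lit c, k => [.const (scratch k) c]
  -- The disjunction of a register with itself serves as a move instruction.
  | .var x, k => [.op .or (scratch k) x.reg x.reg]
  | .op o e f, k => e.code k ++ (f.code (k + 1) ++ [.op o (scratch k) (scratch k) (scratch (k + 1))])
  | .get A e, k => e.code k ++ (addrCode A k ++ [.load (scratch k) (scratch k)])

/-- Code that evaluates a condition and jumps to `t` if it holds. -/
def Cond.code : Cond → ℕ → List Instr
  | .lt e f, t => e.code 0 ++ (f.code 1 ++ [.jumpLt (scratch 0) (scratch 1) t])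
  | .eq e f, t => e.code 0 ++ (f.code 1 ++ [.jumpEq (scratch 0) (scratch 1) t])

/-- The length of the code of a condition. -/
def Cond.len (c : Cond) : ℕ := (c.code 0).length

theorem Cond.length_code (c : Cond) (t : ℕ) : (c.code t).length = c.len := by
  cases c <;> simp [Cond.len, Cond.code]

/-- The length of the code of a program. -/
def Stmt.len : Stmt → ℕ
  | .skip => 0
  | .assign _ e => (e.code 0).length + 1
  | .store A e f => (e.code 0).length + ((addrCode A 0).length + ((f.code 1).length + 1))
  | .seq s t => s.len + t.len
  | .ite c s t => c.len + (t.len + (1 + s.len))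
  | .while c s => c.len + (1 + (s.len + 1))

/-- The code of a program, to be placed at position `o`. -/
def Stmt.code : Stmt → ℕ → List Instr
  | .skip, _ => []
  | .assign x e, _ => e.code 0 ++ [.op .or x.reg (scratch 0) (scratch 0)]
  | .store A e f, _ => e.code 0 ++ (addrCode A 0 ++ (f.code 1 ++ [.store (scratch 0) (scratch 1)]))
  | .seq s t, o => s.code o ++ t.code (o + s.len)
  | .ite c s t, o => c.code (o + c.len + t.len + 1) ++ (t.code (o + c.len) ++
      ([.jump (o + c.len + t.len + 1 + s.len)] ++ s.code (o + c.len + t.len + 1)))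
  | .while c s, o => c.code (o + c.len + 1) ++ ([.jump (o + c.len + 1 + s.len + 1)] ++
      (s.code (o + c.len + 1) ++ [.jump o]))

theorem Stmt.length_code (s : Stmt) (o : ℕ) : (s.code o).length = s.len := by
  induction s generalizing o with
  | skip => rfl
  | assign => simp [code, len]
  | store => simp [code, len]
  | seq s t ihs iht => simp [code, len, ihs, iht]
  | ite c s t ihs iht => simp [code, len, ihs, iht, Cond.length_code]; omega
  | _ c s ih => simp [code, len, ih, Cond.length_code]; omega

end WordRAM

namespace WordRAM

/-! ### Correctness of the translation -/

/-- That code is located at position `o` of `P` is expressed as `_ <+: P.drop o`; this splits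
concatenated code into located pieces. -/
theorem prefix_drop_append {α : Type*} {P u v : List α} {o : ℕ} :
    u ++ v <+: P.drop o ↔ u <+: P.drop o ∧ v <+: P.drop (o + u.length) := by
  constructor
  · rintro ⟨t, ht⟩
    refine ⟨⟨v ++ t, by simpa using ht⟩, ⟨t, ?_⟩⟩
    rw [← List.drop_drop, ← ht]
    simp
  · rintro ⟨⟨t, ht⟩, hv⟩
    rw [← List.drop_drop, ← ht] at hv
    obtain ⟨r, hr⟩ := hv
    refine ⟨r, ?_⟩
    rw [← ht, List.append_assoc, hr]
    simp

theorem getElem?_of_prefix_drop {α : Type*} {P v : List α} {I : α} {o : ℕ}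
    (h : I :: v <+: P.drop o) : P[o]? = some I := by
  obtain ⟨t, ht⟩ := h
  have : (P.drop o)[0]? = some I := by rw [← ht]; rfl
  simpa using this

theorem tail_prefix_drop {α : Type*} {P v : List α} {I : α} {o : ℕ}
    (h : I :: v <+: P.drop o) : v <+: P.drop (o + 1) :=
  (prefix_drop_append (u := [I]).1 h).2

theorem step_eq {ℓ : ℕ} {P v : List Instr} {I : Instr} {s : Config}
    (h : I :: v <+: P.drop s.pc) : step ℓ P s = I.exec ℓ s := by
  unfold step
  rw [getElem?_of_prefix_drop h]

/-- The machine configuration `s` represents the state `σ` of a structured program. -/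
structure Rel (B : ℕ) (σ : St) (s : Config) : Prop where
  reg : ∀ x : Var, s.reg x.reg = σ.v x
  mem : ∀ A i, (A = .raw → i < B) → s.mem (addr B A i) = σ.a A i
  base : s.reg 5 = B

/-- The configurations `s` and `t` differ in the registers for intermediate results with number at
least `k` and in the program counter only. -/
def SameUpTo (k : ℕ) (s t : Config) : Prop :=
  t.mem = s.mem ∧ ∀ q, (∀ m, k ≤ m → q ≠ scratch m) → t.reg q = s.reg q

theorem scratch_injective {i k : ℕ} (h : scratch i = scratch k) : i = k := by
  unfold scratch at h; omega

theorem SameUpTo.trans {k m : ℕ} {s t u : Config} (h : SameUpTo k s t) (h' : SameUpTo m t u)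
    (hkm : k ≤ m) : SameUpTo k s u :=
  ⟨h'.1.trans h.1, fun q hq => (h'.2 q fun i hi => hq i (hkm.trans hi)).trans (h.2 q hq)⟩

theorem SameUpTo.scratch {k i : ℕ} {s t : Config} (h : SameUpTo k s t) (hi : i < k) :
    t.reg (scratch i) = s.reg (scratch i) :=
  h.2 _ fun m hm he => by have := scratch_injective he; omega

theorem Rel.of_sameUpTo {B k : ℕ} {σ : St} {s t : Config} (h : Rel B σ s) (h' : SameUpTo k s t) :
    Rel B σ t where
  reg x := (h'.2 _ fun m _ => x.reg_ne_scratch m).trans (h.reg x)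
  mem A i hA := by rw [h'.1]; exact h.mem A i hA
  base := (h'.2 5 fun m _ => by unfold WordRAM.scratch; omega).trans h.base

/-- In `k` steps the program gets from `s` to `t`. -/
def Reach (ℓ : ℕ) (P : List Instr) (s : Config) (k : ℕ) (t : Config) : Prop :=
  (step ℓ P)^[k] s = t

theorem Reach.trans {ℓ : ℕ} {P : List Instr} {s t u : Config} {k m : ℕ} (h : Reach ℓ P s k t)
    (h' : Reach ℓ P t m u) : Reach ℓ P s (k + m) u := by
  unfold Reach at *
  rw [Nat.add_comm, Function.iterate_add_apply, h, h']

theorem Reach.one {ℓ : ℕ} {P v : List Instr} {I : Instr} {s : Config}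
    (h : I :: v <+: P.drop s.pc) : Reach ℓ P s 1 (I.exec ℓ s) := step_eq h

/-- For indices up to `V` no address exceeds `B + 8 * V + 7`, so no reduction modulo `2 ^ ℓ` takes
place. -/
theorem addrCode_spec {ℓ V B : ℕ} {P : List Instr} (hV : B + (8 * V + 8) < 2 ^ ℓ) (A : Arr) (k : ℕ)
    {s : Config} {i : ℕ} (hi : i ≤ V) (hB : s.reg 5 = B) (hs : s.reg (scratch k) = i)
    (hP : addrCode A k <+: P.drop s.pc) :
    ∃ t, Reach ℓ P s (addrCode A k).length t ∧ t.pc = s.pc + (addrCode A k).length ∧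
      SameUpTo k s t ∧ t.reg (scratch k) = addr B A i := by
  by_cases hA : A = .raw
  · subst hA
    exact ⟨s, rfl, rfl, ⟨rfl, fun _ _ => rfl⟩, hs⟩
  · have hc : addrCode A k = [.const (scratch (k + 1)) 8,
        .op .mul (scratch k) (scratch k) (scratch (k + 1)),
        .const (scratch (k + 1)) A.ctorIdx, .op .add (scratch k) (scratch k) (scratch (k + 1)),
        .op .add (scratch k) 5 (scratch k)] := by
      cases A <;> first | rfl | exact absurd rfl hA
    rw [hc] at hP ⊢
    have hne : scratch k ≠ scratch (k + 1) := fun h => by have := scratch_injective h; omega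
    have h5 : ∀ m, 5 ≠ scratch m := fun m => by unfold scratch; omega
    have hA8 := A.ctorIdx_lt
    have h1 := Reach.one (ℓ := ℓ) hP
    have h2 := Reach.one (ℓ := ℓ) (s := Instr.exec ℓ (.const (scratch (k + 1)) 8) s)
      (tail_prefix_drop hP)
    have h3 := Reach.one (ℓ := ℓ) (s := Instr.exec ℓ (.op .mul (scratch k) (scratch k)
      (scratch (k + 1))) (Instr.exec ℓ (.const (scratch (k + 1)) 8) s))
      (tail_prefix_drop (tail_prefix_drop hP))
    have h4 := Reach.one (ℓ := ℓ) (s := Instr.exec ℓ (.const (scratch (k + 1)) A.ctorIdx)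
      (Instr.exec ℓ (.op .mul (scratch k) (scratch k)
      (scratch (k + 1))) (Instr.exec ℓ (.const (scratch (k + 1)) 8) s)))
      (tail_prefix_drop (tail_prefix_drop (tail_prefix_drop hP)))
    have h6 := Reach.one (ℓ := ℓ) (s := Instr.exec ℓ (.op .add (scratch k) (scratch k)
      (scratch (k + 1))) (Instr.exec ℓ (.const (scratch (k + 1)) A.ctorIdx)
      (Instr.exec ℓ (.op .mul (scratch k) (scratch k)
      (scratch (k + 1))) (Instr.exec ℓ (.const (scratch (k + 1)) 8) s))))
      (tail_prefix_drop (tail_prefix_drop (tail_prefix_drop (tail_prefix_drop hP))))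
    refine ⟨_, (((h1.trans h2).trans h3).trans h4).trans h6, rfl, ⟨rfl, fun q hq => ?_⟩, ?_⟩
    · have hq1 := hq k le_rfl
      have hq2 := hq (k + 1) (by omega)
      simp [Instr.exec, Function.update_apply, hq1, hq2]
    · rw [addr_of_ne i hA]
      simp [Instr.exec, Function.update_apply, hne, hne.symm, h5, BinOp.eval, hB, hs]
      rw [Nat.mod_eq_of_lt (by omega)]
      omega

/-- The scratch registers from `k` on act as a stack: the second operand is evaluated at `k + 1` and
leaves the first one intact. -/
theorem Expr.code_spec {ℓ V B : ℕ} {P : List Instr} (hV : B + (8 * V + 8) < 2 ^ ℓ) {σ : St}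
    (hσ : σ.Bdd V) (e : Expr) (k : ℕ) {s : Config} (hs : Rel B σ s) (hok : e.ok V B σ)
    (hP : e.code k <+: P.drop s.pc) :
    ∃ t, Reach ℓ P s (e.code k).length t ∧ t.pc = s.pc + (e.code k).length ∧
      SameUpTo k s t ∧ t.reg (scratch k) = e.eval σ := by
  induction e generalizing k s with
  | lit c =>
    refine ⟨_, Reach.one hP, rfl, ⟨rfl, fun q hq => ?_⟩, ?_⟩
    · simp [Instr.exec, Function.update_apply, hq k le_rfl]
    · have : c ≤ V := hok
      simp only [Instr.exec, Function.update_self, Expr.eval]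
      exact Nat.mod_eq_of_lt (by omega)
  | var x =>
    refine ⟨_, Reach.one hP, rfl, ⟨rfl, fun q hq => ?_⟩, ?_⟩
    · simp [Instr.exec, Function.update_apply, hq k le_rfl]
    · have := hσ.1 x
      simp only [Instr.exec, Function.update_self, Expr.eval, BinOp.eval, Nat.or_self, hs.reg x]
      exact Nat.mod_eq_of_lt (by omega)
  | op o e f ihe ihf =>
    have hle := Expr.eval_le hσ _ hok
    obtain ⟨hoke, hokf, -⟩ := hok
    have hP1 := prefix_drop_append.1 hP
    have hP2 := prefix_drop_append.1 hP1.2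
    obtain ⟨t, ht, htp, hts, htv⟩ := ihe k hs hoke hP1.1
    obtain ⟨u, hu, hup, hus, huv⟩ := ihf (k + 1) (hs.of_sameUpTo hts) hokf (by rw [htp]; exact hP2.1)
    have h3 := Reach.one (ℓ := ℓ) (s := u) (by rw [hup, htp]; exact hP2.2)
    refine ⟨Instr.exec ℓ (.op o (scratch k) (scratch k) (scratch (k + 1))) u, ?_, ?_,
      ⟨?_, fun q hq => ?_⟩, ?_⟩
    · simpa [Expr.code, Nat.add_assoc] using (ht.trans hu).trans h3
    · simp [Instr.exec, Expr.code, hup, htp]; omega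
    · exact hus.1.trans hts.1
    · have := (hts.trans hus (Nat.le_succ k)).2 q hq
      simp [Instr.exec, Function.update_apply, hq k le_rfl, this]
    · simp only [Instr.exec, Function.update_self, BinOp.eval_eq, huv, hus.scratch (Nat.lt_succ_self k),
        htv]
      exact Nat.mod_eq_of_lt (lt_of_le_of_lt hle (by omega))
  | get A e ih =>
    obtain ⟨hoke, hraw⟩ := hok
    have hP1 := prefix_drop_append.1 hP
    have hP2 := prefix_drop_append.1 hP1.2
    obtain ⟨t, ht, htp, hts, htv⟩ := ih k hs hoke hP1.1
    obtain ⟨u, hu, hup, hus, huv⟩ := addrCode_spec hV A k (Expr.eval_le hσ e hoke)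
      (hs.of_sameUpTo hts).base htv (by rw [htp]; exact hP2.1)
    have h3 := Reach.one (ℓ := ℓ) (s := u) (by rw [hup, htp]; exact hP2.2)
    have hr := (hs.of_sameUpTo hts).of_sameUpTo hus
    refine ⟨Instr.exec ℓ (.load (scratch k) (scratch k)) u,
      by simpa [Expr.code, Nat.add_assoc] using (ht.trans hu).trans h3, ?_, ⟨hus.1.trans hts.1, fun q hq => ?_⟩, ?_⟩
    · simp [Instr.exec, Expr.code, hup, htp]; omega
    · have := (hts.trans hus le_rfl).2 q hq
      simp [Instr.exec, Function.update_apply, hq k le_rfl, this]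
    · simp only [Instr.exec, Function.update_self, huv, Expr.eval]
      exact hr.mem A _ hraw

theorem Cond.code_spec {ℓ V B : ℕ} {P : List Instr} (hV : B + (8 * V + 8) < 2 ^ ℓ) {σ : St}
    (hσ : σ.Bdd V) (c : Cond) (o : ℕ) {s : Config} (hs : Rel B σ s) (hok : c.ok V B σ)
    (hP : c.code o <+: P.drop s.pc) :
    ∃ t, Reach ℓ P s c.len t ∧ (c.eval σ → t.pc = o) ∧ (¬ c.eval σ → t.pc = s.pc + c.len) ∧
      Rel B σ t := by
  have aux : ∀ e f : Expr, e.ok V B σ → f.ok V B σ → ∀ I, e.code 0 ++ (f.code 1 ++ [I]) <+: P.drop s.pc →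
      ∃ t, Reach ℓ P s ((e.code 0).length + (f.code 1).length) t ∧
        t.pc = s.pc + ((e.code 0).length + (f.code 1).length) ∧ Rel B σ t ∧
        t.reg (scratch 0) = e.eval σ ∧ t.reg (scratch 1) = f.eval σ ∧ [I] <+: P.drop t.pc := by
    intro e f he hf I hP
    have hP1 := prefix_drop_append.1 hP
    have hP2 := prefix_drop_append.1 hP1.2
    obtain ⟨t, ht, htp, hts, htv⟩ := e.code_spec hV hσ 0 hs he hP1.1
    obtain ⟨u, hu, hup, hus, huv⟩ := f.code_spec hV hσ 1 (hs.of_sameUpTo hts) hf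
      (by rw [htp]; exact hP2.1)
    refine ⟨u, ht.trans hu, by omega, (hs.of_sameUpTo hts).of_sameUpTo hus,
      (hus.scratch Nat.zero_lt_one).trans htv, huv, by rw [hup, htp]; exact hP2.2⟩
  cases c with
  | lt e f =>
    obtain ⟨t, ht, htp, htr, h0, h1, hI⟩ := aux e f hok.1 hok.2 _ hP
    refine ⟨Instr.exec ℓ (.jumpLt (scratch 0) (scratch 1) o) t,
      by simpa [Cond.len, Cond.code, Nat.add_assoc] using ht.trans (Reach.one hI), ?_, ?_,
      ⟨htr.reg, htr.mem, htr.base⟩⟩ <;> intro h <;> simp only [Cond.eval] at h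
    · simp [Instr.exec, h0, h1, h]
    · simp [Instr.exec, h0, h1, h, htp, Cond.len, Cond.code]; omega
  | eq e f =>
    obtain ⟨t, ht, htp, htr, h0, h1, hI⟩ := aux e f hok.1 hok.2 _ hP
    refine ⟨Instr.exec ℓ (.jumpEq (scratch 0) (scratch 1) o) t,
      by simpa [Cond.len, Cond.code, Nat.add_assoc] using ht.trans (Reach.one hI), ?_, ?_,
      ⟨htr.reg, htr.mem, htr.base⟩⟩ <;> intro h <;> simp only [Cond.eval] at h
    · simp [Instr.exec, h0, h1, h]
    · simp [Instr.exec, h0, h1, h, htp, Cond.len, Cond.code]; omega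

/-- The translation is correct, and the machine needs at most `|code|` steps for each iteration of a
loop and `|code|` steps for the rest. -/
theorem Run.reach {ℓ V B : ℕ} {P : List Instr} (hV : B + (8 * V + 8) < 2 ^ ℓ) {S : Stmt} {σ τ : St}
    {k : ℕ} (h : Run V B S σ k τ) :
    ∀ {s : Config}, σ.Bdd V → Rel B σ s → S.code s.pc <+: P.drop s.pc →
      ∃ t m, Reach ℓ P s m t ∧ m ≤ S.len * (k + 1) ∧ t.pc = s.pc + S.len ∧ Rel B τ t := by
  induction h with
  | skip σ => intro s _ hs _; exact ⟨s, 0, rfl, by simp [Stmt.len], rfl, hs⟩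
  | assign σ x e h =>
    intro s hσ hs hP
    have hP1 := prefix_drop_append.1 hP
    obtain ⟨t, ht, htp, hts, htv⟩ := e.code_spec hV hσ 0 hs h hP1.1
    have htr := hs.of_sameUpTo hts
    have hle := e.eval_le hσ h
    refine ⟨Instr.exec ℓ (.op .or x.reg (scratch 0) (scratch 0)) t, _,
      ht.trans (Reach.one (by rw [htp]; exact hP1.2)), by simp [Stmt.len],
      by simp [Instr.exec, Stmt.len, htp, Nat.add_assoc], ⟨fun y => ?_, htr.mem, ?_⟩⟩
    · simp only [Instr.exec, St.set, Function.update_apply, Var.reg_injective.eq_iff]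
      split_ifs
      · simp only [BinOp.eval, Nat.or_self, htv]
        exact Nat.mod_eq_of_lt (by omega)
      · exact htr.reg y
    · have : 5 ≠ x.reg := by unfold Var.reg; omega
      simp [Instr.exec, Function.update_apply, this, htr.base]
  | store σ A e f he hf h =>
    intro s hσ hs hP
    have hP1 := prefix_drop_append.1 hP
    have hP2 := prefix_drop_append.1 hP1.2
    have hP3 := prefix_drop_append.1 hP2.2
    obtain ⟨t, ht, htp, hts, htv⟩ := e.code_spec hV hσ 0 hs he hP1.1
    have htr := hs.of_sameUpTo hts
    obtain ⟨u, hu, hup, hus, huv⟩ := addrCode_spec hV A 0 (e.eval_le hσ he) htr.base htv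
      (by rw [htp]; exact hP2.1)
    have hur := htr.of_sameUpTo hus
    obtain ⟨w, hw, hwp, hws, hwv⟩ := f.code_spec hV hσ 1 hur hf (by rw [hup, htp]; exact hP3.1)
    have hwr := hur.of_sameUpTo hws
    have h0 := (hws.scratch Nat.zero_lt_one).trans huv
    refine ⟨Instr.exec ℓ (.store (scratch 0) (scratch 1)) w, _,
      ((ht.trans hu).trans hw).trans (Reach.one (by rw [hwp, hup, htp]; exact hP3.2)),
      by simp [Stmt.len]; omega, by simp [Instr.exec, Stmt.len, hwp, hup, htp]; omega,
      ⟨hwr.reg, fun C i hC => ?_, hwr.base⟩⟩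
    simp only [Instr.exec, St.put, Function.update_apply, h0, hwv]
    by_cases hAC : C = A ∧ i = e.eval σ
    · obtain ⟨rfl, rfl⟩ := hAC
      simp
    · rw [if_neg fun h' => hAC (addr_inj hC h h'), hwr.mem C i hC]
      by_cases hA : C = A
      · subst hA
        have : i ≠ e.eval σ := fun h' => hAC ⟨rfl, h'⟩
        simp [this]
      · simp [hA]
  | @seq S T σ₀ σ₁ σ₂ k m h₁ h₂ ih₁ ih₂ =>
    intro s hσ hs hP
    have hP1 := prefix_drop_append.1 hP
    rw [Stmt.length_code] at hP1
    obtain ⟨t, a, ht, hta, htp, htr⟩ := ih₁ hσ hs hP1.1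
    obtain ⟨u, b, hu, hub, hup, hur⟩ := ih₂ (h₁.bdd hσ) htr (by rw [htp]; exact hP1.2)
    refine ⟨u, _, ht.trans hu, ?_, by rw [hup, htp, Stmt.len]; omega, hur⟩
    simp only [Stmt.len]
    nlinarith [Nat.zero_le (S.len * m), Nat.zero_le (T.len * k)]
  | @ite_true c S T σ₀ σ₁ k hok hc h ih =>
    intro s hσ hs hP
    have hP1 := prefix_drop_append.1 hP
    have hP2 := prefix_drop_append.1 hP1.2
    have hP3 := prefix_drop_append.1 hP2.2
    simp only [Stmt.length_code, Cond.length_code, List.length_singleton] at hP1 hP2 hP3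
    obtain ⟨t, ht, htp, -, htr⟩ := c.code_spec hV hσ _ hs hok hP1.1
    obtain ⟨u, b, hu, hub, hup, hur⟩ := ih hσ htr (by rw [htp hc]; exact hP3.2)
    refine ⟨u, _, ht.trans hu, ?_, by rw [hup, htp hc, Stmt.len]; omega, hur⟩
    simp only [Stmt.len]
    nlinarith [Nat.zero_le (c.len * k), Nat.zero_le (T.len * k)]
  | @ite_false c S T σ₀ σ₁ k hok hc h ih =>
    intro s hσ hs hP
    have hP1 := prefix_drop_append.1 hP
    have hP2 := prefix_drop_append.1 hP1.2
    have hP3 := prefix_drop_append.1 hP2.2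
    simp only [Stmt.length_code, Cond.length_code] at hP1 hP2 hP3
    obtain ⟨t, ht, -, htp, htr⟩ := c.code_spec hV hσ _ hs hok hP1.1
    obtain ⟨u, b, hu, hub, hup, hur⟩ := ih hσ htr (by rw [htp hc]; exact hP2.1)
    have h3 := Reach.one (ℓ := ℓ) (s := u) (by rw [hup, htp hc]; exact hP3.1)
    refine ⟨_, _, (ht.trans hu).trans h3, ?_, by simp [Instr.exec, Stmt.len]; omega,
      ⟨hur.reg, hur.mem, hur.base⟩⟩
    simp only [Stmt.len]
    nlinarith [Nat.zero_le (c.len * k), Nat.zero_le (S.len * k)]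
  | @while_true c S σ₀ σ₁ σ₂ k m hok hc h₁ h₂ ih₁ ih₂ =>
    intro s hσ hs hP
    have hP1 := prefix_drop_append.1 hP
    have hP2 := prefix_drop_append.1 hP1.2
    have hP3 := prefix_drop_append.1 hP2.2
    simp only [Stmt.length_code, Cond.length_code, List.length_singleton] at hP1 hP2 hP3
    obtain ⟨t, ht, htp, -, htr⟩ := c.code_spec hV hσ _ hs hok hP1.1
    obtain ⟨u, b, hu, hub, hup, hur⟩ := ih₁ hσ htr (by rw [htp hc]; exact hP3.1)
    have h3 := Reach.one (ℓ := ℓ) (s := u) (by rw [hup, htp hc]; exact hP3.2)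
    obtain ⟨w, d, hw, hwd, hwp, hwr⟩ := ih₂ (s := Instr.exec ℓ (.jump s.pc) u) (h₁.bdd hσ)
      ⟨hur.reg, hur.mem, hur.base⟩ hP
    refine ⟨w, _, ((ht.trans hu).trans h3).trans hw, ?_, hwp, hwr⟩
    simp only [Stmt.len] at hwd ⊢
    nlinarith [Nat.zero_le (c.len * k)]
  | @while_false c S σ hok hc =>
    intro s hσ hs hP
    have hP1 := prefix_drop_append.1 hP
    have hP2 := prefix_drop_append.1 hP1.2
    simp only [Cond.length_code] at hP1 hP2
    obtain ⟨t, ht, -, htp, htr⟩ := c.code_spec hV hσ _ hs hok hP1.1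
    have h3 := Reach.one (ℓ := ℓ) (s := t) (by rw [htp hc]; exact hP2.1)
    refine ⟨_, _, ht.trans h3, by simp only [Stmt.len]; omega, by simp [Instr.exec, Stmt.len]; omega,
      ⟨htr.reg, htr.mem, htr.base⟩⟩

end WordRAM

namespace WordRAM

/-! ### Reasoning about structured programs -/

/-- With `τ` credits, one for each iteration of a loop, the program `S` started in `σ` halts in a
state that satisfies `Q` together with the number of credits left. -/
def wp (V B : ℕ) (S : Stmt) (Q : St → ℕ → Prop) (σ : St) (τ : ℕ) : Prop :=
  ∃ σ' k, Run V B S σ k σ' ∧ k ≤ τ ∧ Q σ' (τ - k)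

variable {V B : ℕ} {Q : St → ℕ → Prop} {σ : St} {τ : ℕ}

theorem wp_skip : wp V B .skip Q σ τ ↔ Q σ τ := by
  constructor
  · rintro ⟨σ', k, h, hk, hQ⟩; cases h; exact hQ
  · intro h; exact ⟨σ, 0, .skip σ, Nat.zero_le _, h⟩

theorem wp_assign {x : Var} {e : Expr} :
    wp V B (.assign x e) Q σ τ ↔ e.ok V B σ ∧ Q (σ.set x (e.eval σ)) τ := by
  constructor
  · rintro ⟨σ', k, h, hk, hQ⟩; cases h with | assign _ _ _ h => exact ⟨h, hQ⟩
  · rintro ⟨h, hQ⟩; exact ⟨_, 0, .assign σ x e h, Nat.zero_le _, hQ⟩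

theorem wp_store {A : Arr} {e f : Expr} :
    wp V B (.store A e f) Q σ τ ↔ (e.ok V B σ ∧ f.ok V B σ ∧ (A = .raw → e.eval σ < B)) ∧
      Q (σ.put A (e.eval σ) (f.eval σ)) τ := by
  constructor
  · rintro ⟨σ', k, h, hk, hQ⟩; cases h with | store _ _ _ _ h1 h2 h3 => exact ⟨⟨h1, h2, h3⟩, hQ⟩
  · rintro ⟨⟨h1, h2, h3⟩, hQ⟩; exact ⟨_, 0, .store σ A e f h1 h2 h3, Nat.zero_le _, hQ⟩

theorem wp_seq {S T : Stmt} :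
    wp V B (.seq S T) Q σ τ ↔ wp V B S (fun σ τ => wp V B T Q σ τ) σ τ := by
  constructor
  · rintro ⟨σ', k, h, hk, hQ⟩
    cases h with | @seq _ _ _ σ₁ _ k m h₁ h₂ =>
    exact ⟨σ₁, k, h₁, by omega, _, _, h₂, by omega, by rwa [Nat.sub_sub]⟩
  · rintro ⟨σ₁, k, h₁, hk, σ₂, m, h₂, hm, hQ⟩
    exact ⟨σ₂, k + m, .seq h₁ h₂, by omega, by rwa [Nat.sub_sub] at hQ⟩

theorem wp_ite {c : Cond} {S T : Stmt} :
    wp V B (.ite c S T) Q σ τ ↔ c.ok V B σ ∧ (c.eval σ → wp V B S Q σ τ) ∧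
      (¬ c.eval σ → wp V B T Q σ τ) := by
  constructor
  · rintro ⟨σ', k, h, hk, hQ⟩
    cases h with
    | ite_true hok hc h => exact ⟨hok, fun _ => ⟨_, _, h, hk, hQ⟩, fun h' => absurd hc h'⟩
    | ite_false hok hc h => exact ⟨hok, fun h' => absurd h' hc, fun _ => ⟨_, _, h, hk, hQ⟩⟩
  · rintro ⟨hok, h1, h2⟩
    by_cases hc : c.eval σ
    · obtain ⟨σ', k, h, hk⟩ := h1 hc
      exact ⟨σ', k, .ite_true hok hc h, hk⟩
    · obtain ⟨σ', k, h, hk⟩ := h2 hc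
      exact ⟨σ', k, .ite_false hok hc h, hk⟩

theorem wp.mono {S : Stmt} {Q' : St → ℕ → Prop} (h : wp V B S Q σ τ)
    (hQ : ∀ σ' τ', Q σ' τ' → Q' σ' τ') : wp V B S Q' σ τ := by
  obtain ⟨σ', k, h, hk, h'⟩ := h
  exact ⟨σ', k, h, hk, hQ _ _ h'⟩

/-- Whether a program may change a variable. -/
def Stmt.setsVar (x : Var) : Stmt → Bool
  | .skip => false
  | .assign y _ => x = y
  | .store _ _ _ => false
  | .seq s t => s.setsVar x || t.setsVar x
  | .ite _ s t => s.setsVar x || t.setsVar x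
  | .while _ s => s.setsVar x

/-- Whether a program may change an array. -/
def Stmt.setsArr (A : Arr) : Stmt → Bool
  | .skip => false
  | .assign _ _ => false
  | .store C _ _ => A = C
  | .seq s t => s.setsArr A || t.setsArr A
  | .ite _ s t => s.setsArr A || t.setsArr A
  | .while _ s => s.setsArr A

/-- The states agree on everything that the program cannot change. -/
def Frame (S : Stmt) (σ σ' : St) : Prop :=
  (∀ x, S.setsVar x = false → σ'.v x = σ.v x) ∧ ∀ A, S.setsArr A = false → σ'.a A = σ.a A

theorem Frame.refl (S : Stmt) (σ : St) : Frame S σ σ := ⟨fun _ _ => rfl, fun _ _ => rfl⟩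

theorem Frame.trans {S : Stmt} {σ₀ σ₁ σ₂ : St} (h : Frame S σ₀ σ₁) (h' : Frame S σ₁ σ₂) :
    Frame S σ₀ σ₂ :=
  ⟨fun x hx => (h'.1 x hx).trans (h.1 x hx), fun A hA => (h'.2 A hA).trans (h.2 A hA)⟩

theorem Frame.mono {S T : Stmt} {σ σ' : St} (h : Frame S σ σ')
    (hv : ∀ x, T.setsVar x = false → S.setsVar x = false)
    (ha : ∀ A, T.setsArr A = false → S.setsArr A = false) : Frame T σ σ' :=
  ⟨fun x hx => h.1 x (hv x hx), fun A hA => h.2 A (ha A hA)⟩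

theorem Run.frame {S : Stmt} {σ σ' : St} {k : ℕ} (h : Run V B S σ k σ') : Frame S σ σ' := by
  induction h with
  | skip σ => exact .refl _ σ
  | assign σ x e h =>
    refine ⟨fun y hy => ?_, fun _ _ => rfl⟩
    simp only [Stmt.setsVar, decide_eq_false_iff_not] at hy
    simp [St.set, hy]
  | store σ A e f =>
    refine ⟨fun _ _ => rfl, fun C hC => ?_⟩
    simp only [Stmt.setsArr, decide_eq_false_iff_not] at hC
    simp [St.put, hC]
  | seq _ _ ih₁ ih₂ =>
    refine (ih₁.mono ?_ ?_).trans (ih₂.mono ?_ ?_) <;> simp +contextual [Stmt.setsVar, Stmt.setsArr]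
  | ite_true _ _ _ ih => refine ih.mono ?_ ?_ <;> simp +contextual [Stmt.setsVar, Stmt.setsArr]
  | ite_false _ _ _ ih => refine ih.mono ?_ ?_ <;> simp +contextual [Stmt.setsVar, Stmt.setsArr]
  | while_true _ _ _ _ ih₁ ih₂ =>
    refine (ih₁.mono ?_ ?_).trans ih₂ <;> simp +contextual [Stmt.setsVar, Stmt.setsArr]
  | while_false => exact .refl _ _

theorem wp.frame {S : Stmt} (h : wp V B S Q σ τ) :
    wp V B S (fun σ' τ' => Q σ' τ' ∧ Frame S σ σ') σ τ := by
  obtain ⟨σ', k, h, hk, h'⟩ := h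
  exact ⟨σ', k, h, hk, h', h.frame⟩

/-- Use the specification of a program as a black box. -/
theorem wp.apply {S : Stmt} {Q' : St → ℕ → Prop} (h : wp V B S Q σ τ)
    (hQ : ∀ σ' τ', Q σ' τ' → Frame S σ σ' → Q' σ' τ') : wp V B S Q' σ τ :=
  h.frame.mono fun σ' τ' h => hQ σ' τ' h.1 h.2

/-- Each iteration consumes a credit, so induction on the credits proves termination and the time
bound at once. The invariant need not mention what the body cannot change, since `Frame` provides
it. -/
theorem wp_while {c : Cond} {S : Stmt} (I : St → ℕ → Prop) (h0 : I σ τ)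
    (h : ∀ σ' τ', I σ' τ' → Frame S σ σ' → c.ok V B σ' ∧
      (c.eval σ' → 1 ≤ τ' ∧ wp V B S I σ' (τ' - 1)) ∧ (¬ c.eval σ' → Q σ' τ')) :
    wp V B (.while c S) Q σ τ := by
  have main : ∀ τ' σ', I σ' τ' → Frame S σ σ' → wp V B (.while c S) Q σ' τ' := by
    intro τ'
    induction τ' using Nat.strong_induction_on with
    | _ τ' ih =>
      intro σ' hI hF
      obtain ⟨hok, ht, hf⟩ := h σ' τ' hI hF
      by_cases hc : c.eval σ'
      · obtain ⟨h1, σ₁, k, hr, hk, hI₁⟩ := ht hc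
        obtain ⟨σ₂, m, hr₂, hm, hQ⟩ := ih (τ' - 1 - k) (by omega) σ₁ hI₁ (hF.trans hr.frame)
        refine ⟨σ₂, k + m + 1, .while_true hok hc hr hr₂, by omega, ?_⟩
        have : τ' - (k + m + 1) = τ' - 1 - k - m := by omega
        rwa [this]
      · exact ⟨σ', 0, .while_false hok hc, Nat.zero_le _, hf hc⟩
  exact main τ σ h0 (.refl _ _)

theorem St.set_v (σ : St) (x y : Var) (k : ℕ) : (σ.set x k).v y = if y = x then k else σ.v y := by
  simp [St.set, Function.update_apply]

theorem St.set_a (σ : St) (x : Var) (k : ℕ) : (σ.set x k).a = σ.a := rfl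

theorem St.put_v (σ : St) (A : Arr) (i k : ℕ) : (σ.put A i k).v = σ.v := rfl

theorem St.put_a (σ : St) (A C : Arr) (i k : ℕ) :
    (σ.put A i k).a C = if C = A then Function.update (σ.a A) i k else σ.a C := by
  simp [St.put, Function.update_apply]

theorem Expr.eval_add (σ : St) (e f : Expr) : (e + f).eval σ = e.eval σ + f.eval σ := rfl
theorem Expr.eval_sub (σ : St) (e f : Expr) : (e - f).eval σ = e.eval σ - f.eval σ := rfl
theorem Expr.eval_mul (σ : St) (e f : Expr) : (e * f).eval σ = e.eval σ * f.eval σ := rfl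
theorem Expr.eval_div (σ : St) (e f : Expr) : (e / f).eval σ = e.eval σ / f.eval σ := rfl
theorem Expr.eval_mod (σ : St) (e f : Expr) : (e % f).eval σ = e.eval σ % f.eval σ := rfl
theorem Expr.eval_lit (σ : St) (c : ℕ) : (Expr.lit c).eval σ = c := rfl
theorem Expr.eval_var (σ : St) (x : Var) : (Expr.var x).eval σ = σ.v x := rfl
theorem Expr.eval_get (σ : St) (A : Arr) (e : Expr) : (Expr.get A e).eval σ = σ.a A (e.eval σ) :=
  rfl

theorem Expr.ok_add (e f : Expr) :
    (e + f).ok V B σ ↔ e.ok V B σ ∧ f.ok V B σ ∧ e.eval σ + f.eval σ ≤ V := Iff.rfl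
theorem Expr.ok_sub (e f : Expr) : (e - f).ok V B σ ↔ e.ok V B σ ∧ f.ok V B σ := by
  show e.ok V B σ ∧ f.ok V B σ ∧ True ↔ _
  rw [and_true]
theorem Expr.ok_mul (e f : Expr) :
    (e * f).ok V B σ ↔ e.ok V B σ ∧ f.ok V B σ ∧ e.eval σ * f.eval σ ≤ V := Iff.rfl
theorem Expr.ok_div (e f : Expr) : (e / f).ok V B σ ↔ e.ok V B σ ∧ f.ok V B σ := by
  show e.ok V B σ ∧ f.ok V B σ ∧ True ↔ _
  rw [and_true]
theorem Expr.ok_mod (e f : Expr) : (e % f).ok V B σ ↔ e.ok V B σ ∧ f.ok V B σ := by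
  show e.ok V B σ ∧ f.ok V B σ ∧ True ↔ _
  rw [and_true]
theorem Expr.ok_lit (c : ℕ) : (Expr.lit c).ok V B σ ↔ c ≤ V := Iff.rfl
theorem Expr.ok_var (x : Var) : (Expr.var x).ok V B σ ↔ True := Iff.rfl
theorem Expr.ok_get (A : Arr) (e : Expr) :
    (Expr.get A e).ok V B σ ↔ e.ok V B σ ∧ (A = .raw → e.eval σ < B) := Iff.rfl

theorem Cond.eval_lt (e f : Expr) : (Cond.lt e f).eval σ ↔ e.eval σ < f.eval σ := Iff.rfl
theorem Cond.eval_eq (e f : Expr) : (Cond.eq e f).eval σ ↔ e.eval σ = f.eval σ := Iff.rfl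
theorem Cond.ok_lt (e f : Expr) : (Cond.lt e f).ok V B σ ↔ e.ok V B σ ∧ f.ok V B σ := Iff.rfl
theorem Cond.ok_eq (e f : Expr) : (Cond.eq e f).ok V B σ ↔ e.ok V B σ ∧ f.ok V B σ := Iff.rfl

end WordRAM

/-! ## Suffixes and next smaller suffixes -/

namespace CircularWord

/-- The suffix of the infinite word `T` at `i` is lexicographically smaller than that at `j`. -/
def SufLT (T : ℕ → ℕ) (i j : ℕ) : Prop :=
  ∃ k, (∀ t < k, T (i + t) = T (j + t)) ∧ T (i + k) < T (j + k)

/-- The suffixes at `i` and `j` have a longest common prefix, and its length is `k`. -/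
def Lce (T : ℕ → ℕ) (i j k : ℕ) : Prop :=
  (∀ t < k, T (i + t) = T (j + t)) ∧ T (i + k) ≠ T (j + k)

/-- `T` is a word at the positions `1, …, N`, with zeros around it. -/
structure IsText (T : ℕ → ℕ) (N : ℕ) : Prop where
  zero : T 0 = 0
  pos : ∀ i, 1 ≤ i → i ≤ N → 1 ≤ T i
  end_eq : ∀ i, N < i → T i = 0

variable {T : ℕ → ℕ} {N : ℕ}

theorem Lce.symm {i j k : ℕ} (h : Lce T i j k) : Lce T j i k :=
  ⟨fun t ht => (h.1 t ht).symm, h.2.symm⟩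

theorem Lce.unique {i j k m : ℕ} (h : Lce T i j k) (h' : Lce T i j m) : k = m := by
  rcases lt_trichotomy k m with hlt | rfl | hlt
  · exact absurd (h'.1 k hlt) h.2
  · rfl
  · exact absurd (h.1 m hlt) h'.2

theorem Lce.sufLT_iff {i j k : ℕ} (h : Lce T i j k) : SufLT T i j ↔ T (i + k) < T (j + k) := by
  constructor
  · rintro ⟨m, hm, hlt⟩
    have : k = m := h.unique ⟨hm, hlt.ne⟩
    rwa [this]
  · exact fun hlt => ⟨k, h.1, hlt⟩

theorem Lce.sufLT_or {i j k : ℕ} (h : Lce T i j k) : SufLT T i j ∨ SufLT T j i := by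
  rcases lt_or_gt_of_ne h.2 with hlt | hlt
  · exact .inl ⟨k, h.1, hlt⟩
  · exact .inr ⟨k, h.symm.1, hlt⟩

theorem SufLT.lce {i j : ℕ} (h : SufLT T i j) : ∃ k, Lce T i j k ∧ T (i + k) < T (j + k) := by
  obtain ⟨k, h1, h2⟩ := h
  exact ⟨k, ⟨h1, h2.ne⟩, h2⟩

theorem SufLT.asymm {i j : ℕ} (h : SufLT T i j) : ¬ SufLT T j i := by
  intro h'
  obtain ⟨k, hk, hlt⟩ := h.lce
  have := hk.symm.sufLT_iff.1 h'
  omega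

theorem SufLT.irrefl (i : ℕ) : ¬ SufLT T i i := fun h => h.asymm h

theorem SufLT.ne {i j : ℕ} (h : SufLT T i j) : i ≠ j := by
  rintro rfl; exact SufLT.irrefl i h

theorem SufLT.trans {i j k : ℕ} (h : SufLT T i j) (h' : SufLT T j k) : SufLT T i k := by
  obtain ⟨a, ha, hlt⟩ := h
  obtain ⟨b, hb, hlt'⟩ := h'
  rcases lt_trichotomy a b with hab | rfl | hab
  · exact ⟨a, fun t ht => (ha t ht).trans (hb t (ht.trans hab)), by rw [← hb a hab]; exact hlt⟩
  · exact ⟨a, fun t ht => (ha t ht).trans (hb t ht), hlt.trans hlt'⟩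
  · exact ⟨b, fun t ht => (ha t (ht.trans hab)).trans (hb t ht), by rw [ha b hab]; exact hlt'⟩

/-- Prepending equal words does not change the order of suffixes. -/
theorem SufLT.of_prepend {i j m : ℕ} (h : ∀ t < m, T (i + t) = T (j + t))
    (h' : SufLT T (i + m) (j + m)) : SufLT T i j := by
  obtain ⟨k, hk, hlt⟩ := h'
  refine ⟨m + k, fun t ht => ?_, by simpa [Nat.add_assoc] using hlt⟩
  by_cases htm : t < m
  · exact h t htm
  · have := hk (t - m) (by omega)
    rwa [show i + m + (t - m) = i + t by omega, show j + m + (t - m) = j + t by omega] at this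

/-- The zero at `N + 1` would face a positive letter. Only the pair `0, N + 1`, where both letters
are zero, has to be excluded by `h0`. -/
theorem IsText.le_of_match (hT : IsText T N) {i j l : ℕ} (hij : i < j) (hj : j ≤ N + 1)
    (h0 : 1 ≤ i ∨ j ≤ N) (h : ∀ t < l, T (i + t) = T (j + t)) : j + l ≤ N + 1 := by
  by_contra hlt
  have h1 := h (N + 1 - j) (by omega)
  rw [show j + (N + 1 - j) = N + 1 by omega, hT.end_eq _ (Nat.lt_succ_self N)] at h1
  have := hT.pos (i + (N + 1 - j)) (by omega) (by omega)
  omega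

theorem IsText.exists_lce (hT : IsText T N) {i j : ℕ} (hij : i < j) (hj : j ≤ N + 1)
    (h0 : 1 ≤ i ∨ j ≤ N) : ∃ k, Lce T i j k := by
  by_contra! hno
  have : ∀ l, ∀ t < l, T (i + t) = T (j + t) := by
    intro l
    induction l with
    | zero => intro t ht; omega
    | succ l ih =>
      intro t ht
      rcases Nat.lt_succ_iff_lt_or_eq.1 ht with h | rfl
      · exact ih t h
      · by_contra hne
        exact hno t ⟨ih, hne⟩
  have := hT.le_of_match hij hj h0 (this (N + 2))
  omega

theorem IsText.sufLT_or (hT : IsText T N) {i j : ℕ} (hij : i < j) (hj : j ≤ N + 1)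
    (h0 : 1 ≤ i ∨ j ≤ N) : SufLT T i j ∨ SufLT T j i := by
  obtain ⟨k, hk⟩ := hT.exists_lce hij hj h0
  exact hk.sufLT_or

/-- Position `0` is a sentinel: the search for a previous smaller suffix stops there at the latest.
-/
theorem IsText.zero_sufLT (hT : IsText T N) {i : ℕ} (hi : 1 ≤ i) (hiN : i ≤ N) : SufLT T 0 i :=
  ⟨0, by simp, by have := hT.pos i hi hiN; simp only [hT.zero, Nat.add_zero]; omega⟩

/-- The next smaller suffix of `i` is that at `c`. -/
def Nss (T : ℕ → ℕ) (i c : ℕ) : Prop :=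
  i < c ∧ SufLT T c i ∧ ∀ k, i < k → k < c → SufLT T i k

/-- The previous smaller suffix of `i` is that at `j`. -/
def Pss (T : ℕ → ℕ) (i j : ℕ) : Prop :=
  j < i ∧ SufLT T j i ∧ ∀ k, j < k → k < i → SufLT T i k

/-- All suffixes that begin between `j` and `i` are greater than those at `j` and `i`. -/
def Visible (T : ℕ → ℕ) (j i : ℕ) : Prop :=
  j < i ∧ ∀ k, j < k → k < i → SufLT T j k ∧ SufLT T i k

theorem Nss.unique {i c d : ℕ} (h : Nss T i c) (h' : Nss T i d) : c = d := by
  rcases lt_trichotomy c d with hlt | rfl | hlt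
  · exact absurd (h'.2.2 c h.1 hlt) h.2.1.asymm
  · rfl
  · exact absurd (h.2.2 d h'.1 hlt) h'.2.1.asymm

theorem Visible.pss {i j : ℕ} (h : Visible T j i) (h' : SufLT T j i) : Pss T i j :=
  ⟨h.1, h', fun k h1 h2 => (h.2 k h1 h2).2⟩

theorem Visible.nss {i j : ℕ} (h : Visible T j i) (h' : SufLT T i j) : Nss T j i :=
  ⟨h.1, h', fun k h1 h2 => (h.2 k h1 h2).1⟩

theorem visible_pred {i : ℕ} (hi : 1 ≤ i) : Visible T (i - 1) i :=
  ⟨by omega, fun k h1 h2 => by omega⟩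

/-- This is the stack step: everything between `p` and `j` is greater than `j` and hence greater
than `i`, so after `j` the next candidate for the previous smaller suffix of `i` is `p`. -/
theorem Visible.pop {i j p : ℕ} (h : Visible T j i) (h' : SufLT T i j) (hp : Pss T j p) :
    Visible T p i := by
  refine ⟨hp.1.trans h.1, fun k h1 h2 => ?_⟩
  rcases lt_trichotomy k j with hkj | rfl | hkj
  · have := hp.2.2 k h1 hkj
    exact ⟨hp.2.1.trans this, h'.trans this⟩
  · exact ⟨hp.2.1, h'⟩
  · exact ⟨hp.2.1.trans (h.2 k hkj h2).1, (h.2 k hkj h2).2⟩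

/-- A suffix to the left that is smaller begins at or before the previous smaller suffix. -/
theorem Pss.le_of_sufLT {i j k : ℕ} (h : Pss T i j) (hk : k < i) (h' : SufLT T k i) : k ≤ j := by
  by_contra hlt
  exact h'.asymm (h.2.2 k (by omega) hk)

/-! ### The arrays of previous and next smaller suffixes -/

/-- The arrays of previous and next smaller suffixes with the lengths of the common prefixes are
correct as far as they can be when only the suffixes at positions below `i` are known. -/
structure Known (T : ℕ → ℕ) (N i : ℕ) (ps pl ns nl : ℕ → ℕ) : Prop where
  pss : ∀ k, 1 ≤ k → k < i → Pss T k (ps k) ∧ Lce T (ps k) k (pl k)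
  nss : ∀ k ≤ N, (Nss T k (ns k) ∧ ns k < i ∧ Lce T k (ns k) (nl k)) ∨
    (ns k = N + 1 ∧ nl k = 0 ∧ ∀ c, k < c → c < i → SufLT T k c)

/-- The suffix at `i` has been compared with its predecessors down to `j`, exclusively. -/
structure Known' (T : ℕ → ℕ) (N i j : ℕ) (ps pl ns nl : ℕ → ℕ) : Prop where
  visible : Visible T j i
  pss : ∀ k, 1 ≤ k → k < i → Pss T k (ps k) ∧ Lce T (ps k) k (pl k)
  nss : ∀ k ≤ N, (Nss T k (ns k) ∧ (ns k < i ∨ ns k = i ∧ j < k) ∧ Lce T k (ns k) (nl k)) ∨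
    (ns k = N + 1 ∧ nl k = 0 ∧ (k ≤ j ∨ i ≤ k) ∧ ∀ c, k < c → c < i → SufLT T k c)

variable {ps pl ns nl : ℕ → ℕ} {i j : ℕ}

theorem Known.start (h : Known T N i ps pl ns nl) (hi : 1 ≤ i) :
    Known' T N i (i - 1) ps pl ns nl where
  visible := visible_pred hi
  pss := h.pss
  nss k hk := by
    rcases h.nss k hk with ⟨h1, h2, h3⟩ | ⟨h1, h2, h3⟩
    · exact .inl ⟨h1, .inl h2, h3⟩
    · exact .inr ⟨h1, h2, by omega, h3⟩

/-- The entry of `j` is still open when `j` is about to be popped, so every pop decreases the number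
of open entries. -/
theorem Known'.ns_eq (h : Known' T N i j ps pl ns nl) (hi : i ≤ N) : ns j = N + 1 := by
  have hj := h.visible.1
  rcases h.nss j (by omega) with ⟨h1, h2, h3⟩ | ⟨h1, -⟩
  · have h4 : ns j < i := by omega
    exact absurd (h.visible.2 _ h1.1 h4).1 h1.2.1.asymm
  · exact h1

theorem Known'.pop (h : Known' T N i j ps pl ns nl) (hj : 1 ≤ j) {l : ℕ}
    (hl : Lce T j i l) (hlt : SufLT T i j) :
    Known' T N i (ps j) ps pl (Function.update ns j i) (Function.update nl j l) where
  visible := h.visible.pop hlt (h.pss j hj h.visible.1).1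
  pss := h.pss
  nss k hk := by
    have hp := (h.pss j hj h.visible.1).1
    by_cases hkj : k = j
    · subst hkj
      simp only [Function.update_self]
      exact .inl ⟨h.visible.nss hlt, .inr ⟨trivial, hp.1⟩, hl⟩
    · simp only [Function.update_of_ne hkj]
      rcases h.nss k hk with ⟨h1, h2, h3⟩ | ⟨h1, h2, h3, h4⟩
      · have := hp.1
        exact .inl ⟨h1, by omega, h3⟩
      · refine .inr ⟨h1, h2, ?_, h4⟩
        -- An open position strictly between `ps j` and `j` would be smaller than `j`, contrary to
        -- the choice of `ps j`.
        by_contra hc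
        have hj' := h.visible.1
        exact (h4 j (by omega) hj').asymm (hp.2.2 k (by omega) (by omega))

theorem Known'.done (h : Known' T N i j ps pl ns nl) {l : ℕ}
    (hl : Lce T j i l) (hlt : SufLT T j i) :
    Known T N (i + 1) (Function.update ps i j) (Function.update pl i l) ns nl where
  pss k h1 h2 := by
    by_cases hki : k = i
    · subst hki
      simp only [Function.update_self]
      exact ⟨h.visible.pss hlt, hl⟩
    · simp only [Function.update_of_ne hki]
      exact h.pss k h1 (by omega)
  nss k hk := by
    rcases h.nss k hk with ⟨h1, h2, h3⟩ | ⟨h1, h2, h3, h4⟩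
    · exact .inl ⟨h1, by omega, h3⟩
    · refine .inr ⟨h1, h2, fun c hkc hci => ?_⟩
      rcases Nat.lt_succ_iff_lt_or_eq.1 hci with hci | rfl
      · exact h4 c hkc hci
      · have h5 : k ≤ j := by omega
        rcases Nat.lt_or_eq_of_le h5 with h6 | rfl
        · exact (h4 j h6 h.visible.1).trans hlt
        · exact hlt

/-- If the suffixes at `j` and `i` agree longer than those at the previous smaller suffix of `j`
and `j`, then these two have the same previous smaller suffix. -/
theorem Lce.pop {p l m : ℕ} (hl : Lce T j i l) (hm : Lce T p j m) (hml : m < l) : Lce T p i m :=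
  ⟨fun t ht => (hm.1 t ht).trans (hl.1 t (ht.trans hml)), by rw [← hl.1 m hml]; exact hm.2⟩

/-! ### Copying -/

/-- The pair `x, y` has a common prefix that reaches up to `r`, and the comparisons at the positions
between `y` and `i` were copies of comparisons at distance `y - x`. -/
structure Copies (T : ℕ → ℕ) (i x y r : ℕ) (ps : ℕ → ℕ) : Prop where
  lt_i : y < i
  le_d : i ≤ y + (y - x)
  visible : Visible T x y
  lce : Lce T x y (r - y)
  lt_r : y < r
  ps_eq : ∀ k, y < k → k < i → ps k = ps (k - (y - x)) + (y - x)

variable {x y r : ℕ}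

theorem Copies.eq (h : Copies T i x y r ps) {k : ℕ} (h1 : y ≤ k) (h2 : k < r) :
    T k = T (k - (y - x)) := by
  have := h.lce.1 (k - y) (by omega)
  have hxy := h.visible.1
  rw [show x + (k - y) = k - (y - x) by omega, show y + (k - y) = k by omega] at this
  exact this.symm

theorem Copies.match (h : Copies T i x y r ps) (hj : y ≤ j) {l : ℕ} (hji : j < i) (hl : i + l ≤ r)
    (hl' : ∀ t < l, T (j - (y - x) + t) = T (i - (y - x) + t)) : ∀ t < l, T (j + t) = T (i + t) := by
  intro t ht
  have hxy := h.visible.1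
  have hyi := h.lt_i
  rw [h.eq (by omega) (by omega), h.eq (k := i + t) (by omega) (by omega)]
  have := hl' t ht
  rwa [show j + t - (y - x) = j - (y - x) + t by omega,
    show i + t - (y - x) = i - (y - x) + t by omega]

theorem Copies.letter (h : Copies T i x y r ps) {l : ℕ} (hj : y ≤ j) (hl : j + l < r) :
    T (j - (y - x) + l) = T (j + l) := by
  have hxy := h.visible.1
  rw [h.eq (k := j + l) (by omega) hl]
  congr 1; omega

/-- The strict bound is essential: the mismatching letters themselves must lie in the stretch that
is a copy. -/
theorem Copies.lce_of (h : Copies T i x y r ps) (hj : y ≤ j) (hji : j < i) {l : ℕ} (hl : i + l < r)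
    (hl' : Lce T (j - (y - x)) (i - (y - x)) l) : Lce T j i l := by
  refine ⟨h.match hj hji hl.le hl'.1, ?_⟩
  rw [← h.letter hj (by omega), ← h.letter h.lt_i.le hl]
  exact hl'.2

theorem Copies.sufLT_of (h : Copies T i x y r ps) (hj : y ≤ j) (hji : j < i) {l : ℕ} (hl : i + l < r)
    (hl' : Lce T (j - (y - x)) (i - (y - x)) l) :
    (SufLT T (j - (y - x)) (i - (y - x)) ↔ SufLT T j i) := by
  rw [hl'.sufLT_iff, (h.lce_of hj hji hl hl').sufLT_iff, h.letter hj (by omega),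
    h.letter h.lt_i.le hl]

/-- The pairs `j, i` and `j - (y - x), i - (y - x)` are both to be compared. -/
structure CopyStep (T : ℕ → ℕ) (i j x y : ℕ) (ps : ℕ → ℕ) : Prop where
  le_j : y ≤ j
  visible : Visible T (j - (y - x)) (i - (y - x))
  ps_le : ps (i - (y - x)) ≤ j - (y - x)

theorem Copies.start (h : Copies T i x y r ps) (hk : Known T N i ps pl ns nl) :
    CopyStep T i (i - 1) x y ps := by
  have hxy := h.visible.1
  have hyi := h.lt_i
  have h1 := (hk.pss (i - (y - x)) (by omega) (by omega)).1.1
  refine ⟨by omega, ?_, by omega⟩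
  have := visible_pred (T := T) (i := i - (y - x)) (by omega)
  rwa [show i - (y - x) - 1 = i - 1 - (y - x) by omega] at this

/-- A visible pair is an edge to a previous or to a next smaller suffix. In this case the common
prefix of the pair to be copied is stored in `pl`; in the other case it is stored in `nl`. -/
theorem CopyStep.lce_pss (h : Copies T i x y r ps) (hk : Known' T N i j ps pl ns nl)
    (he : ps (i - (y - x)) = j - (y - x)) :
    Lce T (j - (y - x)) (i - (y - x)) (pl (i - (y - x))) ∧ SufLT T (j - (y - x)) (i - (y - x)) := by
  have hxy := h.visible.1
  have hyi := h.lt_i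
  have h1 := hk.pss (i - (y - x)) (by omega) (by omega)
  rw [he] at h1
  exact ⟨h1.2, h1.1.2.1⟩

theorem CopyStep.lce_nss (hc : CopyStep T i j x y ps) (h : Copies T i x y r ps)
    (hk : Known' T N i j ps pl ns nl) (hi : i ≤ N) (he : ps (i - (y - x)) ≠ j - (y - x)) :
    Lce T (j - (y - x)) (i - (y - x)) (nl (j - (y - x))) ∧
      SufLT T (i - (y - x)) (j - (y - x)) := by
  have hxy := h.visible.1
  have hyi := h.lt_i
  have hji := hk.visible.1
  have hcv := hc.visible.1
  have h1 := (hk.pss (i - (y - x)) (by omega) (by omega)).1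
  have h2 := h1.2.2 _ (lt_of_le_of_ne hc.ps_le he) hcv
  have h3 := hc.visible.nss h2
  rcases hk.nss (j - (y - x)) (by omega) with ⟨h4, h5, h6⟩ | ⟨h4, h5, h6, h7⟩
  · rw [h4.unique h3] at h6
    exact ⟨h6, h2⟩
  · exact absurd (h7 _ hcv (by omega)) h2.asymm

theorem CopyStep.next (hc : CopyStep T i j x y ps) (h : Copies T i x y r ps)
    (hk : Known' T N i j ps pl ns nl) (hi : i ≤ N) (he : ps (i - (y - x)) ≠ j - (y - x))
    (hl : i + nl (j - (y - x)) < r) : 1 ≤ j ∧ CopyStep T i (ps j) x y ps := by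
  have hxy := h.visible.1
  have hyi := h.lt_i
  have hid := h.le_d
  have hji := hk.visible.1
  have hyj := hc.le_j
  have hcv := hc.visible.1
  obtain ⟨h1, h2⟩ := hc.lce_nss h hk hi he
  have hlt := lt_of_le_of_ne hc.ps_le he
  have h3 := (hk.pss (i - (y - x)) (by omega) (by omega)).1
  -- If `j = y`, then the original of `j` is `x`. If the original of `i` is before `y`, then `x` is
  -- smaller than it, so it would be its previous smaller suffix. If the original of `i` is `y`,
  -- then the match reaches `r`, contrary to `hl`.
  have hjy : y < j := by
    rcases Nat.lt_or_eq_of_le hyj with hlt' | rfl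
    · exact hlt'
    · exfalso
      rw [show y - (y - x) = x by omega] at *
      rcases Nat.lt_or_eq_of_le (show i - (y - x) ≤ y by omega) with h4 | h4
      · have := h3.le_of_sufLT hcv (h.visible.2 _ hcv h4).1
        omega
      · rw [h4] at h1
        have := h1.unique h.lce
        omega
  have hj' := (hk.pss (j - (y - x)) (by omega) (by omega)).1
  have h5 := hj'.le_of_sufLT (by omega) (h.visible.2 (j - (y - x)) (by omega) (by omega)).1
  have h6 := h.ps_eq j hjy hji
  refine ⟨by omega, ⟨by omega, ?_, ?_⟩⟩
  · rw [show ps j - (y - x) = ps (j - (y - x)) by omega]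
    exact hc.visible.pop h2 hj'
  · rw [show ps j - (y - x) = ps (j - (y - x)) by omega]
    by_contra hc'
    have h7 := hj'.2.2 (ps (i - (y - x))) (by omega) hlt
    exact (h3.2.1.trans h2).asymm h7

theorem Copies.succ (h : Copies T i x y r ps) (hc : CopyStep T i j x y ps)
    (hk : Known' T N i j ps pl ns nl) (he : ps (i - (y - x)) = j - (y - x))
    (hl : i + pl (i - (y - x)) < r) : Copies T (i + 1) x y r (Function.update ps i j) := by
  have hxy := h.visible.1
  have hyi := h.lt_i
  have hid := h.le_d
  have hyj := hc.le_j
  have hlce := hk.pss (i - (y - x)) (by omega) (by omega)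
  refine ⟨by omega, ?_, h.visible, h.lce, h.lt_r, fun k h1 h2 => ?_⟩
  -- Copying cannot go on beyond one period: the original of `i` would be `y`, its previous smaller
  -- suffix `x`, and the match of these two ends at `r`, contrary to `hl`.
  · by_contra hlt
    have h1 : i - (y - x) = y := by omega
    rw [h1] at he hl hlce
    rw [he] at hlce
    have h2 := hlce.1.1
    have h3 : j - (y - x) = x := by
      by_contra hne
      exact (h.visible.2 (j - (y - x)) (by omega) h2).2.asymm hlce.1.2.1
    rw [h3] at hlce
    have := hlce.2.unique h.lce
    omega
  · rw [Function.update_of_ne (show k - (y - x) ≠ i by omega)]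
    by_cases hki : k = i
    · subst hki
      rw [Function.update_self, he]; omega
    · rw [Function.update_of_ne hki]
      exact h.ps_eq k h1 (by omega)

theorem Copies.of_visible (h : Visible T j i) {l : ℕ} (hl : Lce T j i l) (h0 : 0 < l) (ps : ℕ → ℕ) :
    Copies T (i + 1) j i (i + l) ps := by
  have := h.1
  exact ⟨by omega, by omega, h, by simpa using hl, by omega, fun k h1 h2 => by omega⟩

end CircularWord

namespace WordRAM

open CircularWord

attribute [simp] wp_skip wp_assign wp_store wp_seq wp_ite St.set_v St.set_a St.put_v St.put_a
  Expr.eval_add Expr.eval_sub Expr.eval_mul Expr.eval_div Expr.eval_mod Expr.eval_lit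
  Expr.eval_var Expr.eval_get Expr.ok_add Expr.ok_sub Expr.ok_mul Expr.ok_div Expr.ok_mod
  Expr.ok_lit Expr.ok_var Expr.ok_get Cond.eval_lt Cond.eval_eq Cond.ok_lt Cond.ok_eq

infixr:60 " ;; " => Stmt.seq
infix:61 " ::= " => Stmt.assign

/-! ### Computing previous and next smaller suffixes -/

/-- Extend the common prefix of the suffixes at `j` and `i`. -/
def extendRight : Stmt :=
  .while (.eq (.get .text (Var.j + Var.l)) (.get .text (Var.i + Var.l))) (.l ::= Var.l + .lit 1)

/-- The state `st` is 0 while results are copied, 1 while letters are compared and 2 when `i` is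
finished. If a copied match reaches `r`, the comparison of letters takes over with the `r - i`
letters that are known to agree. -/
def copyBody : Stmt :=
  .ite (.eq (.get .ps (Var.i - Var.d)) (Var.j - Var.d))
    (.ite (.lt (.get .pl (Var.i - Var.d)) (Var.r - Var.i))
      (.store .ps Var.i Var.j ;; .store .pl Var.i (.get .pl (Var.i - Var.d)) ;; .st ::= .lit 2)
      (.l ::= Var.r - Var.i ;; .st ::= .lit 1))
    (.ite (.lt (.get .nl (Var.j - Var.d)) (Var.r - Var.i))
      (.store .nl Var.j (.get .nl (Var.j - Var.d)) ;; .store .ns Var.j Var.i ;;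
        .j ::= .get .ps Var.j)
      (.l ::= Var.r - Var.i ;; .st ::= .lit 1))

/-- Copy the results of comparisons. -/
def copyLoop : Stmt := .while (.eq Var.st (.lit 0)) copyBody

/-- After `j` is popped, `ps j` is compared with `i` through `j`. If `ps j` and `j` differ within
the first `l` letters, this mismatch also decides about `ps j` and `i`. Otherwise `ps j` and `i`
agree in `l` letters, and `l` need not be reset. -/
def compareBody : Stmt :=
  extendRight ;; .x ::= Var.j ;; .y ::= Var.i ;; .r ::= Var.i + Var.l ;;
    .ite (.lt (.get .text (Var.j + Var.l)) (.get .text (Var.i + Var.l)))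
      (.store .ps Var.i Var.j ;; .store .pl Var.i Var.l ;; .st ::= .lit 2)
      (.store .nl Var.j Var.l ;; .store .ns Var.j Var.i ;;
        .ite (.lt (.get .pl Var.j) Var.l)
          (.store .ps Var.i (.get .ps Var.j) ;; .store .pl Var.i (.get .pl Var.j) ;; .st ::= .lit 2)
          (.j ::= .get .ps Var.j))

/-- Compare suffixes letter by letter. -/
def compareLoop : Stmt := .while (.eq Var.st (.lit 1)) compareBody

def edgesBody : Stmt :=
  .j ::= Var.i - .lit 1 ;; .l ::= .lit 0 ;;
    .ite (.lt Var.i Var.r) (.d ::= Var.y - Var.x ;; .st ::= .lit 0 ;; copyLoop) (.st ::= .lit 1) ;;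
    compareLoop ;; .i ::= Var.i + .lit 1

/-- These values are final for positions without a smaller suffix in the text: the zero at `N + 1`
makes that suffix smaller, with empty common prefix. -/
def clearLoop : Stmt :=
  .while (.lt Var.i (Var.N + .lit 1))
    (.store .ns Var.i (Var.N + .lit 1) ;; .store .nl Var.i (.lit 0) ;; .i ::= Var.i + .lit 1)

/-- Compute the arrays of previous and next smaller suffixes. -/
def edges : Stmt :=
  .i ::= .lit 0 ;; clearLoop ;; .i ::= .lit 1 ;; .r ::= .lit 0 ;; .while (.lt Var.i (Var.N + .lit 1)) edgesBody

/-- The number of positions whose next smaller suffix is not known yet. -/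
def unset (N : ℕ) (ns : ℕ → ℕ) : ℕ := ((Finset.range (N + 1)).filter fun k => ns k = N + 1).card

theorem unset_update {N j v : ℕ} {ns : ℕ → ℕ} (hj : j ≤ N) (h : ns j = N + 1) (hv : v ≤ N) :
    unset N (Function.update ns j v) + 1 = unset N ns := by
  unfold unset
  have : ((Finset.range (N + 1)).filter fun k => Function.update ns j v k = N + 1) =
      ((Finset.range (N + 1)).filter fun k => ns k = N + 1).erase j := by
    ext k
    simp only [Finset.mem_filter, Finset.mem_range, Finset.mem_erase, Function.update_apply]
    by_cases hk : k = j
    · subst hk; simp; omega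
    · simp [hk]
  rw [this, Finset.card_erase_add_one]
  simp only [Finset.mem_filter, Finset.mem_range]
  exact ⟨by omega, h⟩

theorem unset_le (N : ℕ) (ns : ℕ → ℕ) : unset N ns ≤ N + 1 :=
  (Finset.card_filter_le _ _).trans (by simp)

variable {V B : ℕ} {σ : St} {τ : ℕ}

/-- The cost is the growth of `l`, and `i + l` never exceeds `N + 1`. -/
theorem extendRight_spec {N : ℕ} (hT : IsText (σ.a .text) N) (hji : σ.v .j < σ.v .i)
    (hi : σ.v .i ≤ N) (hm : ∀ t < σ.v .l, σ.a .text (σ.v .j + t) = σ.a .text (σ.v .i + t))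
    (hV : N + 2 ≤ V) (hτ : N + 1 ≤ τ + (σ.v .i + σ.v .l)) :
    wp V B extendRight (fun σ' τ' => Lce (σ.a .text) (σ.v .j) (σ.v .i) (σ'.v .l) ∧
      τ' + σ'.v .l = τ + σ.v .l ∧ σ.v .l ≤ σ'.v .l) σ τ := by
  have hb := fun l hm => hT.le_of_match (l := l) hji (by omega) (.inr hi) hm
  refine wp_while (fun σ' τ' => (∀ t < σ'.v .l, σ.a .text (σ.v .j + t) = σ.a .text (σ.v .i + t)) ∧
      τ' + σ'.v .l = τ + σ.v .l ∧ σ.v .l ≤ σ'.v .l) ⟨hm, rfl, le_rfl⟩ ?_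
  rintro σ' τ' ⟨h1, h2, h3⟩ hF
  have hj : σ'.v .j = σ.v .j := hF.1 _ (by simp [Stmt.setsVar])
  have hi' : σ'.v .i = σ.v .i := hF.1 _ (by simp [Stmt.setsVar])
  have ht : σ'.a .text = σ.a .text := hF.2 _ (by simp [Stmt.setsArr])
  have hb1 := hb _ h1
  simp only [Cond.ok_eq, Expr.ok_get, Expr.ok_add, Expr.ok_var, Cond.eval_eq, Expr.eval_get,
    Expr.eval_add, Expr.eval_var, ht, hj, hi']
  refine ⟨⟨⟨⟨trivial, trivial, by omega⟩, by simp⟩, ⟨trivial, trivial, by omega⟩, by simp⟩,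
    fun he => ?_, fun he => ⟨⟨h1, he⟩, h2, h3⟩⟩
  have h4 : ∀ t < σ'.v .l + 1, σ.a .text (σ.v .j + t) = σ.a .text (σ.v .i + t) := by
    intro t ht
    rcases Nat.lt_succ_iff_lt_or_eq.1 ht with h | rfl
    · exact h1 t h
    · exact he
  have hb2 := hb _ h4
  simp
  exact ⟨by omega, by omega, fun t ht => h4 t (by omega), by omega, by omega⟩

/-- The invariant of the loop in `compareLoop`. -/
def CompareInv (N K : ℕ) (σ : St) (τ : ℕ) : Prop :=
  (σ.v .st = 1 ∧ Known' (σ.a .text) N (σ.v .i) (σ.v .j) (σ.a .ps) (σ.a .pl) (σ.a .ns) (σ.a .nl) ∧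
    (∀ t < σ.v .l, σ.a .text (σ.v .j + t) = σ.a .text (σ.v .i + t)) ∧
    -- One credit finishes `i`, open entries pay for pops, and the rest pays for letters not yet
    -- matched.
    1 + unset N (σ.a .ns) + (N + 1 - (σ.v .i + σ.v .l)) + K ≤ τ) ∨
  (σ.v .st = 2 ∧ Known (σ.a .text) N (σ.v .i + 1) (σ.a .ps) (σ.a .pl) (σ.a .ns) (σ.a .nl) ∧
    (σ.v .i + 1 < σ.v .r →
      Copies (σ.a .text) (σ.v .i + 1) (σ.v .x) (σ.v .y) (σ.v .r) (σ.a .ps)) ∧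
    -- The maximum covers an empty match, for which `r` is only `i`.
    unset N (σ.a .ns) + (N + 1 - max (σ.v .i + 1) (σ.v .r)) + K ≤ τ)

theorem compareBody_spec {N K : ℕ} (hT : IsText (σ.a .text) N) (hi1 : 1 ≤ σ.v .i) (hi : σ.v .i ≤ N)
    (hV : N + 2 ≤ V) (hst : σ.v .st = 1) (h : CompareInv N K σ (τ + 1)) :
    wp V B compareBody (CompareInv N K) σ τ := by
  rcases h with ⟨-, hk, hm, hτ⟩ | ⟨h, -⟩
  swap; · omega
  unfold compareBody
  rw [wp_seq]
  refine (extendRight_spec hT hk.visible.1 hi hm hV (by omega)).apply ?_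
  rintro σ' τ' ⟨hl, h2, h3⟩ hF
  have hj : σ'.v .j = σ.v .j := hF.1 _ (by simp [extendRight, Stmt.setsVar])
  have hi' : σ'.v .i = σ.v .i := hF.1 _ (by simp [extendRight, Stmt.setsVar])
  have ha : ∀ A, σ'.a A = σ.a A := fun A => hF.2 A (by simp [extendRight, Stmt.setsArr])
  have hb := hT.le_of_match (l := σ'.v .l) hk.visible.1 (by omega) (.inr hi) hl.1
  have hji := hk.visible.1
  generalize hlv : σ'.v .l = l at *
  generalize σ.v .j = j at *
  generalize σ.v .i = i at *
  have hcop : ∀ ps, i + 1 < i + l → Copies (σ.a .text) (i + 1) j i (i + l) ps :=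
    fun ps hlt => .of_visible hk.visible hl (by omega) ps
  simp [ha, hj, hi', hlv]
  refine ⟨by omega, by omega, fun hlt => ⟨by omega, .inr ?_⟩, fun hlt => ?_⟩
  · have hdone := hk.done hl ⟨l, hl.1, hlt⟩
    simp [ha, hj, hi', hlv]
    exact ⟨hdone, fun h => hcop _ (by omega), by omega⟩
  · have hlt' : SufLT (σ.a .text) i j :=
      ⟨l, hl.symm.1, lt_of_le_of_ne hlt hl.2.symm⟩
    have hj1 : 1 ≤ j := by
      by_contra hj0
      have : j = 0 := by omega
      subst this
      exact hlt'.asymm (hT.zero_sufLT hi1 hi)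
    have hpop := hk.pop hj1 hl hlt'
    have hun := unset_update (v := i) (by omega) (hk.ns_eq hi) hi
    have hp := hk.pss j hj1 hji
    refine ⟨fun hml => ⟨by omega, .inr ?_⟩, fun hml => .inl ?_⟩
    · have hdone := hpop.done (hl.pop hp.2 hml)
        (((hl.pop hp.2 hml).sufLT_iff).2 (by
          have := hp.2.sufLT_iff.1 hp.1.2.1
          rwa [← hl.1 _ hml]))
      simp [ha, hj, hi', hlv]
      exact ⟨hdone, fun h => hcop _ (by omega), by omega⟩
    · have hst' : σ'.v .st = 1 := (hF.1 _ (by simp [extendRight, Stmt.setsVar])).trans hst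
      simp [ha, hj, hi', hlv, hst']
      exact ⟨hpop, fun t ht => (hp.2.1 t (by omega)).trans (hl.1 t ht), by omega⟩

theorem compareLoop_spec {N K : ℕ} (hT : IsText (σ.a .text) N) (hi1 : 1 ≤ σ.v .i)
    (hi : σ.v .i ≤ N) (hV : N + 2 ≤ V) (h : CompareInv N K σ τ) :
    wp V B compareLoop (fun σ' τ' => σ'.v .st = 2 ∧ CompareInv N K σ' τ') σ τ := by
  refine wp_while (CompareInv N K) h ?_
  intro σ' τ' hI hF
  have ht : σ'.a .text = σ.a .text := hF.2 _ (by simp [compareBody, extendRight, Stmt.setsArr])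
  have hi' : σ'.v .i = σ.v .i := hF.1 _ (by simp [compareBody, extendRight, Stmt.setsVar])
  refine ⟨by simp; omega, fun hc => ?_, fun hc => ⟨?_, hI⟩⟩
  · have h1 : 1 ≤ τ' := by
      rcases hI with ⟨-, -, -, h⟩ | ⟨h, -⟩
      · omega
      · simp at hc; omega
    refine ⟨h1, compareBody_spec (by rwa [ht]) (by omega) (by omega) hV hc ?_⟩
    rwa [Nat.sub_add_cancel h1]
  · rcases hI with ⟨h, -⟩ | ⟨h, -⟩
    · exact absurd h hc
    · exact h

/-- The invariant of the loop in `copyLoop`. -/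
def CopyInv (N K : ℕ) (σ : St) (τ : ℕ) : Prop :=
  (σ.v .st = 0 ∧ Known' (σ.a .text) N (σ.v .i) (σ.v .j) (σ.a .ps) (σ.a .pl) (σ.a .ns) (σ.a .nl) ∧
    Copies (σ.a .text) (σ.v .i) (σ.v .x) (σ.v .y) (σ.v .r) (σ.a .ps) ∧
    CopyStep (σ.a .text) (σ.v .i) (σ.v .j) (σ.v .x) (σ.v .y) (σ.a .ps) ∧
    2 + unset N (σ.a .ns) + (N + 1 - σ.v .r) + K ≤ τ) ∨ CompareInv N K σ τ

theorem copyBody_spec {N K : ℕ} (hi : σ.v .i ≤ N) (hir : σ.v .i < σ.v .r)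
    (hd : σ.v .d = σ.v .y - σ.v .x) (hV : N + 2 ≤ V) (hst : σ.v .st = 0)
    (h : CopyInv N K σ (τ + 1)) : wp V B copyBody (CopyInv N K) σ τ := by
  rcases h with ⟨-, hk, hc, hs, hτ⟩ | ⟨h, -⟩ | ⟨h, -⟩
  rotate_left; · omega
  · omega
  have hji := hk.visible.1
  have hyi := hc.lt_i
  have hxy := hc.visible.1
  have hyj := hs.le_j
  have hjd : σ.v .j - (σ.v .y - σ.v .x) < σ.v .i - (σ.v .y - σ.v .x) := by omega
  unfold copyBody
  simp [hd]
  refine ⟨fun he => ⟨fun hlt => ⟨by omega, .inr (.inr ?_)⟩, fun hlt => ⟨by omega, .inr (.inl ?_)⟩⟩,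
    fun he => ⟨fun hlt => .inl ?_, fun hlt => ⟨by omega, .inr (.inl ?_)⟩⟩⟩
  · obtain ⟨h1, h2⟩ := CopyStep.lce_pss hc hk he
    have h3 := hc.lce_of hyj hji (by omega) h1
    have h4 := (hc.sufLT_of hyj hji (by omega) h1).1 h2
    have h5 := hk.done h3 h4
    have h6 := hc.succ hs hk he (by omega)
    simp
    exact ⟨h5, fun _ => h6, by omega⟩
  · obtain ⟨h1, h2⟩ := CopyStep.lce_pss hc hk he
    simp
    refine ⟨hk, hc.match hyj hji (by omega) fun t ht => h1.1 t (by omega), by omega⟩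
  · obtain ⟨h1, h2⟩ := hs.lce_nss hc hk hi he
    obtain ⟨hj1, h7⟩ := hs.next hc hk hi he (by omega)
    have h3 := hc.lce_of hyj hji (by omega) h1
    have h4 : SufLT (σ.a .text) (σ.v .i) (σ.v .j) := by
      rcases h3.sufLT_or with h | h
      · exact absurd ((hc.sufLT_of hyj hji (by omega) h1).2 h) h2.asymm
      · exact h
    have h5 := hk.pop hj1 h3 h4
    have hun := unset_update (v := σ.v .i) (by omega) (hk.ns_eq hi) hi
    simp [hst]
    exact ⟨h5, hc, h7, by omega⟩
  · obtain ⟨h1, h2⟩ := hs.lce_nss hc hk hi he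
    simp
    refine ⟨hk, hc.match hyj hji (by omega) fun t ht => h1.1 t (by omega), by omega⟩

theorem copyLoop_spec {N K : ℕ} (hi : σ.v .i ≤ N) (hir : σ.v .i < σ.v .r)
    (hd : σ.v .d = σ.v .y - σ.v .x) (hV : N + 2 ≤ V) (h : CopyInv N K σ τ) :
    wp V B copyLoop (CompareInv N K) σ τ := by
  refine wp_while (CopyInv N K) h ?_
  intro σ' τ' hI hF
  have hv : ∀ z, z ≠ .l → z ≠ .st → z ≠ .j → σ'.v z = σ.v z :=
    fun z h1 h2 h3 => hF.1 _ (by simp [copyBody, Stmt.setsVar, h1, h2, h3])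
  refine ⟨by simp, fun hc => ?_, fun hc => ?_⟩
  · have h1 : 1 ≤ τ' := by
      rcases hI with ⟨-, -, -, -, h⟩ | ⟨h, -⟩ | ⟨h, -⟩
      · omega
      · simp at hc; omega
      · simp at hc; omega
    refine ⟨h1, copyBody_spec ?_ ?_ ?_ hV hc ?_⟩
    · rwa [hv _ (by simp) (by simp) (by simp)]
    · rwa [hv _ (by simp) (by simp) (by simp), hv _ (by simp) (by simp) (by simp)]
    · rwa [hv _ (by simp) (by simp) (by simp), hv _ (by simp) (by simp) (by simp),
        hv _ (by simp) (by simp) (by simp)]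
    · rwa [Nat.sub_add_cancel h1]
  · rcases hI with ⟨h, -⟩ | h
    · exact absurd h hc
    · exact h

end WordRAM

/-! ### Common suffixes at edges, and edges that repeat to the left -/

namespace CircularWord

variable {T : ℕ → ℕ} {N : ℕ}

/-- All next smaller suffixes and the lengths of common prefixes are correct. -/
def NssArrays (T : ℕ → ℕ) (N : ℕ) (ns nl : ℕ → ℕ) : Prop :=
  ∀ k, 1 ≤ k → k ≤ N → Nss T k (ns k) ∧ ns k ≤ N + 1 ∧ Lce T k (ns k) (nl k)

theorem Known.nssArrays {ps pl ns nl : ℕ → ℕ} (hT : IsText T N)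
    (h : Known T N (N + 1) ps pl ns nl) : NssArrays T N ns nl := by
  intro k hk hkN
  rcases h.nss k hkN with ⟨h1, h2, h3⟩ | ⟨h1, h2, h3⟩
  · exact ⟨h1, by omega, h3⟩
  · have hp := hT.pos k hk hkN
    have he := hT.end_eq (N + 1) (by omega)
    rw [h1, h2]
    exact ⟨⟨by omega, ⟨0, by simp, by simp only [Nat.add_zero]; omega⟩, h3⟩, le_rfl, by simp,
      by simp only [Nat.add_zero]; omega⟩

/-- The words that end before `i < j` have a longest common suffix, and its length is `k`. -/
def Lcs (T : ℕ → ℕ) (i j k : ℕ) : Prop :=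
  k < i ∧ (∀ t, i ≤ t + k → t < i → T t = T (t + (j - i))) ∧ T (i - 1 - k) ≠ T (j - 1 - k)

theorem Lcs.unique {i j k m : ℕ} (hij : i < j) (h : Lcs T i j k) (h' : Lcs T i j m) : k = m := by
  have aux : ∀ {k m}, Lcs T i j k → Lcs T i j m → ¬ k < m := by
    intro k m h h' hlt
    have h1 := h.1
    have h2 := h'.1
    have := h'.2.1 (i - 1 - k) (by omega) (by omega)
    rw [show i - 1 - k + (j - i) = j - 1 - k by omega] at this
    exact h.2.2 this
  rcases lt_trichotomy k m with hlt | rfl | hlt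
  · exact absurd hlt (aux h h')
  · rfl
  · exact absurd hlt (aux h' h)

section Shift

variable {x y q j k c : ℕ}

/-- The suffix at `k + (y - x)` is smaller than that at `k`, as they agree until they arrive at `y`
and `x`. It begins between `x` and `y`, so it is not smaller than that at `x`. -/
theorem Nss.sufLT_of_shift (h : Nss T x y)
    (hq : ∀ t, q ≤ t → t < x → T t = T (t + (y - x))) (hk : q ≤ k) (hkx : k < x)
    (hd : x ≤ k + (y - x)) : SufLT T x k := by
  have hxy := h.1
  have h1 : SufLT T (k + (y - x)) k := by
    refine SufLT.of_prepend (m := x - k) (fun t ht => ?_) ?_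
    · rw [hq (k + t) (by omega) (by omega)]; congr 1; omega
    · rw [show k + (y - x) + (x - k) = y by omega, show k + (x - k) = x by omega]
      exact h.2.1
  rcases Nat.lt_or_eq_of_le hd with h2 | h2
  · exact (h.2.2 _ h2 (by omega)).trans h1
  · rwa [← h2] at h1

/-- Shifting by `y - x` keeps the order: either the mismatch comes before `x` and is shifted too, or
`k` arrives at `x` first, and `x` and its shift `y` are smaller than their opponents. -/
theorem Nss.sufLT_shift (hT : IsText T N) (h : Nss T x y)
    (hq : ∀ t, q ≤ t → t < x → T t = T (t + (y - x))) (hxN : x ≤ N) (hj1 : 1 ≤ j) (hj : q ≤ j)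
    (hjk : j < k) (hkx : k < x) (hd : x ≤ j + (y - x)) :
    (SufLT T j k ∧ SufLT T (j + (y - x)) (k + (y - x))) ∨
      (SufLT T k j ∧ SufLT T (k + (y - x)) (j + (y - x))) := by
  have hxy := h.1
  obtain ⟨m, hm⟩ := hT.exists_lce hjk (by omega) (.inl hj1)
  have hjt : ∀ t, j + t < x → T (j + t) = T (j + (y - x) + t) := fun t ht => by
    rw [hq (j + t) (by omega) (by omega)]; congr 1; omega
  have hkt : ∀ t, k + t < x → T (k + t) = T (k + (y - x) + t) := fun t ht => by
    rw [hq (k + t) (by omega) (by omega)]; congr 1; omega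
  by_cases hmx : m < x - k
  · have h' : Lce T (j + (y - x)) (k + (y - x)) m := by
      refine ⟨fun t ht => ?_, ?_⟩
      · rw [← hjt t (by omega), ← hkt t (by omega)]; exact hm.1 t ht
      · rw [← hjt m (by omega), ← hkt m (by omega)]; exact hm.2
    rcases lt_or_gt_of_ne hm.2 with hlt | hlt
    · left
      refine ⟨⟨m, hm.1, hlt⟩, ⟨m, h'.1, ?_⟩⟩
      rwa [← hjt m (by omega), ← hkt m (by omega)]
    · right
      refine ⟨⟨m, hm.symm.1, hlt⟩, ⟨m, h'.symm.1, ?_⟩⟩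
      rwa [← hjt m (by omega), ← hkt m (by omega)]
  · right
    constructor
    · refine SufLT.of_prepend (m := x - k) (fun t ht => (hm.1 t (by omega)).symm) ?_
      rw [show k + (x - k) = x by omega]
      exact h.sufLT_of_shift hq (by omega) (by omega) (by omega)
    · refine SufLT.of_prepend (m := x - k) (fun t ht => ?_) ?_
      · rw [← hjt t (by omega), ← hkt t (by omega)]
        exact (hm.1 t (by omega)).symm
      · rw [show k + (y - x) + (x - k) = y by omega]
        exact h.2.1.trans (h.2.2 _ (by omega) (by omega))

/-- If the edge `x, y` repeats to the left, then so do next smaller suffixes. -/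
theorem Nss.shift (hT : IsText T N) (h : Nss T x y)
    (hq : ∀ t, q ≤ t → t < x → T t = T (t + (y - x))) (hxN : x ≤ N) (hj1 : 1 ≤ j) (hj : q ≤ j)
    (hjx : j < x) (hd : x ≤ j + (y - x)) (hc : Nss T j c) :
    c ≤ x ∧ Nss T (j + (y - x)) (c + (y - x)) := by
  have hxy := h.1
  have hcx : c ≤ x := by
    by_contra hlt
    exact (hc.2.2 x hjx (by omega)).asymm (h.sufLT_of_shift hq hj hjx hd)
  have hjc := hc.1
  refine ⟨hcx, by omega, ?_, fun k h1 h2 => ?_⟩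
  · rcases Nat.lt_or_eq_of_le hcx with hlt | rfl
    · rcases h.sufLT_shift hT hq hxN hj1 hj hc.1 hlt hd with h3 | h3
      · exact absurd h3.1 hc.2.1.asymm
      · exact h3.2
    · rw [show c + (y - c) = y by omega]
      rcases Nat.lt_or_eq_of_le hd with h2 | h2
      · exact h.2.1.trans (h.2.2 _ h2 (by omega))
      · rw [← h2]; exact h.2.1
  · have h3 := hc.2.2 (k - (y - x)) (by omega) (by omega)
    rcases h.sufLT_shift (k := k - (y - x)) hT hq hxN hj1 hj (by omega) (by omega) hd with h4 | h4
    · rw [show k - (y - x) + (y - x) = k by omega] at h4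
      exact h4.2
    · exact absurd h4.1 h3.asymm

end Shift

/-- The edge at `x`, to `y`, repeats to the left down to `q`. -/
structure LeftCopies (T : ℕ → ℕ) (N j x y q : ℕ) (ns : ℕ → ℕ) : Prop where
  lt_x : j < x
  le_N : x ≤ N
  ns_eq : ns x = y
  le_add : x ≤ j + (y - x)
  one_le : 1 ≤ q
  eq : ∀ t, q ≤ t → t < x → T t = T (t + (y - x))
  ne : T (q - 1) ≠ T (q - 1 + (y - x))

variable {j x y q : ℕ} {ns nl ln : ℕ → ℕ}

theorem LeftCopies.nss_shift (h : LeftCopies T N j x y q ns) (hT : IsText T N)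
    (hns : NssArrays T N ns nl) (hj1 : 1 ≤ j) (hqj : q < j) :
    ns j ≤ x ∧ ns (j + (y - x)) = ns j + (y - x) ∧ x < y ∧ y ≤ N + 1 ∧ j < ns j := by
  have h1 := hns x (by have := h.lt_x; omega) h.le_N
  rw [h.ns_eq] at h1
  have h2 := (hns j hj1 (by have := h.lt_x; have := h.le_N; omega)).1
  have h3 := h1.1.shift hT h.eq h.le_N hj1 hqj.le h.lt_x h.le_add h2
  have h4 := (hns (j + (y - x)) (by omega)
    (by have := h.lt_x; have := h1.1.1; have := h1.2.1; omega)).1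
  exact ⟨h3.1, h4.unique h3.2, h1.1.1, h1.2.1, h2.1⟩

theorem LeftCopies.match (h : LeftCopies T N j x y q ns) (hT : IsText T N)
    (hns : NssArrays T N ns nl) (hj1 : 1 ≤ j) (hqj : q < j) {l : ℕ} (hl : l ≤ j - q)
    (hm : ∀ t, j + (y - x) ≤ t + l → t < j + (y - x) →
      T t = T (t + (ns (j + (y - x)) - (j + (y - x))))) :
    ∀ t, j ≤ t + l → t < j → T t = T (t + (ns j - j)) := by
  intro t h1 h2
  obtain ⟨h3, h4, h5, h6, h7⟩ := h.nss_shift hT hns hj1 hqj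
  have hx := h.lt_x
  have := hm (t + (y - x)) (by omega) (by omega)
  rw [h4, ← h.eq t (by omega) (by omega)] at this
  rw [this, h.eq (t + (ns j - j)) (by omega) (by omega)]
  congr 1; omega

theorem LeftCopies.lcs (h : LeftCopies T N j x y q ns) (hT : IsText T N)
    (hns : NssArrays T N ns nl) (hj1 : 1 ≤ j) (hqj : q < j) {l : ℕ} (hl : l < j - q)
    (hm : Lcs T (j + (y - x)) (ns (j + (y - x))) l) : Lcs T j (ns j) l := by
  obtain ⟨h3, h4, h5, h6, h7⟩ := h.nss_shift hT hns hj1 hqj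
  have hx := h.lt_x
  refine ⟨by omega, h.match hT hns hj1 hqj hl.le hm.2.1, fun he => hm.2.2 ?_⟩
  rw [h.eq (j - 1 - l) (by omega) (by omega), h.eq (ns j - 1 - l) (by omega) (by omega)] at he
  rw [h4, show j + (y - x) - 1 - l = j - 1 - l + (y - x) by omega, he]
  congr 1; omega

/-- The range of one period is not left: if `j + (y - x) = x`, the stored common suffix reaches down
to `q`, and it would not have been short enough to be copied. -/
theorem LeftCopies.pred (h : LeftCopies T N j x y q ns) (hT : IsText T N)
    (hns : NssArrays T N ns nl) (hj1 : 1 ≤ j) (hqj : q < j)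
    (hl : ln (j + (y - x)) < j - q) (hm : Lcs T (j + (y - x)) (ns (j + (y - x))) (ln (j + (y - x)))) :
    LeftCopies T N (j - 1) x y q ns := by
  obtain ⟨h3, h4, h5, h6, h7⟩ := h.nss_shift hT hns hj1 hqj
  have hx := h.lt_x
  have hd := h.le_add
  have h1 := h.one_le
  refine ⟨by omega, h.le_N, h.ns_eq, ?_, h1, h.eq, h.ne⟩
  by_contra hlt
  have he : j + (y - x) = x := by omega
  rw [he, h.ns_eq] at hm
  rw [he] at hl
  have h8 : Lcs T x y (x - q) := by
    refine ⟨by omega, fun t h1 h2 => h.eq t (by omega) h2, ?_⟩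
    rw [show x - 1 - (x - q) = q - 1 by omega, show y - 1 - (x - q) = q - 1 + (y - x) by omega]
    exact h.ne
  have := hm.unique h5 h8
  omega

theorem Lcs.leftCopies {c l : ℕ} (h : Lcs T j c l) (hjc : j < c) (hjN : j ≤ N) (hns : ns j = c) :
    LeftCopies T N (j - 1) j c (j - l) ns := by
  have := h.1
  refine ⟨by omega, hjN, hns, by omega, by omega, fun t h1 h2 => h.2.1 t (by omega) h2, ?_⟩
  have := h.2.2
  rwa [show j - l - 1 = j - 1 - l by omega, show j - 1 - l + (c - j) = c - 1 - l by omega]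

end CircularWord

namespace WordRAM

open CircularWord

variable {V B : ℕ} {σ : St} {τ : ℕ}

theorem clearLoop_spec {N K : ℕ} (hN : σ.v .N = N) (hV : N + 2 ≤ V) (h0 : σ.v .i = 0)
    (hτ : N + 1 + K ≤ τ) :
    wp V B clearLoop (fun σ' τ' => (∀ k ≤ N, σ'.a .ns k = N + 1 ∧ σ'.a .nl k = 0) ∧ K ≤ τ') σ τ := by
  refine wp_while (fun σ' τ' => (∀ k < σ'.v .i, σ'.a .ns k = N + 1 ∧ σ'.a .nl k = 0) ∧
    σ'.v .i ≤ N + 1 ∧ N + 1 - σ'.v .i + K ≤ τ') ⟨by omega, by omega, by omega⟩ ?_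
  rintro σ' τ' ⟨h1, h2, h3⟩ hF
  have hN' : σ'.v .N = N := (hF.1 _ (by simp [Stmt.setsVar])).trans hN
  simp [hN']
  refine ⟨by omega, fun hlt => ⟨by omega, by omega, by omega, fun k hk => ?_, by omega, by omega⟩,
    fun hle => ⟨fun k hk => h1 k (by omega), by omega⟩⟩
  simp only [Function.update_apply]
  split_ifs
  · simp
  · exact h1 k (by omega)

theorem edgesBody_spec {N K : ℕ} (hT : IsText (σ.a .text) N) (hV : N + 2 ≤ V) (h1 : 1 ≤ σ.v .i)
    (hi : σ.v .i ≤ N)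
    (hk : Known (σ.a .text) N (σ.v .i) (σ.a .ps) (σ.a .pl) (σ.a .ns) (σ.a .nl))
    (hc : σ.v .i < σ.v .r → Copies (σ.a .text) (σ.v .i) (σ.v .x) (σ.v .y) (σ.v .r) (σ.a .ps))
    (hτ : 2 + unset N (σ.a .ns) + (N + 1 - max (σ.v .i) (σ.v .r)) + K ≤ τ) :
    wp V B edgesBody (fun σ' τ' => σ'.v .i = σ.v .i + 1 ∧
      Known (σ'.a .text) N (σ'.v .i) (σ'.a .ps) (σ'.a .pl) (σ'.a .ns) (σ'.a .nl) ∧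
      (σ'.v .i < σ'.v .r →
        Copies (σ'.a .text) (σ'.v .i) (σ'.v .x) (σ'.v .y) (σ'.v .r) (σ'.a .ps)) ∧
      unset N (σ'.a .ns) + (N + 1 - max (σ'.v .i) (σ'.v .r)) + K ≤ τ') σ τ := by
  have key : ∀ σ' τ', σ'.v .i = σ.v .i → σ'.a .text = σ.a .text → CompareInv N K σ' τ' →
      wp V B (compareLoop ;; .i ::= Var.i + .lit 1) (fun σ' τ' => σ'.v .i = σ.v .i + 1 ∧
      Known (σ'.a .text) N (σ'.v .i) (σ'.a .ps) (σ'.a .pl) (σ'.a .ns) (σ'.a .nl) ∧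
      (σ'.v .i < σ'.v .r →
        Copies (σ'.a .text) (σ'.v .i) (σ'.v .x) (σ'.v .y) (σ'.v .r) (σ'.a .ps)) ∧
      unset N (σ'.a .ns) + (N + 1 - max (σ'.v .i) (σ'.v .r)) + K ≤ τ') σ' τ' := by
    intro σ₁ τ₁ hi₁ ht₁ hI
    rw [wp_seq]
    refine (compareLoop_spec (by rwa [ht₁]) (by omega) (by omega) hV hI).apply ?_
    rintro σ₂ τ₂ ⟨hst, hI₂⟩ hF
    have hi₂ : σ₂.v .i = σ.v .i :=
      (hF.1 _ (by simp [compareLoop, compareBody, extendRight, Stmt.setsVar])).trans hi₁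
    rcases hI₂ with ⟨h, -⟩ | ⟨-, h2, h3, h4⟩
    · omega
    · simp [hi₂]
      rw [hi₂] at h2 h3 h4
      exact ⟨by omega, h2, h3, h4⟩
  unfold edgesBody
  simp only [wp_seq, wp_assign, wp_ite]
  simp
  refine ⟨by omega, fun hlt => ?_, fun hle => ⟨by omega, ?_⟩⟩
  · refine (copyLoop_spec (N := N) (K := K) ?_ ?_ ?_ hV (.inl ?_)).apply ?_
    · simpa
    · simpa
    · simp
    · simp
      exact ⟨hk.start h1, hc hlt, (hc hlt).start hk, by omega⟩
    · intro σ' τ' hI hF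
      have := key σ' τ' ((hF.1 _ (by simp [copyLoop, copyBody, Stmt.setsVar])).trans (by simp))
        ((hF.2 _ (by simp [copyLoop, copyBody, Stmt.setsArr])).trans (by simp)) hI
      rw [wp_seq] at this
      simpa using this
  · have := key ((((σ.set .j (σ.v .i - 1)).set .l 0).set .st 1)) τ (by simp) (by simp)
      (.inl ?_)
    · rw [wp_seq] at this
      simpa using this
    · simp
      exact ⟨hk.start h1, by omega⟩

/-- The arrays of next smaller suffixes are computed in linear time. -/
theorem edges_spec {N K : ℕ} (hN : σ.v .N = N) (hT : IsText (σ.a .text) N) (hV : N + 2 ≤ V)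
    (hτ : 7 * N + 10 + K ≤ τ) :
    wp V B edges (fun σ' τ' => NssArrays (σ.a .text) N (σ'.a .ns) (σ'.a .nl) ∧ K ≤ τ') σ τ := by
  unfold edges
  simp only [wp_seq, wp_assign]
  refine ⟨by simp, ?_⟩
  refine (clearLoop_spec (K := 6 * N + 9 + K) (by simpa) hV (by simp) (by omega)).apply ?_
  rintro σ₁ τ₁ ⟨h1, h2⟩ hF₁
  have hN₁ : σ₁.v .N = N := (hF₁.1 _ (by simp [clearLoop, Stmt.setsVar])).trans (by simpa)
  have hT₁ : σ₁.a .text = σ.a .text :=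
    (hF₁.2 _ (by simp [clearLoop, Stmt.setsArr])).trans (by simp)
  refine ⟨by simp; omega, by simp, ?_⟩
  refine wp_while (fun σ' τ' => 1 ≤ σ'.v .i ∧ σ'.v .i ≤ N + 1 ∧
      Known (σ'.a .text) N (σ'.v .i) (σ'.a .ps) (σ'.a .pl) (σ'.a .ns) (σ'.a .nl) ∧
      (σ'.v .i < σ'.v .r →
        Copies (σ'.a .text) (σ'.v .i) (σ'.v .x) (σ'.v .y) (σ'.v .r) (σ'.a .ps)) ∧
      3 * (N + 1 - σ'.v .i) + unset N (σ'.a .ns) + (N + 1 - max (σ'.v .i) (σ'.v .r)) + K ≤ τ') ?_ ?_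
  · have hu := unset_le N (σ₁.a .ns)
    simp
    exact ⟨⟨fun k h1 h2 => by omega, fun k hk => .inr ⟨(h1 k hk).1, (h1 k hk).2,
      fun c h1 h2 => by omega⟩⟩, by omega⟩
  · rintro σ' τ' ⟨hi1, hi2, hk, hc, hτ'⟩ hF
    have hN' : σ'.v .N = N := (hF.1 _ (by simp [edgesBody, copyLoop, copyBody, compareLoop,
      compareBody, extendRight, Stmt.setsVar])).trans (by simpa)
    have hT' : σ'.a .text = σ.a .text := (hF.2 _ (by simp [edgesBody, copyLoop, copyBody,
      compareLoop, compareBody, extendRight, Stmt.setsArr])).trans (by simpa)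
    refine ⟨by simp; omega, fun hlt => ⟨by simp [hN'] at hlt; omega, ?_⟩, fun hge => ?_⟩
    · simp [hN'] at hlt
      refine (edgesBody_spec (K := 3 * (N - σ'.v .i) + K) (by rwa [hT']) hV hi1 (by omega) hk hc
        (by omega)).mono ?_
      rintro σ₂ τ₂ ⟨h3, h4, h5, h6⟩
      exact ⟨by omega, by omega, h4, h5, by omega⟩
    · simp [hN'] at hge
      have hi : σ'.v .i = N + 1 := by omega
      rw [hT', hi] at hk
      exact ⟨hk.nssArrays hT, by omega⟩

/-! ### Computing common suffixes -/

/-- Extend the common suffix of the words that end before `j` and `c`. -/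
def extendLeft : Stmt :=
  .while (.eq (.get .text (Var.j - .lit 1 - Var.l)) (.get .text (Var.c - .lit 1 - Var.l)))
    (.l ::= Var.l + .lit 1)

def leftCompare : Stmt :=
  extendLeft ;; .x ::= Var.j ;; .y ::= Var.c ;; .r ::= Var.j - Var.l ;; .store .ln Var.j Var.l

/-- As the positions are processed from right to left, the value at `j + (y - x)` is known. It is
copied if it stops before the border `r` of the repetition; otherwise the comparison resumes with
the `j - r` letters known to agree. -/
def leftBody : Stmt :=
  .c ::= .get .ns Var.j ;;
    .ite (.lt Var.r Var.j)
      (.l ::= .get .ln (Var.j + (Var.y - Var.x)) ;;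
        .ite (.lt Var.l (Var.j - Var.r)) (.store .ln Var.j Var.l)
          (.l ::= Var.j - Var.r ;; leftCompare))
      (.l ::= .lit 0 ;; leftCompare) ;;
    .j ::= Var.j - .lit 1

/-- Compute the array of common suffixes. -/
def leftPass : Stmt :=
  .j ::= Var.N ;; .r ::= Var.N ;; .while (.lt (.lit 0) Var.j) leftBody

theorem leftCompare_spec {N K : ℕ} (hT : IsText (σ.a .text) N) (hj1 : 1 ≤ σ.v .j)
    (hjc : σ.v .j < σ.v .c) (hc : σ.v .c ≤ N + 1) (hl : σ.v .l < σ.v .j)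
    (hm : ∀ t, σ.v .j ≤ t + σ.v .l → t < σ.v .j →
      σ.a .text t = σ.a .text (t + (σ.v .c - σ.v .j)))
    (hV : N + 2 ≤ V) (hτ : σ.v .j - σ.v .l + K ≤ τ) :
    wp V B leftCompare (fun σ' τ' => Lcs (σ.a .text) (σ.v .j) (σ.v .c) (σ'.v .l) ∧
      σ'.v .x = σ.v .j ∧ σ'.v .y = σ.v .c ∧ σ'.v .r = σ.v .j - σ'.v .l ∧
      σ'.a .ln = Function.update (σ.a .ln) (σ.v .j) (σ'.v .l) ∧ σ'.v .r + K ≤ τ') σ τ := by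
  unfold leftCompare
  rw [wp_seq]
  refine wp_while (fun σ' τ' => σ'.v .l < σ.v .j ∧ (∀ t, σ.v .j ≤ t + σ'.v .l → t < σ.v .j →
      σ.a .text t = σ.a .text (t + (σ.v .c - σ.v .j))) ∧ σ.v .j - σ'.v .l + K ≤ τ') ⟨hl, hm, hτ⟩ ?_
  rintro σ' τ' ⟨h1, h2, h3⟩ hF
  have hj : σ'.v .j = σ.v .j := hF.1 _ (by simp [Stmt.setsVar])
  have hc' : σ'.v .c = σ.v .c := hF.1 _ (by simp [Stmt.setsVar])
  have ha : ∀ A, σ'.a A = σ.a A := fun A => hF.2 _ (by simp [Stmt.setsArr])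
  simp [hj, hc', ha]
  refine ⟨by omega, fun he => ?_, fun hne => ⟨⟨h1, h2, hne⟩, h3⟩⟩
  -- At position `0` the match ends, since the letter there is zero and the other one is positive.
  have h4 : σ'.v .l + 1 < σ.v .j := by
    by_contra hlt
    rw [show σ.v .j - 1 - σ'.v .l = 0 by omega, hT.zero] at he
    have := hT.pos (σ.v .c - 1 - σ'.v .l) (by omega) (by omega)
    omega
  refine ⟨by omega, by omega, h4, fun t ht ht' => ?_, by omega⟩
  by_cases hte : t = σ.v .j - 1 - σ'.v .l
  · rw [hte, he]; congr 1; omega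
  · exact h2 t (by omega) ht'

/-- The invariant of the loop in `leftPass`. -/
def LeftInv (N K : ℕ) (σ : St) (τ : ℕ) : Prop :=
  σ.v .j ≤ N ∧
  (∀ k, σ.v .j < k → k ≤ N → Lcs (σ.a .text) k (σ.a .ns k) (σ.a .ln k)) ∧
  (σ.v .r < σ.v .j →
    LeftCopies (σ.a .text) N (σ.v .j) (σ.v .x) (σ.v .y) (σ.v .r) (σ.a .ns)) ∧
  -- There are `j` iterations to come, and at most `min j r` further letters can be matched, since
  -- matches only move the border `r` to the left.
  σ.v .j + min (σ.v .j) (σ.v .r) + K ≤ τ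

theorem leftBody_spec {N K : ℕ} (hT : IsText (σ.a .text) N) (hV : N + 2 ≤ V) (h1 : 1 ≤ σ.v .j)
    (hns : NssArrays (σ.a .text) N (σ.a .ns) (σ.a .nl)) (h : LeftInv N K σ (τ + 1)) :
    wp V B leftBody (LeftInv N K) σ τ := by
  obtain ⟨hjN, hL, hC, hτ⟩ := h
  have hnj := hns _ h1 hjN
  have hjc := hnj.1.1
  have key : ∀ σ' : St, σ'.v .j = σ.v .j → (∀ A, σ'.a A = σ.a A) → σ'.v .c = σ.a .ns (σ.v .j) →
      σ'.v .l < σ.v .j → σ.v .j - σ'.v .l ≤ min (σ.v .j) (σ.v .r) →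
      (∀ t, σ.v .j ≤ t + σ'.v .l → t < σ.v .j →
        σ.a .text t = σ.a .text (t + (σ.a .ns (σ.v .j) - σ.v .j))) →
      wp V B leftCompare (fun σ τ => wp V B (.j ::= Var.j - .lit 1) (LeftInv N K) σ τ) σ' τ := by
    intro σ₁ hj₁ ha₁ hc₁ hl₁ hr₁ hm₁
    refine (leftCompare_spec (N := N) (K := σ.v .j - 1 + K) (by rwa [ha₁]) (by omega) (by omega)
      (by omega) (by omega) (by rwa [hj₁, hc₁, ha₁]) hV (by omega)).apply ?_
    rintro σ₂ τ₂ ⟨h2, h3, h4, h5, h6, h7⟩ hF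
    have hj₂ : σ₂.v .j = σ.v .j :=
      (hF.1 _ (by simp [leftCompare, extendLeft, Stmt.setsVar])).trans hj₁
    have ht₂ : σ₂.a .text = σ.a .text :=
      (hF.2 _ (by simp [leftCompare, extendLeft, Stmt.setsArr])).trans (ha₁ _)
    have hn₂ : σ₂.a .ns = σ.a .ns :=
      (hF.2 _ (by simp [leftCompare, extendLeft, Stmt.setsArr])).trans (ha₁ _)
    rw [hj₁, hc₁, ha₁] at h2
    rw [hj₁] at h3 h5 h6
    rw [hc₁] at h4
    have h2' := h2.1
    simp
    refine ⟨by omega, by simp; omega, ?_, ?_, ?_⟩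
    · simp [hj₂, ht₂, hn₂, h6, ha₁]
      intro k hk hkN
      by_cases hkj : k = σ.v .j
      · subst hkj; simpa using h2
      · rw [Function.update_of_ne hkj]; exact hL k (by omega) hkN
    · simp [hj₂, ht₂, hn₂, h3, h4, h5]
      intro _
      exact h2.leftCopies hjc hjN rfl
    · simp [hj₂]; omega
  unfold leftBody
  simp only [wp_seq, wp_assign, wp_ite]
  simp only [wp_assign] at key
  simp [-wp_assign]
  refine ⟨fun hlt => ?_, fun hge => ?_⟩
  · have hc := hC hlt
    obtain ⟨h2, h3, h4, h5, h6⟩ := hc.nss_shift hT hns h1 hlt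
    have hx := hc.lt_x
    have hq := hc.one_le
    have h7 := hL (σ.v .j + (σ.v .y - σ.v .x)) (by omega) (by omega)
    refine ⟨by omega, fun hl => ⟨by omega, ?_, ?_, ?_, ?_⟩,
      fun hl => (key _ ?_ ?_ ?_ ?_ ?_ ?_).mono fun σ' τ' h => by simpa using h⟩
    · simp; omega
    · have h8 := hc.lcs hT hns h1 hlt hl h7
      simp
      intro k hk hkN
      by_cases hkj : k = σ.v .j
      · subst hkj; simpa using h8
      · rw [Function.update_of_ne hkj]; exact hL k (by omega) hkN
    · simp
      intro _
      exact hc.pred hT hns h1 hlt hl h7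
    · simp; omega
    · simp
    · simp
    · simp
    · simp; omega
    · simp; omega
    · simp
      exact hc.match hT hns h1 hlt le_rfl fun t ht ht' => h7.2.1 t (by omega) ht'
  · refine (key _ ?_ ?_ ?_ ?_ ?_ ?_).mono fun σ' τ' h => by simpa using h
    · simp
    · simp
    · simp
    · simp; omega
    · simp; omega
    simp
    intro t ht ht'; omega

/-- The array of common suffixes is computed in linear time. -/
theorem leftPass_spec {N K : ℕ} (hN : σ.v .N = N) (hT : IsText (σ.a .text) N) (hV : N + 2 ≤ V)
    (hns : NssArrays (σ.a .text) N (σ.a .ns) (σ.a .nl)) (hτ : 2 * N + K ≤ τ) :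
    wp V B leftPass (fun σ' τ' => (∀ k, 1 ≤ k → k ≤ N →
      Lcs (σ.a .text) k (σ.a .ns k) (σ'.a .ln k)) ∧ K ≤ τ') σ τ := by
  unfold leftPass
  simp only [wp_seq, wp_assign]
  refine ⟨by simp, by simp, ?_⟩
  refine wp_while (LeftInv N K) ⟨by simp [hN], ?_, by simp, by simp [hN]; omega⟩ ?_
  · simp [hN]; intro k h1 h2; omega
  · intro σ' τ' hI hF
    have ha : ∀ A, A ≠ .ln → σ'.a A = σ.a A := fun A hA => (hF.2 _ (by
      simp [leftBody, leftCompare, extendLeft, Stmt.setsArr, hA])).trans (by simp)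
    have ht := ha .text (by simp)
    have hn := ha .ns (by simp)
    have hl := ha .nl (by simp)
    refine ⟨by simp, fun hj => ?_, fun hj => ?_⟩
    · simp at hj
      have h1 : 1 ≤ τ' := by have := hI.2.2.2; omega
      refine ⟨h1, leftBody_spec (by rwa [ht]) hV hj (by rwa [ht, hn, hl]) ?_⟩
      rwa [Nat.sub_add_cancel h1]
    · simp at hj
      have h2 := hI.2.1
      have h3 := hI.2.2.2
      rw [ht, hn, hj] at h2
      exact ⟨fun k hk => h2 k (by omega), by omega⟩

end WordRAM

/-! ## Squares -/

namespace CircularWord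

variable {T : ℕ → ℕ} {N : ℕ}

/-- At the positions `1, …, N` there is a square with halves of length `b`. -/
def HasSquare (T : ℕ → ℕ) (N b : ℕ) : Prop :=
  ∃ a, 1 ≤ a ∧ a + 2 * b ≤ N + 1 ∧ ∀ t < b, T (a + t) = T (a + b + t)

theorem hasSquare_zero (T : ℕ → ℕ) (N : ℕ) : HasSquare T N 0 :=
  ⟨1, le_rfl, by omega, by simp⟩

/-- The word of length `q` at `a`, repeated infinitely often. -/
def repeated (T : ℕ → ℕ) (a q : ℕ) (t : ℕ) : ℕ := T (a + t % q)

theorem repeated_add (T : ℕ → ℕ) (a q t : ℕ) : repeated T a q (t + q) = repeated T a q t := by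
  simp [repeated]

theorem eq_repeated {a q e : ℕ} (hp : ∀ t, a ≤ t → t + q < e → T t = T (t + q)) :
    ∀ t, a + t < e → T (a + t) = repeated T a q t := by
  intro t
  induction t using Nat.strong_induction_on with
  | _ t ih =>
    intro ht
    rcases Nat.lt_or_ge t q with h | h
    · rw [repeated, Nat.mod_eq_of_lt h]
    · rcases Nat.eq_zero_or_pos q with rfl | hq
      · simp [repeated]
      have h1 := ih (t - q) (by omega) (by omega)
      have h2 := hp (a + (t - q)) (by omega) (by omega)
      rw [show a + (t - q) + q = a + t by omega] at h2
      rw [← h2, h1, ← repeated_add, Nat.sub_add_cancel h]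

/-- Some multiple of `s` is congruent to the greatest common divisor modulo `q`; the word is
infinite, so no length condition is needed. -/
theorem periodic_gcd {f : ℕ → ℕ} {s q : ℕ} (h1 : ∀ t, f (t + s) = f t)
    (h2 : ∀ t, f (t + q) = f t) : ∀ t, f (t + Nat.gcd s q) = f t := by
  have mul : ∀ {p}, (∀ t, f (t + p) = f t) → ∀ m t, f (t + m * p) = f t := by
    intro p hp m
    induction m with
    | zero => simp
    | succ m ih => intro t; rw [Nat.succ_mul, ← Nat.add_assoc, hp, ih]
  rcases Nat.eq_zero_or_pos q with rfl | hq
  · simpa using h1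
  rcases Nat.lt_or_ge (Nat.gcd s q) q with hlt | hge
  · obtain ⟨m, -, hm⟩ := Nat.exists_mul_mod_eq_gcd (k := q) (n := s) hlt
    intro t
    have h3 : s * m = Nat.gcd s q + (s * m / q) * q := by
      have := Nat.mod_add_div (s * m) q
      rw [hm, Nat.mul_comm q] at this
      exact this.symm
    rw [← mul h2 (s * m / q) (t + Nat.gcd s q), Nat.add_assoc, ← h3, Nat.mul_comm s m, mul h1]
  · have : Nat.gcd s q = q := le_antisymm (Nat.le_of_dvd hq (Nat.gcd_dvd_right s q)) hge
    rwa [this]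

/-- The word between `a` and `e` has period `q`, it cannot be extended to the right, it has at least
two periods, and its period is a primitive word. -/
structure Run (T : ℕ → ℕ) (N a e q : ℕ) : Prop where
  one_le_a : 1 ≤ a
  one_le_q : 1 ≤ q
  two_mul : a + 2 * q ≤ e
  le_N : e ≤ N + 1
  eq : ∀ t, a ≤ t → t + q < e → T t = T (t + q)
  ne : T e ≠ T (e - q)
  primitive : ∀ s, 0 < s → s < q → ¬ ∀ t, repeated T a q (t + s) = repeated T a q t

/-- Let `q` be the least divisor of `b` that is a period of the square; it is primitive by
`periodic_gcd`. Let `e` be the first place after the square where the period breaks, which is at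
most `N + 1` because of the zero there. -/
theorem IsText.exists_run (hT : IsText T N) {a b : ℕ} (ha : 1 ≤ a) (hb : 1 ≤ b)
    (hab : a + 2 * b ≤ N + 1) (h : ∀ t < b, T (a + t) = T (a + b + t)) :
    ∃ q e, q ∣ b ∧ a + 2 * b ≤ e ∧ Run T N a e q := by
  classical
  have hex : ∃ q, 1 ≤ q ∧ q ∣ b ∧ ∀ t, a ≤ t → t + q < a + 2 * b → T t = T (t + q) := by
    refine ⟨b, hb, dvd_rfl, fun t h1 h2 => ?_⟩
    have := h (t - a) (by omega)
    rwa [show a + (t - a) = t by omega, show a + b + (t - a) = t + b by omega] at this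
  obtain ⟨h1, h2, h3⟩ := Nat.find_spec hex
  have hmin := fun m => Nat.find_min (H := hex) (m := m)
  generalize Nat.find hex = q at *
  have hqb := Nat.le_of_dvd hb h2
  have hex2 : ∃ e, a + 2 * b ≤ e ∧ T e ≠ T (e - q) := by
    refine ⟨N + 1, hab, ?_⟩
    rw [hT.end_eq (N + 1) (by omega)]
    have := hT.pos (N + 1 - q) (by omega) (by omega)
    omega
  obtain ⟨h4, h5⟩ := Nat.find_spec hex2
  have hmin2 := fun m => Nat.find_min (H := hex2) (m := m)
  have heN : Nat.find hex2 ≤ N + 1 := by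
    refine Nat.find_min' hex2 ⟨hab, ?_⟩
    rw [hT.end_eq (N + 1) (by omega)]
    have := hT.pos (N + 1 - q) (by omega) (by omega)
    omega
  generalize Nat.find hex2 = e at *
  refine ⟨q, e, h2, h4, ha, h1, by omega, heN, fun t h6 h7 => ?_, h5, fun s hs0 hsq hs => ?_⟩
  · rcases Nat.lt_or_ge (t + q) (a + 2 * b) with h8 | h8
    · exact h3 t h6 h8
    · have := hmin2 (t + q) h7
      rw [not_and, not_not] at this
      have := this h8
      rw [Nat.add_sub_cancel] at this
      exact this.symm
  · have hg := periodic_gcd hs (repeated_add T a q)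
    have hrep := eq_repeated h3
    have hgs := Nat.le_of_dvd hs0 (Nat.gcd_dvd_left s q)
    refine hmin (Nat.gcd s q) (by omega) ⟨Nat.gcd_pos_of_pos_left _ hs0,
      (Nat.gcd_dvd_right s q).trans h2, fun t h6 h7 => ?_⟩
    have h8 := hrep (t - a) (by omega)
    have h9 := hrep (t - a + Nat.gcd s q) (by omega)
    rw [hg, ← h8] at h9
    rw [show a + (t - a) = t by omega, show a + (t - a + Nat.gcd s q) = t + Nat.gcd s q by omega] at h9
    exact h9.symm

/-- Different rotations of a primitive word are different, so exactly one of them is least. -/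
theorem exists_min_rotation {f : ℕ → ℕ} {q : ℕ} (hq : 1 ≤ q) (hf : ∀ t, f (t + q) = f t)
    (hp : ∀ s, 0 < s → s < q → ¬ ∀ t, f (t + s) = f t) :
    ∃ j < q, ∀ s, 0 < s → s < q → SufLT f j (j + s) := by
  have fmod : ∀ t, f (t % q) = f t := by
    intro t
    induction t using Nat.strong_induction_on with
    | _ t ih =>
      rcases Nat.lt_or_ge t q with h | h
      · rw [Nat.mod_eq_of_lt h]
      · rw [Nat.mod_eq_sub_mod h, ih (t - q) (by omega), ← hf, Nat.sub_add_cancel h]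
  have tot : ∀ i k, i < k → k < q → SufLT f i k ∨ SufLT f k i := by
    intro i k hik hkq
    have hne : ∃ m, f (i + m) ≠ f (k + m) := by
      by_contra! hno
      refine hp (k - i) (by omega) (by omega) fun t => ?_
      have h1 : ∃ m r, t + r * q = i + m := ⟨t + i * q - i, i, by
        have : i ≤ i * q := Nat.le_mul_of_pos_right i hq
        omega⟩
      obtain ⟨m, r, hmr⟩ := h1
      have h2 : ∀ u, f (u + r * q) = f u := fun u => by
        rw [← fmod, Nat.add_mul_mod_self_right, fmod]
      rw [← h2 t, hmr, hno, ← h2 (t + (k - i))]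
      congr 1; omega
    have h2 : Lce f i k (Nat.find hne) := by
      refine ⟨fun t ht => ?_, Nat.find_spec hne⟩
      have := Nat.find_min hne ht
      rwa [not_not] at this
    exact h2.sufLT_or
  have hmin : ∀ m, 1 ≤ m → m ≤ q → ∃ j < m, ∀ k < m, k ≠ j → SufLT f j k := by
    intro m
    induction m with
    | zero => intro h; omega
    | succ m ih =>
      intro _ hm
      rcases Nat.eq_zero_or_pos m with rfl | hm0
      · exact ⟨0, by omega, fun k hk hk0 => by omega⟩
      · obtain ⟨j, hj, hjk⟩ := ih hm0 (by omega)
        rcases tot j m hj (by omega) with h | h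
        · refine ⟨j, by omega, fun k hk hkj => ?_⟩
          rcases Nat.lt_succ_iff_lt_or_eq.1 hk with hk | rfl
          · exact hjk k hk hkj
          · exact h
        · refine ⟨m, by omega, fun k hk hkm => ?_⟩
          by_cases hkj : k = j
          · rwa [hkj]
          · exact h.trans (hjk k (by omega) hkj)
  obtain ⟨j, hj, hjk⟩ := hmin q hq le_rfl
  refine ⟨j, hj, fun s hs0 hsq => ?_⟩
  rcases Nat.lt_or_ge (j + s) q with h | h
  · exact hjk _ h (by omega)
  · obtain ⟨m, hm, hlt⟩ := hjk (j + s - q) (by omega) (by omega)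
    have : ∀ t, f (j + s + t) = f (j + s - q + t) := fun t => by
      rw [← hf (j + s - q + t)]; congr 1; omega
    exact ⟨m, fun t ht => by rw [this, hm t ht], by rwa [this]⟩

/-- A run whose right end decreases contains an edge whose length is the period. -/
theorem Run.exists_nss {a e q : ℕ} (h : Run T N a e q) (hlt : T e < T (e - q)) :
    ∃ j, a ≤ j ∧ j < a + q ∧ Nss T j (j + q) ∧ Lce T j (j + q) (e - q - j) := by
  have h2 := h.two_mul
  have hrep := eq_repeated h.eq
  have hf := repeated_add T a q
  obtain ⟨j, hj, hmin⟩ := exists_min_rotation h.one_le_q hf h.primitive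
  have hlce : Lce T (a + j) (a + j + q) (e - q - (a + j)) := by
    refine ⟨fun t ht => ?_, ?_⟩
    · rw [h.eq (a + j + t) (by omega) (by omega)]; congr 1; omega
    · rw [show a + j + (e - q - (a + j)) = e - q by omega,
        show a + j + q + (e - q - (a + j)) = e by omega]
      exact h.ne.symm
  refine ⟨a + j, by omega, by omega, ⟨by have := h.one_le_q; omega, ?_, fun k h3 h4 => ?_⟩, hlce⟩
  · refine ⟨_, hlce.symm.1, ?_⟩
    rwa [show a + j + (e - q - (a + j)) = e - q by omega,
        show a + j + q + (e - q - (a + j)) = e by omega]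
  · obtain ⟨m, hm, hml⟩ := hmin (k - (a + j)) (by omega) (by omega)
    -- The mismatch occurs before the end of the period that starts at `a + j`, hence inside the
    -- run, where `T` agrees with the repeated word. Otherwise the rest of the comparison would
    -- exhibit a rotation smaller than the least one.
    have h5 : m < a + j + q - k := by
      by_contra hge
      have h6 : SufLT (repeated T a q) (j + (a + j + q - k)) j := by
        refine ⟨m - (a + j + q - k), fun t ht => ?_, ?_⟩
        · have := hm (a + j + q - k + t) (by omega)
          rw [Nat.add_assoc j, this, ← hf (j + t)]; congr 1; omega
        · rw [show j + (a + j + q - k) + (m - (a + j + q - k)) = j + m by omega,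
            ← hf (j + (m - (a + j + q - k))),
            show j + (m - (a + j + q - k)) + q = j + (k - (a + j)) + m by omega]
          exact hml
      exact h6.asymm (hmin _ (by omega) (by omega))
    refine ⟨m, fun t ht => ?_, ?_⟩
    · have := hm t ht
      rw [← hrep _ (by omega), ← hrep _ (by omega)] at this
      rw [show k + t = a + (j + (k - (a + j)) + t) by omega, Nat.add_assoc a j t]
      exact this
    · rw [← hrep _ (by omega), ← hrep _ (by omega)] at hml
      rw [show k + m = a + (j + (k - (a + j)) + m) by omega, Nat.add_assoc a j m]
      exact hml

/-- `b` is at least the length of the halves of each square of length at most `2 * M` that is found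
at an edge. -/
def Covers (N M b : ℕ) (ns nl ln : ℕ → ℕ) : Prop :=
  ∀ j, 1 ≤ j → j ≤ N → ns j ≤ N → ns j - j ≤ nl j + ln j → ∀ m,
    2 * ((ns j - j) * m) ≤ nl j + ln j + (ns j - j) → (ns j - j) * m ≤ M → (ns j - j) * m ≤ b

/-- The edge in the run sees all of it: its common prefix ends at the right end of the run, and its
common suffix reaches `a` or further. So `nl j + ln j + q` is at least `e - a`. -/
theorem Run.le_of_covers {a e q M b m : ℕ} {ns nl ln : ℕ → ℕ} (h : Run T N a e q)
    (hns : NssArrays T N ns nl)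
    (hln : ∀ k, 1 ≤ k → k ≤ N → Lcs T k (ns k) (ln k)) (hlt : T e < T (e - q))
    (hc : Covers N M b ns nl ln) (hm : a + 2 * (q * m) ≤ e) (hM : q * m ≤ M) : q * m ≤ b := by
  obtain ⟨j, h1, h2, h3, h4⟩ := h.exists_nss hlt
  have h5 := h.two_mul
  have h6 := h.le_N
  have h7 := h.one_le_a
  have h8 := hns j (by omega) (by omega)
  have h9 := hln j (by omega) (by omega)
  have h10 := h8.1.unique h3
  rw [h10] at h8 h9
  have h11 := h8.2.2.unique h4
  have h12 : j - a ≤ ln j := by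
    by_contra hlt
    have := h9.2.2
    rw [h.eq (j - 1 - ln j) (by omega) (by omega)] at this
    apply this; congr 1; omega
  have := hc j (by omega) (by omega) (by omega) (by omega) m
  rw [h10, show j + q - j = q by omega] at this
  exact this (by omega) hM

/-- The stretch from `j - L` to `c + R` has period `c - j` and thus every multiple of it; `hm` says
that two halves fit. -/
theorem hasSquare_of_edge (hT : IsText T N) {j c L R m : ℕ} (hj : 1 ≤ j) (hc : c ≤ N) (hjc : j < c)
    (hR : Lce T j c R) (hL : Lcs T j c L) (hm : 2 * ((c - j) * m) ≤ R + L + (c - j)) :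
    HasSquare T N ((c - j) * m) := by
  have h1 := hL.1
  have h2 := hT.le_of_match hjc (by omega) (.inl hj) hR.1
  have hp : ∀ t, j - L ≤ t → t < j + R → T t = T (t + (c - j)) := by
    intro t h3 h4
    rcases Nat.lt_or_ge t j with h5 | h5
    · exact hL.2.1 t (by omega) h5
    · have := hR.1 (t - j) (by omega)
      rwa [show j + (t - j) = t by omega, show c + (t - j) = t + (c - j) by omega] at this
  have hmul : ∀ k t, j - L ≤ t → t + (c - j) * k ≤ R + j + (c - j) - 1 → T t = T (t + (c - j) * k) := by
    intro k
    induction k with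
    | zero => simp
    | succ k ih =>
      intro t h3 h4
      rw [Nat.mul_succ] at h4 ⊢
      rw [ih t h3 (by omega), hp _ (by omega) (by omega), Nat.add_assoc]
  refine ⟨j - L, by omega, by omega, fun t ht => ?_⟩
  rw [hmul m (j - L + t) (by omega) (by omega)]
  congr 1; omega

/-- The word with the order of letters reversed. -/
def reversed (T : ℕ → ℕ) (N M i : ℕ) : ℕ := if 1 ≤ i ∧ i ≤ N then M - T i else 0

theorem reversed_eq {M i k : ℕ} (h : T i = T k) (hi : 1 ≤ i) (hiN : i ≤ N) (hk : 1 ≤ k)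
    (hkN : k ≤ N) : reversed T N M i = reversed T N M k := by
  simp [reversed, hi, hiN, hk, hkN, h]

theorem eq_of_reversed_eq {M i k : ℕ} (hM : ∀ i, 1 ≤ i → i ≤ N → T i < M)
    (h : reversed T N M i = reversed T N M k) (hi : 1 ≤ i) (hiN : i ≤ N) (hk : 1 ≤ k)
    (hkN : k ≤ N) : T i = T k := by
  have h1 := hM i hi hiN
  have h2 := hM k hk hkN
  simp only [reversed, hi, hiN, hk, hkN, and_self, if_true] at h
  omega

theorem IsText.reversed {M : ℕ} (hM : ∀ i, 1 ≤ i → i ≤ N → T i < M) :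
    IsText (reversed T N M) N where
  zero := by simp [CircularWord.reversed]
  pos i h1 h2 := by
    have := hM i h1 h2
    simp only [CircularWord.reversed, h1, h2, and_self, if_true]
    omega
  end_eq i h := by
    have : ¬ (1 ≤ i ∧ i ≤ N) := by omega
    simp [CircularWord.reversed, this]

theorem HasSquare.of_reversed {M b : ℕ} (hM : ∀ i, 1 ≤ i → i ≤ N → T i < M)
    (h : HasSquare (CircularWord.reversed T N M) N b) : HasSquare T N b := by
  obtain ⟨a, h1, h2, h3⟩ := h
  exact ⟨a, h1, h2, fun t ht =>
    eq_of_reversed_eq hM (h3 t ht) (by omega) (by omega) (by omega) (by omega)⟩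

theorem Run.reversed {M a e q : ℕ} (h : Run T N a e q) (hM : ∀ i, 1 ≤ i → i ≤ N → T i < M)
    (he : e ≤ N) : Run (CircularWord.reversed T N M) N a e q where
  one_le_a := h.one_le_a
  one_le_q := h.one_le_q
  two_mul := h.two_mul
  le_N := h.le_N
  eq t h1 h2 := reversed_eq (h.eq t h1 h2) (by have := h.one_le_a; omega) (by omega)
    (by have := h.one_le_a; omega) (by omega)
  ne hne := by
    have h1 := h.two_mul
    have h2 := h.one_le_a
    exact h.ne (eq_of_reversed_eq hM hne (by omega) he (by omega) (by omega))
  primitive s h0 hs hno := h.primitive s h0 hs fun t => by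
    have h1 := h.two_mul
    have h2 := h.one_le_a
    have h3 := Nat.mod_lt (t + s) h.one_le_q
    have h4 := Nat.mod_lt t h.one_le_q
    exact eq_of_reversed_eq (i := a + (t + s) % q) (k := a + t % q) hM (hno t) (by omega) (by omega) (by omega) (by omega)

/-- If `b` covers the edges for both orders of the letters, then it covers all squares. -/
theorem le_of_covers (hT : IsText T N) {M K b k : ℕ} (hM : ∀ i, 1 ≤ i → i ≤ N → T i < M)
    {ns nl ln ns' nl' ln' : ℕ → ℕ} (hns : NssArrays T N ns nl)
    (hln : ∀ k, 1 ≤ k → k ≤ N → Lcs T k (ns k) (ln k)) (hc : Covers N K b ns nl ln)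
    (hns' : NssArrays (reversed T N M) N ns' nl')
    (hln' : ∀ k, 1 ≤ k → k ≤ N → Lcs (reversed T N M) k (ns' k) (ln' k))
    (hc' : Covers N K b ns' nl' ln') (h : HasSquare T N k) (hk : k ≤ K) : k ≤ b := by
  rcases Nat.eq_zero_or_pos k with rfl | hk0
  · omega
  obtain ⟨a, h1, h2, h3⟩ := h
  obtain ⟨q, e, ⟨m, rfl⟩, h4, h5⟩ := hT.exists_run h1 hk0 h2 h3
  rcases lt_or_gt_of_ne h5.ne with hlt | hgt
  · exact h5.le_of_covers hns hln hlt hc h4 hk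
  -- At `N + 1` the letter drops to zero, so an increase happens inside the text, where reversal is
  -- faithful.
  · have he : e ≤ N := by
      by_contra hlt
      rw [hT.end_eq e (by omega)] at hgt
      omega
    refine (h5.reversed hM he).le_of_covers hns' hln' ?_ hc' h4 hk
    have h6 := h5.two_mul
    have h7 := hM e (by omega) he
    simp only [reversed]
    rw [if_pos ⟨by omega, he⟩, if_pos ⟨by omega, by omega⟩]
    omega

end CircularWord

/-! ### Computing the longest square from the edges -/

namespace WordRAM

open CircularWord

variable {V B : ℕ} {σ : St} {τ : ℕ}

/-- The best multiple of `d` is limited by the stretch of length `l + d`, into which two halves must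
fit, and by the bound `n - 1`. Edges to the end of the text and stretches shorter than two periods
are skipped. -/
def bestBody : Stmt :=
  .c ::= .get .ns Var.j ;; .d ::= Var.c - Var.j ;; .l ::= .get .nl Var.j + .get .ln Var.j ;;
    .ite (.lt Var.N Var.c) .skip
      (.ite (.lt Var.l Var.d) .skip
        (.u ::= (Var.l + Var.d) / (Var.d + Var.d) ;; .st ::= (Var.n - .lit 1) / Var.d ;;
          .ite (.lt Var.u Var.st) (.st ::= Var.u) .skip ;; .st ::= Var.d * Var.st ;;
          .ite (.lt Var.b Var.st) (.b ::= Var.st) .skip)) ;;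
    .j ::= Var.j + .lit 1

/-- Compute the largest half of a square from the edges. -/
def bestPass : Stmt := .j ::= .lit 1 ;; .while (.lt Var.j (Var.N + .lit 1)) bestBody

end WordRAM

namespace WordRAM

open CircularWord

variable {V B : ℕ} {σ : St} {τ : ℕ}

theorem min_div_spec {d l r s : ℕ} (hd : 1 ≤ d)
    (hs : s = if (l + d) / (d + d) < r / d then (l + d) / (d + d) else r / d) :
    (∀ m, 2 * (d * m) ≤ l + d → d * m ≤ r → d * m ≤ d * s) ∧ 2 * (d * s) ≤ l + d ∧ d * s ≤ r := by
  have h1 : (l + d) / (d + d) * (d + d) ≤ l + d := Nat.div_mul_le_self _ _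
  have h2 : r / d * d ≤ r := Nat.div_mul_le_self _ _
  have h3 : s ≤ (l + d) / (d + d) ∧ s ≤ r / d := by split_ifs at hs <;> omega
  refine ⟨fun m h4 h5 => Nat.mul_le_mul_left d ?_, ?_, ?_⟩
  · have h6 : m ≤ (l + d) / (d + d) := (Nat.le_div_iff_mul_le (by omega)).2 (by linarith)
    have h7 : m ≤ r / d := (Nat.le_div_iff_mul_le (by omega)).2 (by linarith)
    split_ifs at hs <;> omega
  · have := Nat.mul_le_mul_right (d + d) h3.1
    linarith
  · have := Nat.mul_le_mul_right d h3.2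
    linarith

/-- The invariant of the loop in `bestPass`. -/
def BestInv (N n b₀ K : ℕ) (T : ℕ → ℕ) (σ : St) (τ : ℕ) : Prop :=
  1 ≤ σ.v .j ∧ σ.v .j ≤ N + 1 ∧ b₀ ≤ σ.v .b ∧ σ.v .b < n ∧ HasSquare T N (σ.v .b) ∧
  (∀ j, 1 ≤ j → j < σ.v .j → σ.a .ns j ≤ N → σ.a .ns j - j ≤ σ.a .nl j + σ.a .ln j → ∀ m,
    2 * ((σ.a .ns j - j) * m) ≤ σ.a .nl j + σ.a .ln j + (σ.a .ns j - j) →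
    (σ.a .ns j - j) * m ≤ n - 1 → (σ.a .ns j - j) * m ≤ σ.v .b) ∧
  N + 1 - σ.v .j + K ≤ τ

theorem bestBody_spec {N n b₀ K : ℕ} {T : ℕ → ℕ} (hT : IsText T N) (hV : 2 * N + 2 ≤ V)
    (hnN : n ≤ N) (hN : σ.v .N = N) (hn : σ.v .n = n) (hns : NssArrays T N (σ.a .ns) (σ.a .nl))
    (hln : ∀ k, 1 ≤ k → k ≤ N → Lcs T k (σ.a .ns k) (σ.a .ln k)) (hj : σ.v .j ≤ N)
    (h : BestInv N n b₀ K T σ (τ + 1)) : wp V B bestBody (BestInv N n b₀ K T) σ τ := by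
  obtain ⟨h1, h2, h3, h4, h5, h6, h7⟩ := h
  obtain ⟨h8, h9, h10⟩ := hns _ h1 hj
  have h11 := hln _ h1 hj
  have h12 := h8.1
  have h13 := hT.le_of_match h12 h9 (.inl h1) h10.1
  have h14 := h11.1
  have key : ∀ b', σ.v .b ≤ b' → b' < n → HasSquare T N b' →
      (σ.a .ns (σ.v .j) ≤ N → σ.a .ns (σ.v .j) - σ.v .j ≤ σ.a .nl (σ.v .j) + σ.a .ln (σ.v .j) → ∀ m,
        2 * ((σ.a .ns (σ.v .j) - σ.v .j) * m) ≤
          σ.a .nl (σ.v .j) + σ.a .ln (σ.v .j) + (σ.a .ns (σ.v .j) - σ.v .j) →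
        (σ.a .ns (σ.v .j) - σ.v .j) * m ≤ n - 1 → (σ.a .ns (σ.v .j) - σ.v .j) * m ≤ b') →
      ∀ σ' : St, σ'.v .j = σ.v .j + 1 → σ'.v .b = b' → σ'.a = σ.a → BestInv N n b₀ K T σ' τ := by
    intro b' hb1 hb2 hb3 hb4 σ' hj' hb' ha'
    refine ⟨by omega, by omega, by omega, by omega, by rwa [hb'], ?_, by omega⟩
    intro j hj1 hj2 hj3 hj4 m hm hm'
    rw [ha'] at *
    rw [hb']
    rcases Nat.lt_succ_iff_lt_or_eq.1 (show j < σ.v .j + 1 by omega) with hlt | rfl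
    · exact (h6 j hj1 hlt hj3 hj4 m hm hm').trans hb1
    · exact hb4 hj3 hj4 m hm hm'
  unfold bestBody
  simp [hN, hn]
  refine ⟨by omega, fun hlt => ⟨by omega, ?_⟩, fun hle => ⟨fun hlt => ⟨by omega, ?_⟩, fun hge => ?_⟩⟩
  · exact key _ le_rfl h4 h5 (by omega) _ (by simp) (by simp) (by simp)
  · exact key _ le_rfl h4 h5 (by omega) _ (by simp) (by simp) (by simp)
  · generalize hd : σ.a .ns (σ.v .j) - σ.v .j = d at *
    generalize hl : σ.a .nl (σ.v .j) + σ.a .ln (σ.v .j) = l at *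
    have hd1 : 1 ≤ d := by omega
    have hsq : ∀ s, 2 * (d * s) ≤ l + d → HasSquare T N (d * s) := by
      intro s hs
      rw [← hd]
      exact hasSquare_of_edge hT h1 hle h12 h10 h11 (by rw [hd, hl]; exact hs)
    have hmain : ∀ s, s = (if (l + d) / (d + d) < (n - 1) / d then (l + d) / (d + d)
        else (n - 1) / d) → d * s ≤ V ∧ (σ.v .b < d * s → σ.v .j + 1 ≤ V ∧ ∀ σ' : St,
          σ'.v .j = σ.v .j + 1 → σ'.v .b = d * s → σ'.a = σ.a → BestInv N n b₀ K T σ' τ) ∧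
        (d * s ≤ σ.v .b → σ.v .j + 1 ≤ V ∧ ∀ σ' : St,
          σ'.v .j = σ.v .j + 1 → σ'.v .b = σ.v .b → σ'.a = σ.a → BestInv N n b₀ K T σ' τ) := by
      intro s hs
      obtain ⟨ha, hb, hc⟩ := min_div_spec hd1 hs
      refine ⟨by omega, fun hlt => ⟨by omega, key _ hlt.le (by omega) (hsq s hb) ?_⟩,
        fun hle => ⟨by omega, key _ le_rfl h4 h5 ?_⟩⟩
      · exact fun _ _ m hm hm' => ha m hm hm'
      · exact fun _ _ m hm hm' => (ha m hm hm').trans hle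
    refine ⟨by omega, by omega, fun hlt => ?_, fun hle => ?_⟩
    · obtain ⟨ha, hb, hc⟩ := hmain _ (by rw [if_pos hlt])
      refine ⟨ha, fun hlt => ?_, fun hge => ?_⟩
      · exact ⟨by omega, (hb hlt).2 _ (by simp) (by simp) (by simp)⟩
      · exact ⟨by omega, (hc hge).2 _ (by simp) (by simp) (by simp)⟩
    · obtain ⟨ha, hb, hc⟩ := hmain _ (by rw [if_neg (by omega)])
      refine ⟨ha, fun hlt => ?_, fun hge => ?_⟩
      · exact ⟨by omega, (hb hlt).2 _ (by simp) (by simp) (by simp)⟩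
      · exact ⟨by omega, (hc hge).2 _ (by simp) (by simp) (by simp)⟩

theorem bestPass_spec {N n K : ℕ} {T : ℕ → ℕ} (hT : IsText T N) (hV : 2 * N + 2 ≤ V)
    (hnN : n ≤ N) (hN : σ.v .N = N) (hn : σ.v .n = n) (hns : NssArrays T N (σ.a .ns) (σ.a .nl))
    (hln : ∀ k, 1 ≤ k → k ≤ N → Lcs T k (σ.a .ns k) (σ.a .ln k)) (hbn : σ.v .b < n)
    (hb : HasSquare T N (σ.v .b)) (hτ : N + K ≤ τ) :
    wp V B bestPass (fun σ' τ' => σ.v .b ≤ σ'.v .b ∧ σ'.v .b < n ∧ HasSquare T N (σ'.v .b) ∧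
      Covers N (n - 1) (σ'.v .b) (σ.a .ns) (σ.a .nl) (σ.a .ln) ∧ K ≤ τ') σ τ := by
  unfold bestPass
  simp only [wp_seq, wp_assign]
  refine ⟨by simp; omega, ?_⟩
  refine wp_while (BestInv N n (σ.v .b) K T) ?_ ?_
  · simp only [BestInv, St.set_v, St.set_a]
    simp
    exact ⟨hbn, hb, fun j h1 h2 => by omega, by omega⟩
  · intro σ' τ' hI hF
    have ha : ∀ A, σ'.a A = σ.a A := fun A => (hF.2 _ (by simp [bestBody, Stmt.setsArr])).trans
      (by simp)
    have hN' : σ'.v .N = N := (hF.1 _ (by simp [bestBody, Stmt.setsVar])).trans (by simpa)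
    have hn' : σ'.v .n = n := (hF.1 _ (by simp [bestBody, Stmt.setsVar])).trans (by simpa)
    have h1 := hI.2.1
    have h2 := hI.2.2.2.2.2.2
    refine ⟨by simp; omega, fun hlt => ?_, fun hge => ?_⟩
    · simp [hN'] at hlt
      refine ⟨by omega, bestBody_spec hT hV hnN hN' hn' (by rwa [ha, ha]) (by rwa [ha, ha])
        (by omega) ?_⟩
      rwa [Nat.sub_add_cancel (by omega)]
    · simp [hN'] at hge
      obtain ⟨-, -, h3, h4, h5, h6, -⟩ := hI
      rw [ha, ha, ha] at h6
      exact ⟨h3, h4, h5, fun j hj hjN => h6 j hj (by omega), by omega⟩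

/-- Reverse the order of the letters of the text. -/
def flip : Stmt :=
  .j ::= .lit 1 ;; .while (.lt Var.j (Var.N + .lit 1))
    -- For letters from `1` to `n + 2` this reversal is an involution of that range.
    (.store .text Var.j (Var.n + .lit 3 - .get .text Var.j) ;; .j ::= Var.j + .lit 1)

theorem flip_spec {N n K : ℕ} {T : ℕ → ℕ} (hT : IsText T N) (hV : N + 3 ≤ V)
    (hnN : n ≤ N) (hN : σ.v .N = N) (hn : σ.v .n = n) (ht : σ.a .text = T) (hτ : N + K ≤ τ) :
    wp V B flip (fun σ' τ' => σ'.a .text = reversed T N (n + 3) ∧ K ≤ τ') σ τ := by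
  unfold flip
  simp only [wp_seq, wp_assign]
  refine ⟨by simp; omega, ?_⟩
  refine wp_while (fun σ' τ' => 1 ≤ σ'.v .j ∧ σ'.v .j ≤ N + 1 ∧ (∀ k, σ'.a .text k =
    if 1 ≤ k ∧ k < σ'.v .j then n + 3 - T k else T k) ∧ N + 1 - σ'.v .j + K ≤ τ') ?_ ?_
  · simp [ht]
    exact ⟨fun k h1 h2 => by omega, by omega⟩
  · rintro σ' τ' ⟨h1, h2, h3, h4⟩ hF
    have hN' : σ'.v .N = N := (hF.1 _ (by simp [Stmt.setsVar])).trans (by simpa)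
    have hn' : σ'.v .n = n := (hF.1 _ (by simp [Stmt.setsVar])).trans (by simpa)
    simp [hN', hn']
    refine ⟨by omega, fun hlt => ⟨by omega, by omega, by omega, by omega, fun k => ?_, by omega⟩,
      fun hge => ⟨?_, by omega⟩⟩
    · by_cases hk : k = σ'.v .j
      · subst hk
        rw [Function.update_self, h3, if_neg (by omega), if_pos (by omega)]
      · rw [Function.update_of_ne hk, h3]
        by_cases hc : 1 ≤ k ∧ k < σ'.v .j
        · rw [if_pos hc, if_pos (by omega)]
        · rw [if_neg hc, if_neg (by omega)]
    · funext k
      rw [h3, reversed]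
      by_cases hc : 1 ≤ k ∧ k ≤ N
      · rw [if_pos (by omega), if_pos hc]
      · rw [if_neg (by omega), if_neg hc]
        rcases Nat.eq_zero_or_pos k with rfl | hk
        · exact hT.zero
        · exact hT.end_eq k (by omega)

theorem reversed_reversed {T : ℕ → ℕ} {N M : ℕ} (hT : IsText T N)
    (hM : ∀ i, 1 ≤ i → i ≤ N → T i < M) : reversed (reversed T N M) N M = T := by
  funext k
  by_cases hc : 1 ≤ k ∧ k ≤ N
  · have := hM k hc.1 hc.2
    simp only [reversed, if_pos hc]
    omega
  · simp only [reversed, if_neg hc]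
    rcases Nat.eq_zero_or_pos k with rfl | hk
    · exact hT.zero.symm
    · exact (hT.end_eq k (by omega)).symm

/-- Find squares at the edges for one order of the letters. -/
def findSquares : Stmt := edges ;; leftPass ;; bestPass

theorem findSquares_spec {N n K : ℕ} {T : ℕ → ℕ} (hT : IsText T N) (hV : 2 * N + 2 ≤ V)
    (hN1 : 1 ≤ N) (hnN : n ≤ N) (hN : σ.v .N = N) (hn : σ.v .n = n) (ht : σ.a .text = T)
    (hbn : σ.v .b < n) (hb : HasSquare T N (σ.v .b)) (hτ : 10 * N + 10 + K ≤ τ) :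
    wp V B findSquares (fun σ' τ' => σ.v .b ≤ σ'.v .b ∧ σ'.v .b < n ∧ HasSquare T N (σ'.v .b) ∧
      NssArrays T N (σ'.a .ns) (σ'.a .nl) ∧
      (∀ k, 1 ≤ k → k ≤ N → Lcs T k (σ'.a .ns k) (σ'.a .ln k)) ∧
      Covers N (n - 1) (σ'.v .b) (σ'.a .ns) (σ'.a .nl) (σ'.a .ln) ∧ K ≤ τ') σ τ := by
  unfold findSquares
  simp only [wp_seq]
  refine (edges_spec (K := 3 * N + K) hN (by rwa [ht]) (by omega) (by omega)).apply ?_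
  rintro σ₁ τ₁ ⟨h1, h2⟩ hF₁
  have hv₁ : ∀ x, x = .N ∨ x = .n ∨ x = .b → σ₁.v x = σ.v x := by
    rintro x (rfl | rfl | rfl) <;>
      exact hF₁.1 _ (by simp [edges, clearLoop, edgesBody, copyLoop, copyBody, compareLoop, compareBody,
        extendRight, Stmt.setsVar])
  have ht₁ : σ₁.a .text = T := (hF₁.2 _ (by simp [edges, clearLoop, edgesBody, copyLoop, copyBody,
    compareLoop, compareBody, extendRight, Stmt.setsArr])).trans ht
  rw [ht] at h1
  refine (leftPass_spec (N := N) (K := N + K) (by rw [hv₁ _ (.inl rfl), hN]) (by rwa [ht₁])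
    (by omega) (by rwa [ht₁]) (by omega)).apply ?_
  rintro σ₂ τ₂ ⟨h3, h4⟩ hF₂
  have hv₂ : ∀ x, x = .N ∨ x = .n ∨ x = .b → σ₂.v x = σ.v x := by
    rintro x hx
    rw [← hv₁ x hx]
    rcases hx with (rfl | rfl | rfl) <;>
      exact hF₂.1 _ (by simp [leftPass, leftBody, leftCompare, extendLeft, Stmt.setsVar])
  have ha₂ : ∀ A, A ≠ .ln → σ₂.a A = σ₁.a A := fun A hA =>
    hF₂.2 _ (by simp [leftPass, leftBody, leftCompare, extendLeft, Stmt.setsArr, hA])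
  rw [ht₁, ← ha₂ .ns (by simp)] at h3
  rw [← ha₂ .ns (by simp), ← ha₂ .nl (by simp)] at h1
  refine (bestPass_spec (K := K) hT hV hnN (by rw [hv₂ _ (.inl rfl), hN])
    (by rw [hv₂ _ (.inr (.inl rfl)), hn]) h1 h3 (by rwa [hv₂ _ (.inr (.inr rfl))])
    (by rwa [hv₂ _ (.inr (.inr rfl))]) (by omega)).apply ?_
  rintro σ₃ τ₃ ⟨h5, h6, h7, h8, h9⟩ hF₃
  have ha₃ : ∀ A, σ₃.a A = σ₂.a A := fun A =>
    hF₃.2 _ (by simp [bestPass, bestBody, Stmt.setsArr])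
  rw [hv₂ _ (.inr (.inr rfl))] at h5
  simp only [ha₃]
  exact ⟨h5, h6, h7, h1, h3, h8, h9⟩

/-- Compute the length of the halves of the longest square that is shorter than `2 * n`. -/
def longestSquare : Stmt := .b ::= .lit 0 ;; flip ;; findSquares ;; flip ;; findSquares

/-- The reversed order is treated before the original one, so that the next smaller suffixes of `T`
itself remain in memory for the selection of centers. The value `b` is kept and can only grow. -/
theorem longestSquare_spec {N n K : ℕ} {T : ℕ → ℕ} (hT : IsText T N) (hV : 2 * N + 3 ≤ V)
    (hM : ∀ i, 1 ≤ i → i ≤ N → T i < n + 3) (hn0 : 1 ≤ n) (hnN : n ≤ N) (hN : σ.v .N = N)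
    (hn : σ.v .n = n) (ht : σ.a .text = T) (hτ : 22 * N + 20 + K ≤ τ) :
    wp V B longestSquare (fun σ' τ' => σ'.v .b < n ∧ HasSquare T N (σ'.v .b) ∧
      (∀ k < n, HasSquare T N k → k ≤ σ'.v .b) ∧ NssArrays T N (σ'.a .ns) (σ'.a .nl) ∧
      σ'.a .text = T ∧ K ≤ τ') σ τ := by
  have hR := IsText.reversed hM
  have hff : ∀ x, x = .N ∨ x = .n ∨ x = .b → flip.setsVar x = false := by
    rintro x (rfl | rfl | rfl) <;> simp [flip, Stmt.setsVar]
  have hsf : ∀ x, x = .N ∨ x = .n → findSquares.setsVar x = false := by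
    rintro x (rfl | rfl) <;>
      simp [findSquares, edges, clearLoop, edgesBody, copyLoop, copyBody, compareLoop, compareBody,
        extendRight, leftPass, leftBody, leftCompare, extendLeft, bestPass, bestBody, Stmt.setsVar]
  have hst : findSquares.setsArr .text = false := by
    simp [findSquares, edges, clearLoop, edgesBody, copyLoop, copyBody, compareLoop, compareBody,
        extendRight, leftPass, leftBody, leftCompare, extendLeft, bestPass, bestBody, Stmt.setsArr]
  unfold longestSquare
  simp only [wp_seq, wp_assign]
  refine ⟨by simp, ?_⟩
  refine (flip_spec (n := n) (K := 21 * N + 20 + K) hT (by omega) hnN (by simpa) (by simpa) (by simpa)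
    (by omega)).apply ?_
  rintro σ₁ τ₁ ⟨h1, h2⟩ hF₁
  have hN₁ : σ₁.v .N = N := (hF₁.1 _ (hff _ (.inl rfl))).trans (by simpa)
  have hn₁ : σ₁.v .n = n := (hF₁.1 _ (hff _ (.inr (.inl rfl)))).trans (by simpa)
  have hb₁ : σ₁.v .b = 0 := (hF₁.1 _ (hff _ (.inr (.inr rfl)))).trans (by simp)
  refine (findSquares_spec (K := 11 * N + 10 + K) hR (by omega) (by omega) hnN hN₁ hn₁ h1 (by omega)
    (by rw [hb₁]; exact hasSquare_zero _ _) (by omega)).apply ?_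
  rintro σ₂ τ₂ ⟨h3, h4, h5, h6, h7, h8, h9⟩ hF₂
  have hN₂ : σ₂.v .N = N := (hF₂.1 _ (hsf _ (.inl rfl))).trans hN₁
  have hn₂ : σ₂.v .n = n := (hF₂.1 _ (hsf _ (.inr rfl))).trans hn₁
  have ht₂ := (hF₂.2 _ hst).trans h1
  refine (flip_spec (n := n) (K := 10 * N + 10 + K) hR (by omega) hnN hN₂ hn₂ ht₂
    (by omega)).apply ?_
  rintro σ₃ τ₃ ⟨h10, h11⟩ hF₃
  rw [reversed_reversed hT hM] at h10
  have hN₃ : σ₃.v .N = N := (hF₃.1 _ (hff _ (.inl rfl))).trans hN₂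
  have hn₃ : σ₃.v .n = n := (hF₃.1 _ (hff _ (.inr (.inl rfl)))).trans hn₂
  have hb₃ : σ₃.v .b = σ₂.v .b := hF₃.1 _ (hff _ (.inr (.inr rfl)))
  refine (findSquares_spec (K := K) hT (by omega) (by omega) hnN hN₃ hn₃ h10 (by omega)
    (by rw [hb₃]; exact h5.of_reversed hM) (by omega)).apply ?_
  rintro σ₄ τ₄ ⟨h13, h14, h15, h16, h17, h18, h19⟩ hF₄
  refine ⟨h14, h15, fun k hk hsq => ?_, h16, (hF₄.2 _ hst).trans h10, h19⟩
  have h20 : Covers N (n - 1) (σ₄.v .b) (σ₂.a .ns) (σ₂.a .nl) (σ₂.a .ln) := by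
    intro j h1 h2 h3 h4 m h5 h6
    have := h8 j h1 h2 h3 h4 m h5 h6
    omega
  exact le_of_covers hT hM h16 h17 h18 h6 h7 h20 hsq (by omega)

end WordRAM

/-! ## Centers -/

namespace CircularWord

/-- `T` consists of three copies of a word of length `n` and a last letter that is greater than all
letters of the word. -/
structure IsTripled (T : ℕ → ℕ) (n : ℕ) : Prop where
  text : IsText T (3 * n + 1)
  period : ∀ k, 1 ≤ k → k ≤ 2 * n → T (k + n) = T k
  le : ∀ k, 1 ≤ k → k ≤ 3 * n → T k ≤ n + 1
  last : T (3 * n + 1) = n + 2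
  one_le : 1 ≤ n

/-- The conjugate that begins at `x` has a border of length `b`, where `n = b + p`. -/
def Center (T : ℕ → ℕ) (b p x : ℕ) : Prop := ∀ t < b, T (x + t) = T (x + p + t)

/-- The suffix at `s` is the least one that begins at a center. -/
structure LeastCenter (T : ℕ → ℕ) (n b p s : ℕ) : Prop where
  one_le : 1 ≤ s
  le : s ≤ n
  center : Center T b p s
  least : ∀ x, 1 ≤ x → x ≤ n → Center T b p x → x ≠ s → SufLT T s x

variable {T : ℕ → ℕ} {n b p : ℕ}

theorem IsTripled.lt_last (h : IsTripled T n) {k : ℕ} (hk : k ≠ 3 * n + 1) : T k < n + 2 := by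
  rcases Nat.eq_zero_or_pos k with rfl | h1
  · rw [h.text.zero]; omega
  rcases Nat.lt_or_ge (3 * n) k with h2 | h2
  · rw [h.text.end_eq k (by omega)]; omega
  · have := h.le k h1 h2; omega

theorem IsTripled.exists_least (h : IsTripled T n) {x : ℕ} (hx : 1 ≤ x) (hxn : x ≤ n)
    (hc : Center T b p x) : ∃ s, LeastCenter T n b p s := by
  have main : ∀ m ≤ n, (∃ x, 1 ≤ x ∧ x ≤ m ∧ Center T b p x) → ∃ s, 1 ≤ s ∧ s ≤ m ∧
      Center T b p s ∧ ∀ y, 1 ≤ y → y ≤ m → Center T b p y → y ≠ s → SufLT T s y := by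
    intro m hm
    induction m with
    | zero => rintro ⟨x, h1, h2, -⟩; omega
    | succ m ih =>
      rintro ⟨x, hx1, hxm, hx⟩
      by_cases hex : ∃ x, 1 ≤ x ∧ x ≤ m ∧ Center T b p x
      · obtain ⟨s, h1, h2, h3, h4⟩ := ih (by omega) hex
        by_cases hlt : Center T b p (m + 1) ∧ SufLT T (m + 1) s
        · refine ⟨m + 1, by omega, le_rfl, hlt.1, fun y hy1 hym hy hne => ?_⟩
          by_cases hys : y = s
          · exact hys ▸ hlt.2
          · exact hlt.2.trans (h4 y hy1 (by omega) hy hys)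
        · refine ⟨s, h1, by omega, h3, fun y hy1 hym hy hne => ?_⟩
          rcases Nat.lt_succ_iff_lt_or_eq.1 (show y < m + 1 + 1 by omega) with hy2 | rfl
          · exact h4 y hy1 (by omega) hy hne
          · exact (h.text.sufLT_or (show s < m + 1 by omega) (by omega) (.inl h1)).resolve_right
              fun h5 => hlt ⟨hy, h5⟩
      · push Not at hex
        have hy' : ∀ y, 1 ≤ y → y ≤ m + 1 → Center T b p y → y = m + 1 := by
          intro y h1 h2 h3
          by_contra hne
          exact hex y h1 (by omega) h3
        obtain rfl := hy' x hx1 hxm hx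
        exact ⟨m + 1, hx1, le_rfl, hx, fun y h1 h2 h3 h4 => absurd (hy' y h1 h2 h3) h4⟩
  obtain ⟨s, h1, h2, h3, h4⟩ := main n le_rfl ⟨x, hx, hxn, hc⟩
  exact ⟨s, h1, h2, h3, h4⟩

/-- The conjugate that begins with the second half of a square ends with the first half. The square
avoids the last letter, which occurs only once, and it can be moved by multiples of `n`. -/
theorem IsTripled.exists_center (h : IsTripled T n) (hb : b < n) (hs : HasSquare T (3 * n + 1) b) :
    ∃ x, 1 ≤ x ∧ x ≤ n ∧ Center T b (n - b) x := by
  rcases Nat.eq_zero_or_pos b with rfl | hb1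
  · exact ⟨1, le_rfl, h.one_le, fun t ht => by omega⟩
  obtain ⟨a, ha, hab, hsq⟩ := hs
  have h1 : a + 2 * b ≤ 3 * n + 1 := by
    by_contra hlt
    have h2 := hsq (b - 1) (by omega)
    rw [show a + b + (b - 1) = 3 * n + 1 by omega, h.last] at h2
    have := h.lt_last (k := a + (b - 1)) (by omega)
    omega
  have key : ∀ m a, a ≤ m → 1 ≤ a → a + 2 * b ≤ 3 * n + 1 → (∀ t < b, T (a + t) = T (a + b + t)) →
      ∃ x, 1 ≤ x ∧ x ≤ n ∧ Center T b (n - b) x := by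
    intro m
    induction m with
    | zero => intro a _ _; omega
    | succ m ih =>
      intro a ham ha1 hab hsq
      have hn := h.one_le
      rcases Nat.lt_or_ge n a with hna | hna
      · refine ih (a - n) (by omega) (by omega) (by omega) fun t ht => ?_
        have e1 := h.period (a - n + t) (by omega) (by omega)
        have e2 := h.period (a - n + b + t) (by omega) (by omega)
        have e3 := hsq t ht
        rw [show a - n + t + n = a + t by omega] at e1
        rw [show a - n + b + t + n = a + b + t by omega] at e2
        rw [← e1, ← e2, e3]
      · rcases Nat.lt_or_ge n (a + b) with hab | hab
        · refine ⟨a + b - n, by omega, by omega, fun t ht => ?_⟩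
          have e2 := h.period (a + b - n + t) (by omega) (by omega)
          rw [show a + b - n + t + n = a + b + t by omega, ← hsq t ht] at e2
          rw [← e2]
          congr 1; omega
        · refine ⟨a + b, by omega, by omega, fun t ht => ?_⟩
          have e2 := h.period (a + t) (by omega) (by omega)
          rw [← hsq t ht, ← e2]
          congr 1; omega
  exact key a a le_rfl ha h1 hsq

theorem IsTripled.hasSquare (h : IsTripled T n) (hb : b < n) {x : ℕ} (hx : 1 ≤ x) (hxn : x ≤ n)
    (hc : Center T b (n - b) x) : HasSquare T (3 * n + 1) b := by
  refine ⟨x + (n - b), by omega, by omega, fun t ht => ?_⟩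
  have e := h.period (x + t) (by omega) (by omega)
  rw [← hc t ht, ← e]
  congr 1; omega

/-- Letters agree with those at distance `p` on the windows of length `b` at `x` and at `z`, and
these windows leave no gap. So centers at distance at most `b` belong to one block. -/
theorem Center.between {x y z : ℕ} (hx : Center T b p x) (hz : Center T b p z) (hxy : x ≤ y)
    (hyz : y ≤ z) (hzb : z ≤ x + b) : Center T b p y := by
  intro t ht
  rcases Nat.lt_or_ge (y + t) (x + b) with h | h
  · have := hx (y + t - x) (by omega)
    rwa [show x + (y + t - x) = y + t by omega, show x + p + (y + t - x) = y + p + t by omega]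
      at this
  · have := hz (y + t - z) (by omega)
    rwa [show z + (y + t - z) = y + t by omega, show z + p + (y + t - z) = y + p + t by omega]
      at this

/-- Positions that are far from the end of a match between centers are centers simultaneously. -/
theorem Center.of_match (h : IsTripled T n) (hn : b + p = n) {i j k t : ℕ} (hi1 : 1 ≤ i)
    (hj1 : 1 ≤ j) (hi : Center T b p i) (hj : Center T b p j)
    (hk : ∀ q < k, T (i + q) = T (j + q)) (htk : b + t ≤ k) (hit : i + t ≤ 2 * n)
    (hjt : j + t ≤ 2 * n) (hc : Center T b p (i + t)) : Center T b p (j + t) := by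
  intro q hq
  have h1 := hk (t + q) (by omega)
  have h2 := hc q hq
  rw [show i + (t + q) = i + t + q by omega, show j + (t + q) = j + t + q by omega] at h1
  rw [← h1, h2]
  rcases Nat.lt_or_ge (t + q) b with h3 | h3
  · have e1 := hi (t + q) h3
    have e2 := hj (t + q) h3
    have e3 := hk (t + q) (by omega)
    rw [show i + t + p + q = i + p + (t + q) by omega, ← e1, e3, e2]
    congr 1; omega
  · have e1 := h.period (i + (t + q - b)) (by omega) (by omega)
    have e2 := h.period (j + (t + q - b)) (by omega) (by omega)
    have e3 := hk (t + q - b) (by omega)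
    rw [show i + t + p + q = i + (t + q - b) + n by omega, e1, e3, ← e2]
    congr 1; omega

theorem Center.sub_period (h : IsTripled T n) (hn : b + p = n) {x : ℕ} (hx : n < x)
    (hx2 : x ≤ 2 * n) (hc : Center T b p x) : Center T b p (x - n) := by
  intro t ht
  have e1 := h.period (x - n + t) (by omega) (by omega)
  have e2 := h.period (x - n + p + t) (by omega) (by omega)
  rw [← e1, ← e2, show x - n + t + n = x + t by omega, show x - n + p + t + n = x + p + t by omega]
  exact hc t ht

/-- If `T` is smaller at `i` than at `j` then the least center is not near `j`. -/
theorem LeastCenter.not_right {s i j k t : ℕ} (hs : LeastCenter T n b p s) (h : IsTripled T n)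
    (hn : b + p = n) (hi1 : 1 ≤ i) (hij : i < j) (hi : Center T b p i) (hj : Center T b p j)
    (hk : ∀ q < k, T (i + q) = T (j + q)) (hlt : T (i + k) < T (j + k))
    (ht : t = 0 ∨ b + t ≤ k) : s ≠ j + t := by
  rintro rfl
  have h2 := hs.le
  have hc : Center T b p (i + t) := by
    rcases ht with rfl | ht
    · exact hi
    · exact hj.of_match h hn (by omega) hi1 hi (fun q hq => (hk q hq).symm) ht (by omega)
        (by omega) hs.center
  refine (hs.least (i + t) (by omega) (by omega) hc (by omega)).asymm ⟨k - t, fun q hq => ?_, ?_⟩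
  · rw [Nat.add_assoc, Nat.add_assoc]
    exact hk (t + q) (by omega)
  · rwa [show i + t + (k - t) = i + k by omega, show j + t + (k - t) = j + k by omega]

/-- If `T` is smaller at `j` than at `i` then the least center is not near `i`. -/
theorem LeastCenter.not_left {s i j k t : ℕ} (hs : LeastCenter T n b p s) (h : IsTripled T n)
    (hn : b + p = n) (hi1 : 1 ≤ i) (hij : i < j) (hjn : j ≤ n) (hi : Center T b p i)
    (hj : Center T b p j) (hk : ∀ q < k, T (i + q) = T (j + q)) (hlt : T (j + k) < T (i + k))
    (ht : t = 0 ∨ b + t ≤ k) : s ≠ i + t := by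
  rintro rfl
  have h2 := hs.le
  have hc : Center T b p (j + t) := by
    rcases ht with rfl | ht
    · exact hj
    · exact hi.of_match h hn hi1 (by omega) hj hk ht (by omega) (by omega) hs.center
  rcases Nat.lt_or_ge n (j + t) with hjt | hjt
  · have h3 := h.text.le_of_match hij (by omega) (.inl hi1) hk
    -- This is what the great last letter is for: the letter at `j` is the smaller one, so the
    -- mismatch comes before the end of the periodic part, and the suffix can be moved back by `n`.
    have h4 : j + k ≤ 3 * n := by
      by_contra h5
      have h6 : j + k = 3 * n + 1 ∨ j + k = 3 * n + 2 := by omega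
      rcases h6 with h6 | h6
      · have := h.lt_last (k := i + k) (by omega)
        rw [h6, h.last] at hlt
        omega
      · have h7 := hk (k - 1) (by omega)
        rw [show j + (k - 1) = 3 * n + 1 by omega, h.last] at h7
        have := h.lt_last (k := i + (k - 1)) (by omega)
        omega
    have hp : ∀ q ≤ k - t, T (j + t - n + q) = T (j + (t + q)) := by
      intro q hq
      have := h.period (j + t - n + q) (by omega) (by omega)
      rw [← this]
      congr 1; omega
    refine (hs.least (j + t - n) (by omega) (by omega) (hc.sub_period h hn hjt (by omega))
      (by omega)).asymm ⟨k - t, fun q hq => ?_, ?_⟩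
    · rw [hp q hq.le, Nat.add_assoc]
      exact (hk (t + q) (by omega)).symm
    · rw [hp _ le_rfl]
      rwa [show i + t + (k - t) = i + k by omega, show j + (t + (k - t)) = j + k by omega]
  · refine (hs.least (j + t) (by omega) hjt hc (by omega)).asymm ⟨k - t, fun q hq => ?_, ?_⟩
    · rw [Nat.add_assoc, Nat.add_assoc]
      exact (hk (t + q) (by omega)).symm
    · rwa [show i + t + (k - t) = i + k by omega, show j + t + (k - t) = j + k by omega]

/-! ### Representatives of blocks of centers -/

/-- The marked positions are centers at distance more than `b` of each other, and the least center is
marked. -/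
structure Marks (T : ℕ → ℕ) (n b p : ℕ) (fl : ℕ → ℕ) : Prop where
  center : ∀ k, fl k ≠ 0 → 1 ≤ k ∧ k ≤ n ∧ Center T b p k
  far : ∀ k m, fl k ≠ 0 → fl m ≠ 0 → k < m → k + b < m
  least : ∀ s, LeastCenter T n b p s → fl s ≠ 0

/-- The positions greater than `u` have been processed; `x` is the marked position of the block of
centers that begins at `u + 1`, or zero if there is no such block. -/
structure PartialMarks (T : ℕ → ℕ) (n b p u x : ℕ) (fl : ℕ → ℕ) : Prop where
  le : x ≤ n
  zero : fl 0 = 0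
  none : x = 0 → u < n → ¬ Center T b p (u + 1)
  center : ∀ k, fl k ≠ 0 → k ≤ n ∧ Center T b p k ∧ u < k ∧ x ≤ k
  block : x ≠ 0 → fl x ≠ 0 ∧ ∀ k, u < k → k < x → Center T b p k ∧ SufLT T x k
  far : ∀ k m, fl k ≠ 0 → fl m ≠ 0 → k < m → k + b < m
  cover : ∀ s, u < s → s ≤ n → Center T b p s → ∃ f, fl f ≠ 0 ∧ (f = s ∨ SufLT T f s)

variable {u x : ℕ} {fl : ℕ → ℕ}

theorem PartialMarks.marks (h : PartialMarks T n b p 0 x fl) : Marks T n b p fl where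
  center k hk := ⟨(h.center k hk).2.2.1, (h.center k hk).1, (h.center k hk).2.1⟩
  far := h.far
  least s hs := by
    obtain ⟨f, hf, rfl | h1⟩ := h.cover s (by have := hs.one_le; omega) hs.le hs.center
    · exact hf
    · obtain ⟨h2, h3, h4, -⟩ := h.center f hf
      exact absurd h1 (hs.least f h4 h2 h3 h1.ne).asymm

theorem partialMarks_start (h0 : ∀ k, fl k = 0) : PartialMarks T n b p n 0 fl where
  le := Nat.zero_le n
  zero := h0 0
  none _ h := absurd h (lt_irrefl n)
  center k hk := absurd (h0 k) hk
  block h := absurd rfl h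
  far k m hk := absurd (h0 k) hk
  cover s h1 h2 := by omega

theorem PartialMarks.skip (h : PartialMarks T n b p u x fl) (hu : 1 ≤ u) (hc : ¬ Center T b p u) :
    PartialMarks T n b p (u - 1) 0 fl where
  le := Nat.zero_le n
  zero := h.zero
  none _ _ := by rwa [Nat.sub_add_cancel hu]
  center k hk := by
    obtain ⟨h1, h2, h3, -⟩ := h.center k hk
    exact ⟨h1, h2, by omega, by omega⟩
  block h := absurd rfl h
  far := h.far
  cover s h1 h2 h3 := by
    refine h.cover s ?_ h2 h3
    by_contra hlt
    exact hc (by rwa [show u = s by omega])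

/-- The next smaller suffix `c` lies in the block, no further than its mark `x`, so the suffix at
`x` is smaller than that at `u`. -/
theorem PartialMarks.keep (h : PartialMarks T n b p u x fl) (hu : 1 ≤ u) (hc : Center T b p u)
    {c : ℕ} (hn : Nss T u c) (hcx : c ≤ x) : PartialMarks T n b p (u - 1) x fl := by
  have h1 := hn.1
  have hb := h.block (by omega)
  have hx : SufLT T x u := by
    rcases Nat.lt_or_eq_of_le hcx with h2 | rfl
    · exact (hb.2 c h1 h2).2.trans hn.2.1
    · exact hn.2.1
  refine ⟨h.le, h.zero, fun h2 => by omega, fun k hk => ?_, fun _ => ⟨hb.1, fun k h2 h3 => ?_⟩, h.far,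
    fun s h2 h3 h4 => ?_⟩
  · obtain ⟨h2, h3, h4, h5⟩ := h.center k hk
    exact ⟨h2, h3, by omega, h5⟩
  · rcases Nat.lt_or_eq_of_le (show u ≤ k by omega) with h4 | rfl
    · exact hb.2 k h4 h3
    · exact ⟨hc, hx⟩
  · rcases Nat.lt_or_eq_of_le (show u ≤ s by omega) with h5 | rfl
    · exact h.cover s h5 h3 h4
    · exact ⟨x, hb.1, .inr hx⟩

/-- As the next smaller suffix lies beyond `x`, that at `u` is smaller than that at `x`. If `x = 0`,
a new block begins, and clearing the flag at `0` does no harm. -/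
theorem PartialMarks.replace (h : PartialMarks T n b p u x fl) (hu : 1 ≤ u) (hun : u ≤ n)
    (hc : Center T b p u) {c : ℕ} (hn : Nss T u c) (hcx : x < c) :
    PartialMarks T n b p (u - 1) u (Function.update (Function.update fl x 0) u 1) := by
  have hfl : ∀ k, Function.update (Function.update fl x 0) u 1 k ≠ 0 → k = u ∨ k ≠ x ∧ fl k ≠ 0 := by
    intro k hk
    by_cases h1 : k = u
    · exact .inl h1
    · by_cases h2 : k = x
      · subst h2; simp [h1] at hk
      · simp [h1, h2] at hk; exact .inr ⟨h2, hk⟩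
  have hfl' : ∀ k, k ≠ x → fl k ≠ 0 → Function.update (Function.update fl x 0) u 1 k ≠ 0 := by
    intro k h1 h2
    by_cases h3 : k = u
    · subst h3; simp
    · simpa [h3, h1] using h2
  have hfar : ∀ m, m ≠ x → fl m ≠ 0 → u + b < m := by
    intro m hm hfm
    obtain ⟨h1, h2, h3, h4⟩ := h.center m hfm
    by_cases hx : x = 0
    · by_contra hlt
      -- A mark within distance `b` would put `u + 1` between two centers of one block.
      exact h.none hx (by omega) (hc.between h2 (by omega) (by omega) (by omega))
    · have hb := h.block hx
      have := h.far x m hb.1 hfm (by omega)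
      have := (h.center x hb.1).2.2.1
      omega
  refine ⟨hun, ?_, fun h1 => by omega, fun k hk => ?_, fun _ => ⟨by simp, fun k h1 h2 => by omega⟩,
    fun k m hk hm hkm => ?_, fun s h1 h2 h3 => ?_⟩
  · by_contra h1
    rcases hfl 0 h1 with h2 | h2
    · omega
    · exact h2.2 h.zero
  · rcases hfl k hk with rfl | ⟨h1, h2⟩
    · exact ⟨hun, hc, by omega, le_rfl⟩
    · obtain ⟨h3, h4, h5, -⟩ := h.center k h2
      exact ⟨h3, h4, by omega, by omega⟩
  · rcases hfl m hm with rfl | ⟨h1, h2⟩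
    · rcases hfl k hk with rfl | ⟨h1, h2⟩
      · omega
      · have := (h.center k h2).2.2.1; omega
    · rcases hfl k hk with rfl | ⟨h3, h4⟩
      · exact hfar m h1 h2
      · exact h.far k m h4 h2 hkm
  · rcases Nat.lt_or_eq_of_le (show u ≤ s by omega) with h4 | rfl
    · obtain ⟨f, hf, hfs⟩ := h.cover s h4 h2 h3
      by_cases hfx : f = x
      · subst hfx
        have h5 := (h.center f hf).2.2.1
        have h6 := hn.2.2 f h5 hcx
        refine ⟨u, by simp, .inr ?_⟩
        rcases hfs with rfl | hfs
        · exact h6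
        · exact h6.trans hfs
      · exact ⟨f, hfl' f hfx hf, hfs⟩
    · exact ⟨u, by simp, .inl rfl⟩

end CircularWord

namespace WordRAM

open CircularWord

variable {V B : ℕ} {σ : St} {τ : ℕ}

/-! ### Selecting the least center -/

/-- Update the length of the match at distance `p`. -/
def countStep : Stmt :=
  .ite (.eq (.get .text Var.j) (.get .text (Var.j + Var.p))) (.y ::= Var.y + .lit 1) (.y ::= .lit 0)

/-- Update the marks for the position `j`; the least center of the current block is in `x`. -/
def markStep : Stmt :=
  .ite (.lt Var.j (Var.n + .lit 1))
    (.ite (.lt Var.y Var.b) (.x ::= .lit 0)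
      (.ite (.lt Var.x (.get .ns Var.j))
        (.store .fl Var.x (.lit 0) ;; .store .fl Var.j (.lit 1) ;; .x ::= Var.j) .skip)) .skip

/-- Mark the least center of each block of centers. -/
def markPass : Stmt :=
  -- A start at `2 * n` makes the count at positions up to `n` exact for lengths up to `b`, which is
  -- less than `n`.
  .j ::= Var.n + Var.n ;; .y ::= .lit 0 ;; .x ::= .lit 0 ;;
    .while (.lt (.lit 0) Var.j) (countStep ;; markStep ;; .j ::= Var.j - .lit 1)

/-- The letters at `j` and the following `m` positions agree with those at distance `p`, up to
position `2 * n`, if and only if `m ≤ y`. -/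
def Counts (T : ℕ → ℕ) (n p j y : ℕ) : Prop :=
  j + y ≤ 2 * n + 1 ∧
    ∀ m, j + m ≤ 2 * n + 1 → (m ≤ y ↔ ∀ t < m, T (j + t) = T (j + p + t))

theorem Counts.succ {T : ℕ → ℕ} {n p j y : ℕ} (h : Counts T n p (j + 1) y) :
    Counts T n p j (if T j = T (j + p) then y + 1 else 0) := by
  have h0 := h.1
  split_ifs with he
  · refine ⟨by omega, fun m hm => ?_⟩
    rcases m with _ | m
    · simp
    · rw [Nat.succ_le_succ_iff, h.2 m (by omega)]
      constructor
      · rintro h1 t ht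
        rcases t with _ | t
        · exact he
        · have := h1 t (by omega)
          rwa [show j + 1 + t = j + (t + 1) by omega, show j + 1 + p + t = j + p + (t + 1) by omega]
            at this
      · rintro h1 t ht
        have := h1 (t + 1) (by omega)
        rwa [show j + 1 + t = j + (t + 1) by omega, show j + 1 + p + t = j + p + (t + 1) by omega]
  · refine ⟨by omega, fun m hm => ?_⟩
    rcases m with _ | m
    · simp
    · simp only [Nat.le_zero, Nat.succ_ne_zero, false_iff]
      exact fun h1 => he (h1 0 (by omega))

/-- The invariant of the loop in `markPass`. -/
def MarkInv (T : ℕ → ℕ) (n b p K : ℕ) (σ : St) (τ : ℕ) : Prop :=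
  σ.v .j ≤ 2 * n ∧ Counts T n p (σ.v .j + 1) (σ.v .y) ∧
    PartialMarks T n b p (min (σ.v .j) n) (σ.v .x) (σ.a .fl) ∧ σ.v .j + K ≤ τ

theorem countStep_spec (hV : σ.v .j + σ.v .p ≤ V) (hV' : σ.v .y + 1 ≤ V) :
    wp V B countStep (fun σ' τ' => σ'.v .y = (if σ.a .text (σ.v .j) = σ.a .text (σ.v .j + σ.v .p)
      then σ.v .y + 1 else 0) ∧ τ' = τ) σ τ := by
  simp [countStep]
  exact ⟨hV, fun h => ⟨by omega, h⟩⟩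

theorem markStep_spec {T : ℕ → ℕ} {n b p : ℕ} (hT : IsTripled T n) (hbn : b < n) (hV : 2 * n ≤ V)
    (hn : σ.v .n = n) (hb : σ.v .b = b) (hj : 1 ≤ σ.v .j) (hj2 : σ.v .j ≤ 2 * n)
    (hns : NssArrays T (3 * n + 1) (σ.a .ns) (σ.a .nl)) (hc : Counts T n p (σ.v .j) (σ.v .y))
    (h : PartialMarks T n b p (min (σ.v .j) n) (σ.v .x) (σ.a .fl)) :
    wp V B markStep (fun σ' τ' =>
      PartialMarks T n b p (min (σ.v .j - 1) n) (σ'.v .x) (σ'.a .fl) ∧ τ' = τ) σ τ := by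
  have h1 := (hns _ hj (by omega)).1
  have hn1 := hT.one_le
  simp [markStep, hn, hb]
  refine ⟨by omega, fun hjn => ?_, fun hjn => ?_⟩
  · have hcb : b ≤ σ.v .y ↔ Center T b p (σ.v .j) := hc.2 b (by omega)
    rw [show min (σ.v .j) n = σ.v .j by omega] at h
    rw [show min (σ.v .j - 1) n = σ.v .j - 1 by omega]
    refine ⟨fun hlt => ?_, fun hle => ⟨fun hlt => ⟨by omega, ?_⟩, fun hle' => ?_⟩⟩
    · exact h.skip hj fun h2 => by have := hcb.2 h2; omega
    · exact h.replace hj (by omega) (hcb.1 hle) h1 hlt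
    · exact h.keep hj (hcb.1 hle) h1 hle'
  · rw [show min (σ.v .j) n = n by omega] at h
    rwa [show min (σ.v .j - 1) n = n by omega]

theorem markPass_spec {T : ℕ → ℕ} {n b p K : ℕ} (hT : IsTripled T n) (hbn : b < n) (hp : p ≤ n)
    (hV : 3 * n + 1 ≤ V) (hn : σ.v .n = n) (hb : σ.v .b = b) (hpv : σ.v .p = p)
    (ht : σ.a .text = T) (hns : NssArrays T (3 * n + 1) (σ.a .ns) (σ.a .nl))
    (hfl : ∀ k, σ.a .fl k = 0) (hτ : 2 * n + K ≤ τ) :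
    wp V B markPass (fun σ' τ' => Marks T n b p (σ'.a .fl) ∧ K ≤ τ') σ τ := by
  unfold markPass
  simp only [wp_seq, wp_assign]
  refine ⟨by simp; omega, by simp, by simp, ?_⟩
  refine wp_while (MarkInv T n b p K) ?_ ?_
  · simp [MarkInv, hn]
    refine ⟨by omega, ⟨by omega, fun m hm => ?_⟩, partialMarks_start hfl, by omega⟩
    obtain rfl : m = 0 := by omega
    simp
  · rintro σ' τ' ⟨h1, h2, h3, h4⟩ hF
    have hv : ∀ x, x = .n ∨ x = .b ∨ x = .p → σ'.v x = σ.v x := by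
      rintro x (rfl | rfl | rfl) <;>
        exact (hF.1 _ (by simp [countStep, markStep, Stmt.setsVar])).trans (by simp)
    have ha : ∀ A, A ≠ .fl → σ'.a A = σ.a A := fun A hA =>
      (hF.2 _ (by simp [countStep, markStep, Stmt.setsArr, hA])).trans (by simp)
    refine ⟨by simp, fun hlt => ?_, fun hge => ?_⟩
    · simp at hlt
      refine ⟨by omega, ?_⟩
      rw [wp_seq]
      have h2' := h2.1
      have hp' : σ'.v .p = p := by rw [hv _ (by simp), hpv]
      refine (countStep_spec ?_ ?_).apply ?_
      · rw [hp']; omega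
      · omega
      rintro σ₁ τ₁ ⟨h5, rfl⟩ hF₁
      have hj₁ : σ₁.v .j = σ'.v .j := hF₁.1 _ (by simp [countStep, Stmt.setsVar])
      have hx₁ : σ₁.v .x = σ'.v .x := hF₁.1 _ (by simp [countStep, Stmt.setsVar])
      have hn₁ : σ₁.v .n = σ'.v .n := hF₁.1 _ (by simp [countStep, Stmt.setsVar])
      have hb₁ : σ₁.v .b = σ'.v .b := hF₁.1 _ (by simp [countStep, Stmt.setsVar])
      have ha₁ : ∀ A, σ₁.a A = σ'.a A := fun A => hF₁.2 _ (by simp [countStep, Stmt.setsArr])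
      rw [ha _ (by simp), ht, hp'] at h5
      rw [wp_seq]
      refine (markStep_spec (p := p) hT hbn (by omega) ?_ ?_ ?_ ?_ ?_ ?_ ?_).apply ?_
      · rw [hn₁, hv _ (by simp), hn]
      · rw [hb₁, hv _ (by simp), hb]
      · omega
      · omega
      · rwa [ha₁, ha₁, ha _ (by simp), ha _ (by simp)]
      · rw [hj₁, h5]
        exact h2.succ
      · rwa [hj₁, hx₁, ha₁]
      rintro σ₂ τ₂ ⟨h6, rfl⟩ hF₂
      have hj₂ : σ₂.v .j = σ'.v .j := (hF₂.1 _ (by simp [markStep, Stmt.setsVar])).trans hj₁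
      have hy₂ : σ₂.v .y = σ₁.v .y := hF₂.1 _ (by simp [markStep, Stmt.setsVar])
      rw [hj₁] at h6
      simp [MarkInv, hj₂, hy₂]
      refine ⟨by omega, by omega, ?_, h6, by omega⟩
      rw [Nat.sub_add_cancel (by omega), h5]
      exact h2.succ
    · simp at hge
      rw [hge, Nat.zero_min] at h3
      exact ⟨h3.marks, by omega⟩

/-- Compare the suffixes at the marked positions `j < i`, and drop one of them. -/
def duel : Stmt :=
  .l ::= .lit 0 ;; extendRight ;;
    .ite (.lt (.get .text (Var.j + Var.l)) (.get .text (Var.i + Var.l)))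
      -- The loser eliminates the positions after it by `t` with `b + t ≤ l`; this is the first
      -- position that survives.
      (.y ::= Var.i + Var.l + .lit 1 - Var.b)
      (.y ::= Var.j + Var.l + .lit 1 - Var.b ;; .j ::= Var.i) ;;
    .i ::= Var.i + Var.b + .lit 1 ;; .ite (.lt Var.i Var.y) (.i ::= Var.y) .skip

/-- Find the least center among the marked positions. -/
def select : Stmt :=
  .j ::= .lit 1 ;; .while (.eq (.get .fl Var.j) (.lit 0)) (.j ::= Var.j + .lit 1) ;;
    .i ::= Var.j + .lit 1 ;;
    .while (.lt Var.i (Var.n + .lit 1))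
      (.ite (.eq (.get .fl Var.i) (.lit 0)) (.i ::= Var.i + .lit 1) duel)

/-- The invariant of the second loop in `select`. -/
def SelectInv (n s K : ℕ) (σ : St) (τ : ℕ) : Prop :=
  1 ≤ σ.v .j ∧ σ.v .j < σ.v .i ∧ σ.v .j ≤ n ∧ σ.v .i ≤ 4 * n + 2 ∧ σ.a .fl (σ.v .j) ≠ 0 ∧
    -- A duel with a match of length `k` increases `i + j` by at least `b + 1` and by at least `k +
    -- 1 - b`, hence by at least half of `k + 2`. Twice this increase pays for the letters and for
    -- the iteration.
    (s = σ.v .j ∨ σ.v .i ≤ s) ∧ 2 * (5 * n + 2 - (σ.v .i + σ.v .j)) + K ≤ τ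

theorem duel_spec {T : ℕ → ℕ} {n b p s K : ℕ} (hT : IsTripled T n) (hbn : b < n) (hbp : b + p = n)
    (hV : 5 * n + 3 ≤ V) (hn : σ.v .n = n) (hb : σ.v .b = b) (ht : σ.a .text = T)
    (hm : Marks T n b p (σ.a .fl)) (hs : LeastCenter T n b p s) (h : SelectInv n s K σ (τ + 1))
    (hi : σ.v .i ≤ n) (hfi : σ.a .fl (σ.v .i) ≠ 0) : wp V B duel (SelectInv n s K) σ τ := by
  obtain ⟨h1, h2, h3, h4, h5, h6, h7⟩ := h
  have hgap := hm.far _ _ h5 hfi h2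
  unfold duel
  simp only [wp_seq, wp_assign]
  refine ⟨by simp, ?_⟩
  refine (extendRight_spec (N := 3 * n + 1) ?_ ?_ ?_ ?_ ?_ ?_).apply ?_
  · simpa [ht] using hT.text
  · simpa
  · simp; omega
  · simp
  · omega
  · simp; omega
  rintro σ₁ τ₁ ⟨h8, h9, -⟩ hF₁
  have hj₁ : σ₁.v .j = σ.v .j := (hF₁.1 _ (by simp [extendRight, Stmt.setsVar])).trans (by simp)
  have hi₁ : σ₁.v .i = σ.v .i := (hF₁.1 _ (by simp [extendRight, Stmt.setsVar])).trans (by simp)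
  have hb₁ : σ₁.v .b = b := (hF₁.1 _ (by simp [extendRight, Stmt.setsVar])).trans (by simpa)
  have ha₁ : ∀ A, σ₁.a A = σ.a A := fun A =>
    (hF₁.2 _ (by simp [extendRight, Stmt.setsArr])).trans (by simp)
  simp [ht] at h8 h9
  have hk := hT.text.le_of_match h2 (by omega) (.inl h1) h8.1
  generalize hl : σ₁.v .l = k at *
  have hkey : ∀ σ' : St, ∀ e, σ'.a = σ.a → σ'.v .i = max (σ.v .i + b + 1) e →
      (σ.a .text (σ.v .j + k) < σ.a .text (σ.v .i + k) ∧ e = σ.v .i + k + 1 - b ∧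
        σ'.v .j = σ.v .j ∨
      σ.a .text (σ.v .i + k) < σ.a .text (σ.v .j + k) ∧ e = σ.v .j + k + 1 - b ∧
        σ'.v .j = σ.v .i) → SelectInv n s K σ' τ₁ := by
    rintro σ' e ha' hi' (⟨hlt, he, hj'⟩ | ⟨hlt, he, hj'⟩)
    · refine ⟨by omega, by omega, by omega, by omega, by rwa [ha', hj'], ?_, by omega⟩
      rcases h6 with h6 | h6
      · exact .inl (h6.trans hj'.symm)
      · right
        by_contra hc
        -- The least center is marked, and no other mark lies within distance `b` after `i`.
        have h10 : s < σ.v .i + b + 1 → s = σ.v .i := by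
          intro h10
          by_contra hne
          have := hm.far _ _ hfi (hm.least s hs) (by omega)
          omega
        rw [ht] at hlt
        refine hs.not_right (t := s - σ.v .i) hT hbp h1 h2 (hm.center _ h5).2.2
          (hm.center _ hfi).2.2 h8.1 hlt ?_ (by omega)
        omega
    · refine ⟨by omega, by omega, by omega, by omega, by rwa [ha', hj'], ?_, by omega⟩
      rw [ht] at hlt
      have hnl : ∀ t, t = 0 ∨ b + t ≤ k → s ≠ σ.v .j + t := fun t =>
        hs.not_left hT hbp h1 h2 hi (hm.center _ h5).2.2 (hm.center _ hfi).2.2 h8.1 hlt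
      have h10 := hnl 0 (.inl rfl)
      rcases h6 with h6 | h6
      · exact absurd h6 h10
      · by_contra hc
        push Not at hc
        have h11 := hm.far _ _ hfi (hm.least s hs) (by omega)
        exact hnl (s - σ.v .j) (by omega) (by omega)
  simp [hj₁, hi₁, hb₁, ha₁, ht, hl]
  refine ⟨by omega, fun hlt => ⟨by omega, by omega, fun h => ?_, fun h => ?_⟩,
    fun hge => ⟨by omega, by omega, fun h => ?_, fun h => ?_⟩⟩
  · refine hkey _ (σ.v .i + k + 1 - b) ?_ ?_ (.inl ⟨by rwa [ht], rfl, ?_⟩)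
    · funext A; simp [ha₁]
    · simp; omega
    · simp [hj₁]
  · refine hkey _ (σ.v .i + k + 1 - b) ?_ ?_ (.inl ⟨by rwa [ht], rfl, ?_⟩)
    · funext A; simp [ha₁]
    · simp [hi₁, hb₁]; omega
    · simp [hj₁]
  · refine hkey _ (σ.v .j + k + 1 - b) ?_ ?_ (.inr ⟨?_, rfl, ?_⟩)
    · funext A; simp [ha₁]
    · simp; omega
    · rw [ht]; exact lt_of_le_of_ne hge h8.2.symm
    · simp [hi₁]
  · refine hkey _ (σ.v .j + k + 1 - b) ?_ ?_ (.inr ⟨?_, rfl, ?_⟩)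
    · funext A; simp [ha₁]
    · simp [hi₁, hb₁]; omega
    · rw [ht]; exact lt_of_le_of_ne hge h8.2.symm
    · simp [hi₁]

theorem select_spec {T : ℕ → ℕ} {n b p s K : ℕ} (hT : IsTripled T n) (hbn : b < n)
    (hbp : b + p = n) (hV : 5 * n + 3 ≤ V) (hn : σ.v .n = n) (hb : σ.v .b = b)
    (ht : σ.a .text = T) (hm : Marks T n b p (σ.a .fl)) (hs : LeastCenter T n b p s)
    (hτ : 11 * n + 4 + K ≤ τ) :
    wp V B select (fun σ' τ' => σ'.v .j = s ∧ K ≤ τ') σ τ := by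
  have hs1 := hs.one_le
  have hs2 := hs.le
  unfold select
  simp only [wp_seq, wp_assign]
  refine ⟨by simp; omega, ?_⟩
  refine (wp_while (fun σ' τ' => 1 ≤ σ'.v .j ∧ σ'.v .j ≤ s ∧ 10 * n + 4 + K + (n - σ'.v .j) ≤ τ')
    (Q := fun σ' τ' => 1 ≤ σ'.v .j ∧ σ'.v .j ≤ s ∧ σ.a .fl (σ'.v .j) ≠ 0 ∧ 10 * n + 4 + K ≤ τ')
    ?_ ?_).apply ?_
  · simp; omega
  · rintro σ' τ' ⟨h1, h2, h3⟩ hF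
    have ha : σ'.a .fl = σ.a .fl := (hF.2 _ (by simp [Stmt.setsArr])).trans (by simp)
    simp [ha]
    refine ⟨fun h0 => ?_, fun h0 => ⟨h1, h2, h0, by omega⟩⟩
    have : σ'.v .j ≠ s := fun h4 => hm.least s hs (h4 ▸ h0)
    omega
  rintro σ₁ τ₁ ⟨h1, h2, h3, h4⟩ hF₁
  have hv₁ : ∀ x, x ≠ .j → σ₁.v x = σ.v x := fun x hx =>
    (hF₁.1 _ (by simp [Stmt.setsVar, hx])).trans (by simp [hx])
  have ha₁ : ∀ A, σ₁.a A = σ.a A := fun A => (hF₁.2 _ (by simp [Stmt.setsArr])).trans (by simp)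
  refine ⟨by simp; omega, ?_⟩
  refine wp_while (SelectInv n s K) ?_ ?_
  · simp [SelectInv, ha₁, h3]
    omega
  · rintro σ₂ τ₂ hI hF₂
    have hv₂ : ∀ x, x = .n ∨ x = .b → σ₂.v x = σ.v x := by
      rintro x (rfl | rfl) <;>
        exact (hF₂.1 _ (by simp [duel, extendRight, Stmt.setsVar])).trans (by simp [hv₁])
    have ha₂ : ∀ A, σ₂.a A = σ.a A := fun A =>
      (hF₂.2 _ (by simp [duel, extendRight, Stmt.setsArr])).trans (by simp [ha₁])
    have hI' := hI
    obtain ⟨h5, h6, h7, h8, h9, h10, h11⟩ := hI'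
    refine ⟨by simp [hv₂, hn]; omega, fun hlt => ?_, fun hge => ?_⟩
    · simp [hv₂, hn] at hlt
      refine ⟨by omega, ?_⟩
      simp only [wp_ite]
      refine ⟨by simp, fun h0 => ?_, fun h0 => ?_⟩
      · simp at h0
        have h12 : s ≠ σ₂.v .i := by
          rintro rfl
          rw [ha₂] at h0
          exact hm.least _ hs h0
        simp [SelectInv]
        exact ⟨by omega, h5, by omega, h7, by omega, h9, by omega, by omega⟩
      · refine duel_spec hT hbn hbp hV ?_ ?_ ?_ ?_ hs ?_ ?_ ?_
        · rw [hv₂ _ (by simp), hn]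
        · rw [hv₂ _ (by simp), hb]
        · rw [ha₂, ht]
        · rwa [ha₂]
        · rwa [Nat.sub_add_cancel (by omega)]
        · omega
        · simpa using h0
    · simp [hv₂, hn] at hge
      exact ⟨by omega, by omega⟩

end WordRAM

/-! ### The text of a circular word -/

namespace CircularWord

/-- Three copies of `w` and a great last letter. -/
def tripled (w : List ℕ) (k : ℕ) : ℕ :=
  if k = 0 then 0 else if k ≤ 3 * w.length then w.getD ((k - 1) % w.length) 0
  else if k = 3 * w.length + 1 then w.length + 2 else 0

variable {w : List ℕ}

theorem tripled_add {i t : ℕ} (hi : 1 ≤ i) (hit : i + t ≤ 3 * w.length) :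
    tripled w (i + t) = w.getD ((i - 1 + t) % w.length) 0 := by
  rw [tripled, if_neg (by omega), if_pos hit]
  congr 2; omega

theorem getD_mod_bounds (hw : w ≠ []) (h : ∀ a ∈ w, 1 ≤ a ∧ a ≤ max 2 w.length) (k : ℕ) :
    1 ≤ w.getD (k % w.length) 0 ∧ w.getD (k % w.length) 0 ≤ w.length + 1 := by
  have hn := List.length_pos_iff.2 hw
  rw [List.getD_eq_getElem _ _ (Nat.mod_lt _ hn)]
  have := h _ (List.getElem_mem (Nat.mod_lt k hn))
  omega

theorem isTripled (hw : w ≠ []) (h : ∀ a ∈ w, 1 ≤ a ∧ a ≤ max 2 w.length) :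
    IsTripled (tripled w) w.length := by
  have hn := List.length_pos_iff.2 hw
  have hb : ∀ k, 1 ≤ k → k ≤ 3 * w.length → 1 ≤ tripled w k ∧ tripled w k ≤ w.length + 1 := by
    intro k h1 h2
    rw [tripled, if_neg (by omega), if_pos h2]
    exact getD_mod_bounds hw h _
  have hl : tripled w (3 * w.length + 1) = w.length + 2 := by
    rw [tripled, if_neg (by omega), if_neg (by omega), if_pos rfl]
  refine ⟨⟨rfl, fun i h1 h2 => ?_, fun i hi => ?_⟩, fun k h1 h2 => ?_, fun k h1 h2 => (hb k h1 h2).2,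
    hl, hn⟩
  · rcases Nat.lt_or_eq_of_le h2 with h3 | rfl
    · exact (hb i h1 (by omega)).1
    · rw [hl]; omega
  · rw [tripled, if_neg (by omega), if_neg (by omega), if_neg (by omega)]
  · rw [tripled, if_neg (by omega), if_pos (by omega), tripled, if_neg (by omega), if_pos (by omega),
      show k + w.length - 1 = k - 1 + w.length by omega, Nat.add_mod_right]

end CircularWord

/-! ### Building the text and assembling the program -/

namespace WordRAM

open CircularWord

variable {V B : ℕ} {σ : St} {τ : ℕ}

/-- Write the text that belongs to the input, and a second copy of the input. -/
def build : Stmt :=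
  .i ::= .lit 0 ;;
    -- With two adjacent copies of the input, every conjugate is a contiguous stretch of memory. The
    -- output `v` is a prefix of it and has the same address.
    .while (.lt Var.i Var.n) (.store .raw (Var.n + Var.i) (.get .raw Var.i) ;; .i ::= Var.i + .lit 1) ;;
    .N ::= Var.n + Var.n + Var.n + .lit 1 ;; .i ::= .lit 1 ;;
    .while (.lt Var.i Var.N)
      (.store .text Var.i (.get .raw ((Var.i - .lit 1) % Var.n)) ;; .i ::= Var.i + .lit 1) ;;
    .store .text Var.N (Var.n + .lit 2)

theorem build_spec {w : List ℕ} {K : ℕ} (hw : w ≠ []) (hV : 3 * w.length + 2 ≤ V)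
    (hn : σ.v .n = w.length) (hr : ∀ i, σ.a .raw i = w.getD i 0) (ht : ∀ i, σ.a .text i = 0)
    (hτ : 4 * w.length + K ≤ τ) :
    wp V (2 * w.length) build (fun σ' τ' => σ'.v .N = 3 * w.length + 1 ∧ σ'.a .text = tripled w ∧
      (∀ i < 2 * w.length, σ'.a .raw i = w.getD (i % w.length) 0) ∧ K ≤ τ') σ τ := by
  have hn1 := List.length_pos_iff.2 hw
  unfold build
  simp only [wp_seq, wp_assign]
  refine ⟨by simp, ?_⟩
  refine (wp_while (fun σ' τ' => σ'.v .i ≤ w.length ∧ (∀ i, i < w.length + σ'.v .i →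
      σ'.a .raw i = w.getD (i % w.length) 0) ∧ 4 * w.length + K - σ'.v .i ≤ τ')
    (Q := fun σ' τ' => (∀ i < 2 * w.length, σ'.a .raw i = w.getD (i % w.length) 0) ∧
      3 * w.length + K ≤ τ') ?_ ?_).apply ?_
  · simp [hr]
    exact ⟨fun i hi => by rw [Nat.mod_eq_of_lt hi], by omega⟩
  · rintro σ' τ' ⟨h1, h2, h3⟩ hF
    have hn' : σ'.v .n = w.length := (hF.1 _ (by simp [Stmt.setsVar])).trans (by simpa)
    simp [hn']
    refine ⟨fun hlt => ⟨by omega, ⟨by omega, by omega, by omega⟩, by omega, by omega,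
      fun i hi => ?_, by omega⟩, fun hge => ⟨fun i hi => h2 i (by omega), by omega⟩⟩
    by_cases hi2 : i = w.length + σ'.v .i
    · subst hi2
      rw [Function.update_self, h2 _ (by omega), Nat.add_mod_left]
      rfl
    · rw [Function.update_of_ne hi2]
      exact h2 i (by omega)
  rintro σ₁ τ₁ ⟨h1, h2⟩ hF₁
  have hn₁ : σ₁.v .n = w.length := (hF₁.1 _ (by simp [Stmt.setsVar])).trans (by simpa)
  have ht₁ : ∀ k, σ₁.a .text k = 0 := fun k => by
    rw [(hF₁.2 .text (by simp [Stmt.setsArr])).trans rfl, ← ht k]; rfl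
  refine ⟨by simp [hn₁]; omega, by simp; omega, ?_⟩
  refine (wp_while (fun σ' τ' => 1 ≤ σ'.v .i ∧ σ'.v .i ≤ 3 * w.length + 1 ∧
      (∀ k, σ'.a .text k = if k < σ'.v .i then tripled w k else 0) ∧
      3 * w.length + 1 + K - σ'.v .i ≤ τ')
    (Q := fun σ' τ' => (∀ k, σ'.a .text k = if k < 3 * w.length + 1 then tripled w k else 0) ∧
      K ≤ τ') ?_ ?_).apply ?_
  · simp [ht₁]
    exact ⟨rfl, by omega⟩
  · rintro σ' τ' ⟨h3, h4, h5, h6⟩ hF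
    have hn' : σ'.v .n = w.length := (hF.1 _ (by simp [Stmt.setsVar])).trans (by simpa)
    have hN' : σ'.v .N = 3 * w.length + 1 :=
      (hF.1 _ (by simp [Stmt.setsVar])).trans (by simp [hn₁]; omega)
    have hr' : ∀ i < 2 * w.length, σ'.a .raw i = w.getD (i % w.length) 0 := fun i hi => by
      rw [hF.2 .raw (by simp [Stmt.setsArr])]; exact h1 i hi
    have hmod := Nat.mod_lt (σ'.v .i - 1) hn1
    simp [hn', hN']
    refine ⟨fun hlt => ⟨by omega, ⟨by omega, by omega⟩, by omega, by omega, fun k => ?_, by omega⟩,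
      fun hge => ⟨fun k => ?_, by omega⟩⟩
    · by_cases hk : k = σ'.v .i
      · subst hk
        rw [Function.update_self, hr' _ (by omega), Nat.mod_mod, if_pos (by omega), tripled,
          if_neg (by omega), if_pos (by omega)]
      · rw [Function.update_of_ne hk, h5]
        congr 1
        simp; omega
    · rw [h5, show σ'.v .i = 3 * w.length + 1 by omega]
      exact if_congr (by omega) rfl rfl
  rintro σ₂ τ₂ ⟨h3, h4⟩ hF₂
  have hn₂ : σ₂.v .n = w.length := (hF₂.1 _ (by simp [Stmt.setsVar])).trans (by simpa)
  have hN₂ : σ₂.v .N = 3 * w.length + 1 :=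
    (hF₂.1 _ (by simp [Stmt.setsVar])).trans (by simp [hn₁]; omega)
  have hr₂ : ∀ i < 2 * w.length, σ₂.a .raw i = w.getD (i % w.length) 0 := fun i hi => by
    rw [hF₂.2 .raw (by simp [Stmt.setsArr])]; exact h1 i hi
  simp [hn₂, hN₂]
  refine ⟨⟨by omega, by omega⟩, ?_, hr₂, h4⟩
  funext k
  by_cases hk : k = 3 * w.length + 1
  · subst hk
    rw [Function.update_self, tripled, if_neg (by omega), if_neg (by omega), if_pos rfl]
  · rw [Function.update_of_ne hk, h3]
    split_ifs with h5
    · rfl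
    · rw [tripled, if_neg (by omega), if_neg (by omega), if_neg hk]

/-- Compute the length `p` of the minimal representation, the position `j` of a conjugate that is
represented by it, and `x = j - 1`. -/
def findMinimal : Stmt :=
  build ;; longestSquare ;; .p ::= Var.n - Var.b ;; markPass ;; select ;; .x ::= Var.j - .lit 1

/-- With `N = 3 * n + 1`, the credits are `4 * n` for `build`, `22 * N + 20` for `longestSquare`, `2
* n` for `markPass` and `11 * n + 4` for `select`. -/
theorem findMinimal_spec {w : List ℕ} (hw : w ≠ []) (hσ : ∀ a ∈ w, 1 ≤ a ∧ a ≤ max 2 w.length)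
    (hV : 6 * w.length + 5 ≤ V) (hn : σ.v .n = w.length) (hr : ∀ i, σ.a .raw i = w.getD i 0)
    (h0 : ∀ A, A ≠ .raw → ∀ i, σ.a A i = 0) (hτ : 83 * w.length + 46 ≤ τ) :
    wp V (2 * w.length) findMinimal (fun σ' _ => ∃ b s, b < w.length ∧
      LeastCenter (tripled w) w.length b (w.length - b) s ∧
      (∀ k < w.length, ∀ x, 1 ≤ x → x ≤ w.length → Center (tripled w) k (w.length - k) x → k ≤ b) ∧
      σ'.v .p = w.length - b ∧ σ'.v .j = s ∧ σ'.v .x = s - 1 ∧ σ'.v .n = w.length ∧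
      ∀ i < 2 * w.length, σ'.a .raw i = w.getD (i % w.length) 0) σ τ := by
  have hT := isTripled hw hσ
  have hn1 := hT.one_le
  have hv : ∀ S, S = longestSquare ∨ S = markPass ∨ S = select →
      S.setsVar .n = false ∧ S.setsArr .raw = false := by
    rintro S (rfl | rfl | rfl) <;>
      simp [longestSquare, flip, findSquares, edges, clearLoop, edgesBody, copyLoop, copyBody,
        compareLoop, compareBody, extendRight, leftPass, leftBody, leftCompare, extendLeft, bestPass,
        bestBody, markPass, countStep, markStep, select, duel, Stmt.setsVar, Stmt.setsArr]
  have hv' : ∀ S, S = markPass ∨ S = select →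
      S.setsVar .b = false ∧ S.setsVar .p = false ∧ S.setsArr .text = false := by
    rintro S (rfl | rfl) <;>
      simp [extendRight, markPass, countStep, markStep, select, duel, Stmt.setsVar, Stmt.setsArr]
  have hfl : ∀ S, S = build ∨ S = longestSquare → S.setsArr .fl = false := by
    rintro S (rfl | rfl) <;>
      simp [build, longestSquare, flip, findSquares, edges, clearLoop, edgesBody, copyLoop, copyBody,
        compareLoop, compareBody, extendRight, leftPass, leftBody, leftCompare, extendLeft, bestPass,
        bestBody, Stmt.setsArr]
  unfold findMinimal
  simp only [wp_seq, wp_assign]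
  refine (build_spec (K := 79 * w.length + 46) hw (by omega) hn hr (h0 _ (by simp))
    (by omega)).apply ?_
  rintro σ₁ τ₁ ⟨hN₁, ht₁, hr₁, hτ₁⟩ hF₁
  have hn₁ : σ₁.v .n = w.length := (hF₁.1 _ (by simp [build, Stmt.setsVar])).trans hn
  have hfl₁ : ∀ i, σ₁.a .fl i = 0 := fun i => by
    rw [hF₁.2 _ (hfl _ (by simp))]; exact h0 _ (by simp) i
  refine (longestSquare_spec (n := w.length) (K := 13 * w.length + 4) hT.text (by omega)
    (fun i _ _ => ?_) hn1 (by omega) hN₁ hn₁ ht₁ (by omega)).apply ?_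
  · rcases eq_or_ne i (3 * w.length + 1) with rfl | hi
    · rw [hT.last]; omega
    · have := hT.lt_last hi; omega
  rintro σ₂ τ₂ ⟨hb₂, hsq, hmax, hns, ht₂, hτ₂⟩ hF₂
  have hn₂ : σ₂.v .n = w.length := (hF₂.1 _ (hv _ (by simp)).1).trans hn₁
  have hr₂ : σ₂.a .raw = σ₁.a .raw := hF₂.2 _ (hv _ (by simp)).2
  have hfl₂ : ∀ i, σ₂.a .fl i = 0 := fun i => by
    rw [hF₂.2 _ (hfl _ (by simp))]; exact hfl₁ i
  refine ⟨by simp, ?_⟩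
  generalize hb : σ₂.v .b = b at *
  refine (markPass_spec (n := w.length) (b := b) (p := w.length - b) (K := 11 * w.length + 4) hT hb₂
    (Nat.sub_le _ _) (by omega) ?_ ?_ ?_ ?_ ?_ ?_ ?_).apply ?_
  · simpa
  · simpa
  · simp [hn₂, hb]
  · simpa
  · simpa
  · simpa
  · omega
  rintro σ₃ τ₃ ⟨hm, hτ₃⟩ hF₃
  have hn₃ : σ₃.v .n = w.length := (hF₃.1 _ (hv _ (by simp)).1).trans (by simpa)
  have hr₃ : σ₃.a .raw = σ₁.a .raw := (hF₃.2 _ (hv _ (by simp)).2).trans (by simpa)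
  have hb₃ : σ₃.v .b = b := (hF₃.1 _ (hv' _ (by simp)).1).trans (by simpa)
  have hp₃ : σ₃.v .p = w.length - b := (hF₃.1 _ (hv' _ (by simp)).2.1).trans (by simp [hn₂, hb])
  have ht₃ : σ₃.a .text = tripled w := (hF₃.2 _ (hv' _ (by simp)).2.2).trans (by simpa)
  obtain ⟨x, hx1, hxn, hx⟩ := hT.exists_center hb₂ hsq
  obtain ⟨s, hs⟩ := hT.exists_least hx1 hxn hx
  refine (select_spec (K := 0) hT hb₂ (by omega) (by omega) hn₃ hb₃ ht₃ hm hs (by omega)).apply ?_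
  rintro σ₄ τ₄ ⟨hj₄, -⟩ hF₄
  have hn₄ : σ₄.v .n = w.length := (hF₄.1 _ (hv _ (by simp)).1).trans hn₃
  have hr₄ : σ₄.a .raw = σ₁.a .raw := (hF₄.2 _ (hv _ (by simp)).2).trans hr₃
  have hp₄ : σ₄.v .p = w.length - b := (hF₄.1 _ (hv' _ (by simp)).2.1).trans hp₃
  refine ⟨by simp; omega, b, s, hb₂, hs, fun k hk x h1 h2 h3 => hmax k hk (hT.hasSquare hk h1 h2 h3),
    by simpa, by simpa, by simp [hj₄], by simpa, ?_⟩
  simp only [St.set_a, hr₄]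
  exact hr₁

end WordRAM

/-! ### Minimal representations -/

namespace CircularWord

variable {w u : List ℕ}

theorem getD_flatten_replicate (u : List ℕ) (m k : ℕ) (hk : k < m * u.length) :
    (List.replicate m u).flatten.getD k 0 = u.getD (k % u.length) 0 := by
  induction m generalizing k with
  | zero => omega
  | succ m ih =>
    rw [List.replicate_succ, List.flatten_cons]
    rcases Nat.lt_or_ge k u.length with h | h
    · rw [List.getD_append _ _ _ _ h, Nat.mod_eq_of_lt h]
    · rw [List.getD_append_right _ _ _ _ h, ih _ (by rw [Nat.succ_mul] at hk; omega),
        Nat.mod_eq_sub_mod h]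

theorem le_mul_length (hu : u ≠ []) (n : ℕ) : n ≤ n * u.length :=
  Nat.le_mul_of_pos_right n (List.length_pos_iff.2 hu)

theorem length_fracPow (hu : u ≠ []) (n : ℕ) : (fracPow u n).length = n := by
  simpa [fracPow] using le_mul_length hu n

theorem getD_fracPow (hu : u ≠ []) {n k : ℕ} (hk : k < n) :
    (fracPow u n).getD k 0 = u.getD (k % u.length) 0 := by
  rw [← getD_flatten_replicate u n k (hk.trans_le (le_mul_length hu n)), fracPow]
  simp [List.getD_eq_getElem?_getD, List.getElem?_take, hk]

theorem ext_getD {u v : List ℕ} (h : u.length = v.length)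
    (h' : ∀ k < u.length, u.getD k 0 = v.getD k 0) : u = v := by
  refine List.ext_getElem h fun k h1 h2 => ?_
  have := h' k h1
  rwa [List.getD_eq_getElem _ _ h1, List.getD_eq_getElem _ _ h2] at this

theorem getD_rotate (hw : w ≠ []) {i t : ℕ} (hi : 1 ≤ i) (hin : i ≤ w.length) (ht : t < w.length) :
    (w.rotate (i - 1)).getD t 0 = tripled w (i + t) := by
  have hn := List.length_pos_iff.2 hw
  rw [tripled_add hi (by omega), List.getD_eq_getElem _ _ (by simpa), List.getElem_rotate,
    List.getD_eq_getElem _ _ (Nat.mod_lt _ hn)]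
  congr 2; omega

theorem getD_take {k p : ℕ} (hk : k < p) : (u.take p).getD k 0 = u.getD k 0 := by
  simp [List.getD_eq_getElem?_getD, List.getElem?_take, hk]

/-- A border of length `b` amounts to the period `n - b`, so the conjugate is recovered by repeating
its prefix of that length. -/
theorem fracPow_take_of_center (hw : w ≠ []) {b s : ℕ} (hb : b < w.length) (hs : 1 ≤ s)
    (hsn : s ≤ w.length) (hc : Center (tripled w) b (w.length - b) s) :
    fracPow ((w.rotate (s - 1)).take (w.length - b)) w.length = w.rotate (s - 1) := by
  have hl : ((w.rotate (s - 1)).take (w.length - b)).length = w.length - b := by simp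
  have hne : (w.rotate (s - 1)).take (w.length - b) ≠ [] := by
    rw [← List.length_pos_iff, hl]; omega
  refine ext_getD (by rw [length_fracPow hne, List.length_rotate]) fun k hk => ?_
  rw [length_fracPow hne] at hk
  rw [getD_fracPow hne hk, hl, getD_take (Nat.mod_lt _ (by omega))]
  induction k using Nat.strong_induction_on with
  | _ k ih =>
    rcases Nat.lt_or_ge k (w.length - b) with h | h
    · rw [Nat.mod_eq_of_lt h]
    · rw [Nat.mod_eq_sub_mod h, ih _ (by omega) (by omega), getD_rotate hw hs hsn (by omega),
        getD_rotate hw hs hsn hk, hc _ (by omega)]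
      congr 1; omega

theorem IsRepresentation.exists_center (hw : w ≠ []) (h : IsRepresentation w (u, w.length)) :
    ∃ x, 1 ≤ x ∧ x ≤ w.length ∧ u = (w.rotate (x - 1)).take u.length ∧
      Center (tripled w) (w.length - u.length) u.length x := by
  obtain ⟨hu, hle, -, hm⟩ := h
  have hn := List.length_pos_iff.2 hw
  obtain ⟨m, hm⟩ := hm.symm
  simp only at hu hle hm
  have he : fracPow u w.length = w.rotate (m % w.length + 1 - 1) := by
    rw [Nat.add_sub_cancel, List.rotate_mod, hm]
  have hx := Nat.mod_lt m hn
  have hg : ∀ t < w.length, (w.rotate (m % w.length + 1 - 1)).getD t 0 = u.getD (t % u.length) 0 :=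
    fun t ht => by rw [← he, getD_fracPow hu ht]
  refine ⟨m % w.length + 1, by omega, by omega, ?_, fun t ht => ?_⟩
  · refine ext_getD (by simp [hle]) fun t ht => ?_
    rw [getD_take ht, hg t (by omega), Nat.mod_eq_of_lt ht]
  · rw [Nat.add_assoc (m % w.length + 1), ← getD_rotate hw (by omega) (by omega) (by omega),
      hg _ (by omega), ← getD_rotate hw (by omega) (by omega) (by omega), hg _ (by omega), Nat.add_mod_left]

theorem isMinimalRepresentation (hw : w ≠ []) {b s : ℕ} (hb : b < w.length)
    (hs : LeastCenter (tripled w) w.length b (w.length - b) s)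
    (hmax : ∀ k < w.length, ∀ x, 1 ≤ x → x ≤ w.length →
      Center (tripled w) k (w.length - k) x → k ≤ b) :
    IsMinimalRepresentation w ((w.rotate (s - 1)).take (w.length - b), w.length) := by
  have hl : ((w.rotate (s - 1)).take (w.length - b)).length = w.length - b := by simp
  have hne : (w.rotate (s - 1)).take (w.length - b) ≠ [] := by
    rw [← List.length_pos_iff, hl]; omega
  refine ⟨⟨hne, by rw [hl]; exact Nat.sub_le _ _, rfl, ?_⟩, ?_⟩
  · show fracPow _ _ ~r w
    rw [fracPow_take_of_center hw hb hs.one_le hs.le hs.center]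
    exact (List.IsRotated.forall w _)
  · rintro ⟨u, n'⟩ hr hne'
    obtain rfl : n' = w.length := hr.2.2.1
    obtain ⟨x, hx1, hxn, hux, hc⟩ := IsRepresentation.exists_center hw hr
    have hu := List.length_pos_iff.2 hr.1
    have hle : u.length ≤ w.length := hr.2.1
    simp only at hu ⊢
    rw [hl]
    have h1 := hmax (w.length - u.length) (by omega) x hx1 hxn
      (by rwa [Nat.sub_sub_self hle])
    rcases Nat.lt_or_ge (w.length - b) u.length with h2 | h2
    · exact .inl h2
    refine .inr ⟨by omega, ?_⟩
    have h3 : u.length = w.length - b := by omega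
    rw [h3, show w.length - (w.length - b) = b by omega] at hc
    rw [h3] at hux
    by_cases hxs : x = s
    · subst hxs
      exact absurd (by rw [← hux]) hne'
    obtain ⟨k, hk, hlt⟩ := hs.least x hx1 hxn hc hxs
    have hv : ∀ t < w.length - b, ((w.rotate (s - 1)).take (w.length - b)).getD t 0 =
        tripled w (s + t) := fun t ht => by
      rw [getD_take ht, getD_rotate hw hs.one_le hs.le (by omega)]
    have hu' : ∀ t < w.length - b, u.getD t 0 = tripled w (x + t) := fun t ht => by
      rw [hux, getD_take ht, getD_rotate hw hx1 hxn (by omega)]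
    -- A mismatch within the first `n - b` letters decides the lexicographic order of the two words;
    -- a later one means that they are equal.
    rcases Nat.lt_or_ge k (w.length - b) with h4 | h4
    · refine List.lt_iff_exists.2 (.inr ⟨k, by rwa [hl], by rwa [h3], fun j hj => ?_, ?_⟩)
      · rw [← List.getD_eq_getElem _ 0, ← List.getD_eq_getElem _ 0, hv j (by omega),
          hu' j (by omega), hk j hj]
      · rw [← List.getD_eq_getElem _ 0, ← List.getD_eq_getElem _ 0, hv k h4, hu' k h4]
        exact hlt
    · refine absurd ?_ hne'
      rw [ext_getD (u := u) (v := (w.rotate (s - 1)).take (w.length - b)) (by omega)]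
      intro t ht
      rw [hv t (by omega), hu' t (by omega), hk t (by omega)]

end CircularWord

/-! ### The algorithm -/

namespace WordRAM

open CircularWord

/-- Set the register of `n` and the address of the arrays. -/
def prologue : List Instr := [.op .add 5 0 0, .op .or Var.n.reg 0 0]

/-- Copy the results into the output registers. -/
def epilogue : List Instr :=
  [.op .or 0 Var.p.reg Var.p.reg, .op .or 1 Var.x.reg Var.x.reg, .op .or 2 Var.n.reg Var.n.reg,
    .op .or 3 Var.j.reg Var.j.reg, .op .or 4 Var.x.reg Var.x.reg]

/-- The program that computes minimal representations. -/
def minimalRepresentation : List Instr := prologue ++ (findMinimal.code 2 ++ epilogue)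

/-- The state of structured programs that corresponds to the input `w`. -/
def inputState (w : List ℕ) : St where
  v x := if x = .n then w.length else 0
  a A i := if A = .raw then w.getD i 0 else 0

theorem inputState_bdd {w : List ℕ} {V : ℕ} (h : ∀ a ∈ w, a ≤ V) (hV : w.length ≤ V) :
    (inputState w).Bdd V := by
  refine ⟨fun x => ?_, fun A i => ?_⟩
  · simp only [inputState]
    split_ifs
    · exact hV
    · exact Nat.zero_le V
  · simp only [inputState]
    split_ifs
    · rcases Nat.lt_or_ge i w.length with hi | hi
      · rw [List.getD_eq_getElem _ _ hi]
        exact h _ (List.getElem_mem hi)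
      · rw [List.getD_eq_default _ _ hi]
        exact Nat.zero_le V
    · exact Nat.zero_le V

theorem prologue_spec {w : List ℕ} {ℓ : ℕ} (hℓ : 2 * w.length < 2 ^ ℓ) {P : List Instr}
    (hP : prologue <+: P) :
    ∃ s, Reach ℓ P (init w) 2 s ∧ s.pc = 2 ∧ Rel (2 * w.length) (inputState w) s := by
  have hP' : prologue <+: P.drop (init w).pc := hP
  refine ⟨_, (Reach.one hP').trans (Reach.one (tail_prefix_drop hP')), rfl, fun x => ?_,
    fun A i hi => ?_, ?_⟩
  · have h1 : x.reg ≠ 5 := by unfold Var.reg; omega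
    have h2 : x.reg ≠ 0 := by unfold Var.reg; omega
    by_cases hx : x = .n
    · subst hx
      simp [Instr.exec, init, inputState, BinOp.eval, Function.update_apply]
      exact Nat.mod_eq_of_lt (by omega)
    · simp [Instr.exec, init, inputState, Function.update_apply, h1, h2, hx,
        Var.reg_injective.eq_iff]
  · by_cases hA : A = .raw
    · subst hA; rfl
    · rw [addr_of_ne i hA]
      simp only [Instr.exec, init, inputState, if_neg hA]
      exact List.getD_eq_default _ _ (by omega)
  · have h1 : 5 ≠ Var.n.reg := by unfold Var.reg; omega
    simp [Instr.exec, init, Function.update_apply, h1, BinOp.eval]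
    rw [← two_mul]
    exact Nat.mod_eq_of_lt hℓ

theorem epilogue_spec {V B ℓ : ℕ} {P : List Instr} {σ : St} {s : Config} (hV : V < 2 ^ ℓ)
    (hσ : σ.Bdd V) (hs : Rel B σ s) (hP : epilogue <+: P.drop s.pc) :
    ∃ t, Reach ℓ P s 5 t ∧ t.pc = s.pc + 5 ∧ t.mem = s.mem ∧ t.reg 0 = σ.v .p ∧ t.reg 1 = σ.v .x ∧
      t.reg 2 = σ.v .n ∧ t.reg 3 = σ.v .j ∧ t.reg 4 = σ.v .x := by
  have h1 := tail_prefix_drop hP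
  have h2 := tail_prefix_drop h1
  have h3 := tail_prefix_drop h2
  have h4 := tail_prefix_drop h3
  have hmod : ∀ x, σ.v x % 2 ^ ℓ = σ.v x := fun x => Nat.mod_eq_of_lt ((hσ.1 x).trans_lt hV)
  refine ⟨_, ((((Reach.one hP).trans (Reach.one h1)).trans (Reach.one h2)).trans
    (Reach.one h3)).trans (Reach.one h4), rfl, rfl, ?_⟩
  have hne : ∀ (x : Var) k, k < 5 → x.reg ≠ k := fun x k hk => by unfold Var.reg; omega
  simp [Instr.exec, BinOp.eval, Function.update_apply, hne, hs.reg, hmod]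

/-- A halted configuration is a fixed point of `step`, so surplus steps change nothing. -/
theorem HaltsWithin.of_reach {ℓ m T : ℕ} {P : List Instr} {s t : Config} (h : Reach ℓ P s m t)
    (hm : m ≤ T) (ht : P.length ≤ t.pc) : HaltsWithin ℓ P s T t := by
  have hfix : step ℓ P t = t := by
    unfold step
    rw [List.getElem?_eq_none ht]
  refine ⟨?_, ht⟩
  rw [← Nat.sub_add_cancel hm, Function.iterate_add_apply, show (step ℓ P)^[m] s = t from h]
  exact Function.iterate_fixed hfix _

end WordRAM

open WordRAM CircularWord

theorem mainTheorem8 :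
    ∃ (P : List WordRAM.Instr) (c C : ℕ),
      ∀ w : List ℕ, w ≠ [] → (∀ a ∈ w, 1 ≤ a ∧ a ≤ max 2 w.length) →
      ∀ ℓ : ℕ, c * w.length ≤ 2 ^ ℓ →
        ∃ s : WordRAM.Config,
          WordRAM.HaltsWithin ℓ P (WordRAM.init w) (C * w.length) s ∧
          ∃ (v : List ℕ) (i : ℕ),
            IsMinimalRepresentation w (v, w.length) ∧
            1 ≤ i ∧ i ≤ w.length ∧
            w.drop (i - 1) ++ w.take (i - 1) = fracPow v w.length ∧
            s.reg 0 = v.length ∧ s.HoldsWord (s.reg 1) v ∧ s.reg 2 = w.length ∧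
            s.reg 3 = i ∧ s.HoldsWord (s.reg 4) (w.drop (i - 1) ++ w.take (i - 1)) := by
  -- With `V = 16 * n` and `B = 2 * n`, `B + (8 * V + 8)` is at most `138 * n`. There are at most
  -- `83 * n + 46` loop iterations, and one more is at most `130 * n`; the prologue and the epilogue
  -- take 7 steps.
  refine ⟨minimalRepresentation, 256, findMinimal.len * 130 + 7, fun w hw hσ ℓ hℓ => ?_⟩
  have hn := List.length_pos_iff.2 hw
  obtain ⟨s₀, hs₀, hp₀, hr₀⟩ := prologue_spec (w := w) (ℓ := ℓ) (P := minimalRepresentation)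
    (by omega) (List.prefix_append _ _)
  obtain ⟨σ, k, hrun, hk, b, s, hb, hs, hmax, hp, hj, hx, hvn, hraw⟩ :=
    findMinimal_spec (V := 16 * w.length) (σ := inputState w) (τ := 83 * w.length + 46) hw hσ
      (by omega) rfl (fun _ => rfl) (fun A hA i => by simp [inputState, hA]) le_rfl
  have hbdd : (inputState w).Bdd (16 * w.length) :=
    inputState_bdd (fun a ha => by have := hσ a ha; omega) (by omega)
  have hP : findMinimal.code 2 ++ epilogue <+: minimalRepresentation.drop 2 := List.prefix_rfl
  have hP2 := prefix_drop_append.1 hP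
  obtain ⟨s₁, m, hs₁, hm, hp₁, hr₁⟩ := hrun.reach (P := minimalRepresentation) (ℓ := ℓ) (by omega)
    hbdd hr₀ (by rw [hp₀]; exact hP2.1)
  obtain ⟨s₂, hs₂, hp₂, hmem, h0, h1, h2, h3, h4⟩ := epilogue_spec (P := minimalRepresentation)
    (ℓ := ℓ) (by omega) (hrun.bdd hbdd) hr₁ (by
      rw [hp₁, hp₀]; rw [Stmt.length_code] at hP2; exact hP2.2)
  have hs1 := hs.one_le
  have hsn := hs.le
  have hrot : w.drop (s - 1) ++ w.take (s - 1) = w.rotate (s - 1) :=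
    (List.rotate_eq_drop_append_take (by omega)).symm
  have hmem' : ∀ t < w.length, s₂.mem (s - 1 + t) = (w.rotate (s - 1)).getD t 0 := by
    intro t ht
    rw [hmem, getD_rotate hw hs1 hsn ht, tripled_add hs1 (by omega), ← hraw _ (by omega)]
    exact hr₁.mem .raw _ fun _ => by omega
  refine ⟨s₂, .of_reach ((hs₀.trans hs₁).trans hs₂) ?_ ?_,
    (w.rotate (s - 1)).take (w.length - b), s, isMinimalRepresentation hw hb hs hmax, hs1, hsn,
    ?_, ?_, ?_, by rw [h2, hvn], by rw [h3, hj], ?_⟩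
  · have h5 : findMinimal.len * (k + 1) ≤ findMinimal.len * (130 * w.length) :=
      Nat.mul_le_mul_left _ (by omega)
    rw [Nat.add_mul, Nat.mul_assoc]
    omega
  · simp [minimalRepresentation, Stmt.length_code, prologue, epilogue]
    omega
  · rw [hrot, fracPow_take_of_center hw hb hs1 hsn hs.center]
  · simp [h0, hp]
  · intro t ht
    have ht' : t < w.length - b := by simpa using ht
    rw [h1, hx, hmem' t (by omega), ← List.getD_eq_getElem _ 0 ht, getD_take ht']
  · intro t ht
    have ht' : t < w.length := by simpa [hrot] using ht
    rw [h4, hx, hmem' t ht', ← List.getD_eq_getElem _ 0 ht, hrot]
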